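/- Let $S^1$ be the counterclockwise oriented circle of perimeter $1$ with initial point $u$. **Chord diagrams.** A labeled chord diagram with $n-1$ chords consists of points $x_j\neq y_j$ of $S^1$, $1\le j\le n-1$, such that the chords $[x_j,y_j]$ do not meet inside the disc, the closure of each of the $n$ regions into which they divide the disc meets $S^1$ in a set of positive measure, and a numbering of the regions by $1,\dots,n$ is given. The chords form a forest with vertices $x_j,y_j$. A marked diagram has in addition points $z_1,\dots,z_n\in S^1$ such that $z_i$ lies in the closure of the $i$-th region of the disc (so degenerate intervals, i.e. isolated points of this closure on $S^1$, are allowed). The topology is the one inherited from $(S^1)^{2n-2}\times (S^1)^n$, the numbering being locally constant. Identify two marked diagrams with the same underlying diagram if, for every $i$ with $z_i\ne z_i'$, the points $z_i,z_i'$ are vertices of the same tree; then divide by the action of $\mathfrak S_{n-1}\ltimes(\mathfrak S_2)^{n-1}$ permuting the chords and exchanging $x_j$ and $y_j$: this is $MC(n)$. The space $MD(n)$ of marked chord diagrams is the quotient of $MC(n)$ by the relation $\sim_f$: same marked points, same vertices, same partition of the vertices into trees, same labels of the intervals of $S^1$. The operad structure on $MD$: $\mathfrak S_n$ acts by renumbering;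 the composite $\gamma(c;c_1,\dots,c_m)$ is obtained by patching $c_i$, linearly rescaled, into the $i$-th loop of $c$ (the boundary of the $i$-th region with the chords contracted), the point $u$ of $c_i$ being put at $z_i$, and numbering the regions lexicographically; the unit is the diagram without chords and with $z_1=u$. **Cacti.** A point of $Cac(n)$ is a configuration of $n$ oriented parameterized circles (lobes) of sizes $r_i>0$, $\sum r_i=1$, glued at finitely many points so that the graph whose vertices are the lobes and the intersection points, and whose edges are the incidences, is a tree, with a cyclic order of the lobes at each intersection point, a base point $w$ and the choice of a lobe containing $w$. Tracing the boundary from $w$ gives the pinching map of $S^1$ onto the cactus; two cacti are close if their sizes and the projections $S^1\to S^1$ of their pinching maps to the $n$ parameterized lobes are uniformly close. In the operad $Cac$, $\mathfrak S_n$ renumbers the lobes, $\gamma(a;b_1,\dots,b_m)$ is obtained by identifying the parameterized $i$-th lobe of $a$ with the boundary of $b_i$, rescaled to the size of that lobe, and the unit is the one-lobe cactus whose base point is its marked point. **Theorem.** $MD$ and $Cac$ are topological operads with these structures. For every $n$ there is a quotient map (in particular a continuous surjection) $\delta_n\colon MC(n)\to Cac(n)$ which sends a marked diagram to the cactus obtained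 by contracting its chords: the $i$-th lobe is the $i$-th loop, of size its length $r_i$, parameterized with constant velocity starting at $z_i$; the intersection points are the trees; at an intersection point, the lobe of the interval ending at a vertex of the tree is followed by the lobe of the interval starting at that vertex; the base point is the image of $u$, on the lobe of the interval starting at $u$. The map $\delta_n$ factors through the quotient $MC(n)\to MD(n)$ and a homeomorphism $\bar\delta_n\colon MD(n)\to Cac(n)$. The maps $\bar\delta_n$ are $\mathfrak S_n$-equivariant and compatible with the compositions and the units, so they form an isomorphism of operads $MD\cong Cac$. -/

import Mathlib

open Topology Filter MeasureTheory

noncomputable section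

/-! # Topological (symmetric) operads -/

/-- Given right actions of the symmetric groups on a family of spaces `O n`, the induced relabelling
along a bijection `Fin a ≃ Fin b` (such a bijection forces `a = b`). -/
def reindexAlong {O : ℕ → Type} (act : ∀ {n : ℕ}, O n → Equiv.Perm (Fin n) → O n)
    {a b : ℕ} (e : Fin a ≃ Fin b) (x : O b) : O a :=
  have h : b = a := by simpa using (Fintype.card_congr e).symm
  act (cast (congrArg O h) x) (e.trans (finCongr h))

/-- An operad structure on the topological spaces `O n`: continuous right actions of the symmetric
groups, continuous composition laws, a unit, and the associativity, unit and equivariance axioms.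
The inputs of `comp x y` are ordered lexicographically, i.e. through
`finSigmaFinEquiv : (Σ i, Fin (k i)) ≃ Fin (∑ i, k i)`. Heterogeneous equality is only used between
elements of spaces `O a`, `O b` for which `a = b` is a theorem of arithmetic. -/
structure TopOperad (O : ℕ → Type) [∀ n, TopologicalSpace (O n)] where
  act : ∀ {n : ℕ}, O n → Equiv.Perm (Fin n) → O n
  comp : ∀ {m : ℕ} {k : Fin m → ℕ}, O m → (∀ i, O (k i)) → O (∑ i, k i)
  unit : O 1
  continuous_act : ∀ {n : ℕ} (σ : Equiv.Perm (Fin n)), Continuous fun x : O n => act x σ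
  continuous_comp : ∀ {m : ℕ} {k : Fin m → ℕ},
    Continuous fun p : O m × (∀ i, O (k i)) => comp p.1 p.2
  act_one : ∀ {n : ℕ} (x : O n), act x 1 = x
  act_mul : ∀ {n : ℕ} (x : O n) (σ τ : Equiv.Perm (Fin n)), act x (σ * τ) = act (act x σ) τ
  unit_comp : ∀ {n : ℕ} (y : O n), HEq (comp unit (fun _ : Fin 1 => y)) y
  comp_unit : ∀ {n : ℕ} (x : O n), HEq (comp x (fun _ : Fin n => unit)) x
  comp_assoc : ∀ {m : ℕ} {k : Fin m → ℕ} {q : ∀ i, Fin (k i) → ℕ}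
    (x : O m) (y : ∀ i, O (k i)) (z : ∀ i j, O (q i j)),
    HEq (comp (comp x y) (fun l : Fin (∑ i, k i) =>
          z (finSigmaFinEquiv.symm l).1 (finSigmaFinEquiv.symm l).2))
        (comp x (fun i => comp (y i) (z i)))
  act_comp : ∀ {m : ℕ} {k : Fin m → ℕ} (x : O m) (y : ∀ i, O (k i)) (σ : Equiv.Perm (Fin m)),
    comp (act x σ) (fun i => y (σ i)) =
      reindexAlong act
        ((finSigmaFinEquiv (n := fun i => k (σ i))).symm.trans
          ((Equiv.sigmaCongrLeft (β := fun i => Fin (k i)) σ).trans finSigmaFinEquiv))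
        (comp x y)
  comp_act : ∀ {m : ℕ} {k : Fin m → ℕ} (x : O m) (y : ∀ i, O (k i))
    (τ : ∀ i, Equiv.Perm (Fin (k i))),
    comp x (fun i => act (y i) (τ i)) =
      act (comp x y) (finSigmaFinEquiv.permCongr (Equiv.sigmaCongrRight τ))

/-! # Chord diagrams

The oriented circle of perimeter `1` is `UnitAddCircle = ℝ/ℤ` (arc length, counterclockwise), with
initial marked point `u = 0`. `Set.cIoo p q` and `Set.cIcc p q` are the open and closed arcs
travelled counterclockwise from `p` to `q`. -/

section arcs

variable {n : ℕ} (pt : Fin (n - 1) → Bool → UnitAddCircle) (lab : Fin (n - 1) → Bool → Fin n)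

/-- The open arc cut off by the `j`-th chord on its side `b`. -/
def chordArc (j : Fin (n - 1)) (b : Bool) : Set UnitAddCircle := Set.cIoo (pt j b) (pt j (!b))

/-- The part of the circle on the boundary of the `k`-th region, without the vertices. A region of
the disc is convex: it is the intersection of the half discs cut off by the chords on its
boundary. -/
def openRegion (k : Fin n) : Set UnitAddCircle := {p | ∀ j b, lab j b = k → p ∈ chordArc pt j b}

end arcs

/-- A labeled chord diagram with `n - 1` chords. The `j`-th chord joins `pt j false` (the point
`x_j`) to `pt j true` (the point `y_j`). The numbering of the `n` regions of the disc is recorded by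
the numbers of the two regions adjacent to each chord: `lab j b` is the number of the region
adjacent to the `j`-th chord on the side of the arc from `pt j b` to `pt j (!b)`. -/
@[ext] structure ChordDiagram (n : ℕ) where
  pt : Fin (n - 1) → Bool → UnitAddCircle
  lab : Fin (n - 1) → Bool → Fin n
  ne : ∀ j, pt j false ≠ pt j true
  /-- No two chords cross inside the disc: the end points of one are not on different sides of the
  other. (Coinciding chords are excluded by the last two conditions.) -/
  flat : ∀ i j b, ¬ (pt j b ∈ chordArc pt i false ∧ pt j (!b) ∈ chordArc pt i true)
  /-- The regions numbered `0, …, n - 1` partition the circle minus the vertices. -/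
  existsUnique_region : ∀ p, (∀ j b, p ≠ pt j b) → ∃! k, p ∈ openRegion pt lab k
  /-- Each of the `n` regions meets the circle in a set of positive measure. -/
  region_pos : ∀ k, 0 < volume (openRegion pt lab k)

namespace ChordDiagram

variable {n : ℕ} (c : ChordDiagram n)

/-- The topology inherited from `(S¹)^(2n-2)`, the (finite) numbering data being discrete. -/
instance : TopologicalSpace (ChordDiagram n) :=
  TopologicalSpace.induced (fun c => (c.pt, c.lab)) inferInstance

/-- The open intervals of the circle with label `k`. -/
def region (k : Fin n) : Set UnitAddCircle := openRegion c.pt c.lab k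

/-- The points of the circle in the closure of the `k`-th region of the disc, i.e. the closed
intervals with label `k`. (Isolated points at which the closed region touches the circle are
degenerate intervals.) -/
def closedRegion (k : Fin n) : Set UnitAddCircle :=
  {p | ∀ j b, c.lab j b = k → p ∈ Set.cIcc (c.pt j b) (c.pt j (!b))}

/-- The set of end points of the chords. -/
def vertices : Set UnitAddCircle := {p | ∃ j b, p = c.pt j b}

/-- The graph of the chord diagram; its edges are the chords. (Points of the circle other than the
end points of the chords are isolated.) -/
def graph : SimpleGraph UnitAddCircle :=
  SimpleGraph.fromRel fun p q => ∃ j, p = c.pt j false ∧ q = c.pt j true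

/-- `p` and `q` are vertices of the same tree (they are in the same cluster). -/
def SameTree (p q : UnitAddCircle) : Prop :=
  p ∈ c.vertices ∧ q ∈ c.vertices ∧ c.graph.Reachable p q

/-- `c` and `c'` have related forests: same vertices, same clusters, same labels of the intervals
of the circle. -/
def RelatedForests (c c' : ChordDiagram n) : Prop :=
  c.vertices = c'.vertices ∧ (∀ p q, c.SameTree p q ↔ c'.SameTree p q) ∧
    ∀ k, c.region k = c'.region k

/-- `k` is the label of the interval starting at `p`. -/
def LabelAfter (p : UnitAddCircle) (k : Fin n) : Prop :=
  ∀ᶠ s : ℝ in 𝓝[>] 0, p + (s : UnitAddCircle) ∈ c.region k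

/-- `k` is the label of the interval ending at `p`. -/
def LabelBefore (p : UnitAddCircle) (k : Fin n) : Prop :=
  ∀ᶠ s : ℝ in 𝓝[>] 0, p - (s : UnitAddCircle) ∈ c.region k

end ChordDiagram

/-- A chord diagram with a marked point `z i` on the closed `i`-th region, for each `i`. -/
@[ext] structure MarkedDiagram (n : ℕ) extends ChordDiagram n where
  z : Fin n → UnitAddCircle
  z_mem : ∀ i, z i ∈ toChordDiagram.closedRegion i

namespace MarkedDiagram

variable {n : ℕ}

instance : TopologicalSpace (MarkedDiagram n) :=
  TopologicalSpace.induced (fun c => (c.toChordDiagram, c.z)) inferInstance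

/-- The relation `∼₀`: marked points may be exchanged within the vertices of a tree. -/
def Sim0 (c c' : MarkedDiagram n) : Prop :=
  c.toChordDiagram = c'.toChordDiagram ∧
    ∀ i, c.z i ≠ c'.z i → c.toChordDiagram.SameTree (c.z i) (c'.z i)

/-- `c'` is in the orbit of `c` under the group `𝔖_{n-1} ⋉ (𝔖_2)^{n-1}`, which permutes the chords
(`τ`) and exchanges their end points (`ε`). -/
def SameOrbit (c c' : MarkedDiagram n) : Prop :=
  ∃ (τ : Equiv.Perm (Fin (n - 1))) (ε : Fin (n - 1) → Bool),
    (∀ j b, c'.pt j b = c.pt (τ j) (xor (ε j) b)) ∧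
    (∀ j b, c'.lab j b = c.lab (τ j) (xor (ε j) b)) ∧ c'.z = c.z

/-- The map of degree one from the circle to the parameterized `i`-th lobe `ℝ/ℤ`. It is the
projection of the circle onto the `i`-th loop (everything outside the `i`-th region is contracted),
followed by the orientation preserving parametrization of the loop of constant velocity sending
`z i` to `0`: a point `p` goes to the part of the length of the `i`-th loop that is travelled
from `z i` to `p`. -/
def lobeMap (c : MarkedDiagram n) (i : Fin n) (p : UnitAddCircle) : UnitAddCircle :=
  ((volume.real (c.toChordDiagram.region i ∩ Set.cIoo (c.z i) p) /
    volume.real (c.toChordDiagram.region i) : ℝ) : UnitAddCircle)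

/-- `c'` is `c` with the regions and the marked points renumbered: the `i`-th region of `c'` is the
`σ i`-th region of `c`. -/
def IsRelabeling (c : MarkedDiagram n) (σ : Equiv.Perm (Fin n)) (c' : MarkedDiagram n) : Prop :=
  c'.pt = c.pt ∧ (∀ j b, c'.lab j b = σ.symm (c.lab j b)) ∧ ∀ i, c'.z i = c.z (σ i)

/-- `e` is obtained by patching, for each `i`, the diagram `d i`, linearly rescaled, into the
`i`-th region of `c`, its point `u` being put at `z i`. The chords of `e` are those of `c` and those
of the `d i`; the regions of `e` are those of the `d i`, in lexicographic order; the point `u` of `e`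
is that of `c`. -/
def IsPatching {m : ℕ} {k : Fin m → ℕ} (c : MarkedDiagram m) (d : ∀ i, MarkedDiagram (k i))
    (e : MarkedDiagram (∑ i, k i)) : Prop :=
  (∃ f : Fin (m - 1) ⊕ (Σ i, Fin (k i - 1)) ≃ Fin ((∑ i, k i) - 1),
    (∀ j b, e.pt (f (Sum.inl j)) b = c.pt j b) ∧
    ∀ i j b, e.pt (f (Sum.inr ⟨i, j⟩)) b ∈ c.toChordDiagram.closedRegion i ∧
      c.lobeMap i (e.pt (f (Sum.inr ⟨i, j⟩)) b) = (d i).pt j b) ∧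
  (∀ i j, ∀ p ∈ e.toChordDiagram.region (finSigmaFinEquiv ⟨i, j⟩),
    p ∈ c.toChordDiagram.region i ∧ c.lobeMap i p ∈ (d i).toChordDiagram.region j) ∧
  ∀ i j, e.z (finSigmaFinEquiv ⟨i, j⟩) ∈ c.toChordDiagram.closedRegion i ∧
    c.lobeMap i (e.z (finSigmaFinEquiv ⟨i, j⟩)) = (d i).z j

end MarkedDiagram

/-- The space of marked labeled chord diagrams. -/
abbrev MLC (n : ℕ) : Type := Quot (MarkedDiagram.Sim0 (n := n))

/-- The space of marked unlabeled chord diagrams, the quotient of `MLC n` by the group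
`𝔖_{n-1} ⋉ (𝔖_2)^{n-1}`. -/
abbrev MC (n : ℕ) : Type :=
  Quot fun a b : MLC n => ∃ c c' : MarkedDiagram n,
    a = Quot.mk _ c ∧ b = Quot.mk _ c' ∧ c.SameOrbit c'

/-- The class of a marked diagram in `MC n`. -/
def MC.mk {n : ℕ} (c : MarkedDiagram n) : MC n := Quot.mk _ (Quot.mk _ c)

/-- The space of marked chord diagrams, the quotient of `MC n` by the relation `∼_f`. -/
abbrev MD (n : ℕ) : Type :=
  Quot fun a b : MC n => ∃ c c' : MarkedDiagram n,
    a = MC.mk c ∧ b = MC.mk c' ∧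
      c.toChordDiagram.RelatedForests c'.toChordDiagram ∧ c.z = c'.z

/-- The quotient map from `MC n` to `MD n`. -/
def MC.toMD {n : ℕ} (x : MC n) : MD n := Quot.mk _ x

/-- The class of a marked diagram in `MD n`. -/
def MD.mk {n : ℕ} (c : MarkedDiagram n) : MD n := (MC.mk c).toMD

/-! # Cacti -/

/-- The points of a disjoint union of `n` circles, parameterized by `ℝ/ℤ`; the marked point of the
`i`-th circle is `(i, 0)`. -/
abbrev LobePoint (n : ℕ) : Type := Fin n × UnitAddCircle

/-- The intersection points of the configuration of circles in which the points of each cycle of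
`next` are identified. -/
abbrev IntersectionPoint {n : ℕ} (next : Equiv.Perm (LobePoint n)) : Type :=
  {P : Set (LobePoint n) // ∃ x, next x ≠ x ∧ P = {y | next.SameCycle x y}}

/-- The dual graph of a configuration of circles: the vertices are the circles and the intersection
points, the edges are the incidences. -/
def dualGraph {n : ℕ} (next : Equiv.Perm (LobePoint n)) :
    SimpleGraph (Fin n ⊕ IntersectionPoint next) :=
  SimpleGraph.fromRel fun v v' => match v, v' with
    | Sum.inl i, Sum.inr P => ∃ t, (i, t) ∈ P.1
    | _, _ => False

/-- A cactus with `n` lobes: `n` parameterized circles of positive sizes with sum `1`, glued at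
finitely many intersection points in a treelike way, with a cyclic order of the lobes at each
intersection point, a base point and the choice of a lobe on which the base point lies. The gluing
and the cyclic orders are recorded by the permutation `next`: its nontrivial cycles are the
intersection points with their cyclic order. -/
@[ext] structure Cactus (n : ℕ) where
  size : Fin n → ℝ
  next : Equiv.Perm (LobePoint n)
  base : LobePoint n
  size_pos : ∀ i, 0 < size i
  sum_size : ∑ i, size i = 1
  finite_points : {x | next x ≠ x}.Finite
  /-- An intersection point is a single point of each circle through it. -/
  eq_of_sameCycle : ∀ i t t', next.SameCycle (i, t) (i, t') → t = t'
  isTree : (dualGraph next).IsTree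

namespace Cactus

variable {n : ℕ}

/-- `φ` traces the boundary of the cactus with unit speed, starting at the base point and
following the orientation of the lobes. At time `t` the path arrives at the point
`next.symm (φ t)` and leaves from `φ t`: at an intersection point it goes on along the next lobe in
the cyclic order. (On the `i`-th lobe unit speed is velocity `1 / size i` in the parameter.) -/
def IsTrace (a : Cactus n) (φ : UnitAddCircle → LobePoint n) : Prop :=
  φ 0 = a.base ∧ ∀ t,
    (∀ᶠ s : ℝ in 𝓝[>] 0, φ (t + (s : UnitAddCircle)) =
      ((φ t).1, (φ t).2 + ((s / a.size (φ t).1 : ℝ) : UnitAddCircle))) ∧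
    (∀ᶠ s : ℝ in 𝓝[>] 0, φ (t - (s : UnitAddCircle)) =
      ((a.next.symm (φ t)).1, (a.next.symm (φ t)).2 -
        ((s / a.size (a.next.symm (φ t)).1 : ℝ) : UnitAddCircle)))

/-- `f i` is the pinching map of the circle onto the cactus (the trace of the boundary) followed
by the retraction of the cactus onto its `i`-th lobe which contracts the other lobes: it moves
with the trace along the `i`-th lobe, and stands still while the trace is on another lobe. -/
def IsPinchingMap (a : Cactus n) (f : Fin n → C(UnitAddCircle, UnitAddCircle)) : Prop :=
  ∃ φ, a.IsTrace φ ∧ ∀ i t,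
    ((φ t).1 = i → f i t = (φ t).2) ∧
    ((φ t).1 ≠ i → ∀ᶠ s : ℝ in 𝓝[>] 0, f i (t + (s : UnitAddCircle)) = f i t)

/-- The pinching map of a cactus, in terms of its projections to the lobes. -/
def pinchingMap (a : Cactus n) : Fin n → C(UnitAddCircle, UnitAddCircle) :=
  Classical.epsilon a.IsPinchingMap

/-- The topology on the space of cacti: two cacti are close if the sizes of their lobes and their
pinching maps (in the uniform topology) are close. Thus a cactus moves continuously when the
lengths of its arcs do, and arcs between intersection points may shrink to length zero. -/
instance : TopologicalSpace (Cactus n) :=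
  TopologicalSpace.induced (fun a => (a.size, a.pinchingMap)) inferInstance

/-- `a'` is `a` with the lobes renumbered: the `i`-th lobe of `a'` is the `σ i`-th lobe of `a`. -/
def IsRelabeling (a : Cactus n) (σ : Equiv.Perm (Fin n)) (a' : Cactus n) : Prop :=
  (∀ i, a'.size i = a.size (σ i)) ∧
  (∀ x, Prod.map σ id (a'.next x) = a.next (Prod.map σ id x)) ∧
  Prod.map σ id a'.base = a.base

/-- `e` is the operadic composite of `a` and the `b i`: the `i`-th lobe of `a` is replaced by the
cactus `b i`, rescaled to the size of the lobe, by identifying the parameterized lobe with the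
boundary of `b i`, traced by `φ i`. A path along the boundary of `e` that arrives at a point of
a lobe of `b i` arrives there at the time `t` at which the trace of `b i` leaves from the next
point in `b i`; in `a` this is the point `t` of the `i`-th lobe, from where it goes on to the next
point in `a`. -/
def IsComposite {m : ℕ} {k : Fin m → ℕ} (a : Cactus m) (b : ∀ i, Cactus (k i))
    (e : Cactus (∑ i, k i)) : Prop :=
  ∃ φ : ∀ i, UnitAddCircle ≃ LobePoint (k i), (∀ i, (b i).IsTrace (φ i)) ∧
    let incl : ∀ i, LobePoint (k i) → LobePoint (∑ i, k i) :=
      fun i x => (finSigmaFinEquiv ⟨i, x.1⟩, x.2)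
    let leave : LobePoint m → LobePoint (∑ i, k i) := fun x => incl x.1 (φ x.1 x.2)
    (∀ i j, e.size (finSigmaFinEquiv ⟨i, j⟩) = a.size i * (b i).size j) ∧
    e.base = leave a.base ∧
    ∀ i x, e.next (incl i x) = leave (a.next (i, (φ i).symm ((b i).next x)))

end Cactus

/-- The cactus `a` is obtained from the marked chord diagram `c` by contracting the chords: the
size of the `i`-th lobe is the length of the `i`-th loop, the lobes are parameterized by the maps
`lobeMap i`, at the intersection point given by a tree the lobe of the interval ending at a vertex
`p` is followed by the lobe of the interval starting at `p`, and the base point is the image of `u`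
in the lobe of the interval starting at `u`. -/
def IsContraction {n : ℕ} (c : MarkedDiagram n) (a : Cactus n) : Prop :=
  (∀ i, a.size i = volume.real (c.toChordDiagram.region i)) ∧
  (∀ p i j, c.toChordDiagram.LabelBefore p i → c.toChordDiagram.LabelAfter p j →
    a.next (i, c.lobeMap i p) = (j, c.lobeMap j p)) ∧
  ∀ j, c.toChordDiagram.LabelAfter 0 j → a.base = (j, c.lobeMap j 0)

/-- `P` is the marked chord diagram operad: the symmetric groups renumber, the composition is
patching of diagrams, the unit is the diagram without chords whose marked point is `u`. -/
def IsMarkedChordDiagramOperad (P : TopOperad MD) : Prop :=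
  (∀ (n : ℕ) (c : MarkedDiagram n) (σ : Equiv.Perm (Fin n)),
    ∃ c', c.IsRelabeling σ c' ∧ P.act (MD.mk c) σ = MD.mk c') ∧
  (∀ (m : ℕ) (k : Fin m → ℕ) (c : MarkedDiagram m) (d : ∀ i, MarkedDiagram (k i)),
    (∃ e, c.IsPatching d e) ∧
    ∀ e, c.IsPatching d e → P.comp (MD.mk c) (fun i => MD.mk (d i)) = MD.mk e) ∧
  ∃ c : MarkedDiagram 1, c.z 0 = 0 ∧ P.unit = MD.mk c

/-- `Q` is the cactus operad: the symmetric groups renumber the lobes, the composition is insertion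
of cacti into lobes, the unit is the circle whose base point is its marked point. -/
def IsCactusOperad (Q : TopOperad Cactus) : Prop :=
  (∀ (n : ℕ) (a : Cactus n) (σ : Equiv.Perm (Fin n)), a.IsRelabeling σ (Q.act a σ)) ∧
  (∀ (m : ℕ) (k : Fin m → ℕ) (a : Cactus m) (b : ∀ i, Cactus (k i)),
    a.IsComposite b (Q.comp a b)) ∧
  Q.unit.base = (0, 0)

end

/-! The intermediate object is a `BoundaryTrace`: the tracing of the boundary as a map `φ` of the
circle to the lobes, with its left limits `ψ` and compatible retractions `ρ i` onto the lobes. Both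
chord diagrams and cacti are translated into it. The composite `f i = ρ i ∘ φ` is the pinching map
to the `i`-th lobe. It moves with speed `1 / size i` on the `i`-th region and stands still
elsewhere, so its increments are lengths of parts of that region (`BoundaryTrace.f_eq_add_arcVol`).
Its degree is a positive integer. Since the sizes add up to the length of the circle, all degrees
are `1` (`BoundaryTrace.volume_region`). Hence `φ` and `ψ` are bijections, and `next = φ ∘ ψ⁻¹` is
the gluing permutation of a cactus (`BoundaryTrace.toCactus`).

Every cactus arises in this way (`Cactus.exists_boundaryTrace`). The tree condition gives the
retractions. The trace is built by moving from cut to cut; the retractions show that a visited lobe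
is traversed exactly once, and connectedness of the dual graph that every lobe is visited. As a
consequence a cactus is determined by its pinching maps (`Cactus.ext_pinchingMap`). Operadic
composition is composition of pinching maps (`Cactus.comp_pinchingMap_mk`), so the operad axioms and
the continuity of the operations follow from those of composition of maps and from bookkeeping with
lexicographic numberings.

A chord diagram labels the intervals of the circle by regions. A counting argument
(`ChordDiagram.same_side_of_not_vertex`: `n - 1` noncrossing chords separate at most `n` points)
shows that a chord never separates a region, so the labeling is noncrossing and yields a boundary
trace. This is the contraction `MarkedDiagram.toCactus`. Two vertices lie in the same tree exactly
when every pinching map identifies them (`ChordDiagram.sameTree_iff`). Therefore the cactus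
determines the labels, the vertices and the trees, and the marked points up to motion in a tree: its
fibres are the classes defining `MD n` (`MarkedDiagram.mk_eq_of_toCactus_eq`).

For surjectivity, the points of the circle with the same image in the cactus form noncrossing
classes. In each class the first point, in the order of the trace, is joined to all others; the
resulting chords correspond to the `n - 1` lobes other than the base lobe
(`BoundaryTrace.exists_chordDiagram`). The contraction is a quotient map because diagrams whose
regions have length bounded below form a compact set (`MarkedDiagram.isCompact_setOf_le_volume`),
and near a given cactus the sizes are bounded below.

The operad structure of `MD` is transported from cacti. That it is the geometric one means that
patchings exist and that contraction turns patching into composition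
(`MarkedDiagram.exists_isPatching`, `MarkedDiagram.IsPatching.toCactus_eq`). -/

noncomputable section


/-! # The circle -/

/-- The representative in `[0, 1)` of a point of the circle. -/
def ccw (x : UnitAddCircle) : ℝ := (AddCircle.equivIco (1 : ℝ) 0 x : ℝ)

lemma ccw_nonneg (x : UnitAddCircle) : 0 ≤ ccw x := (AddCircle.equivIco (1 : ℝ) 0 x).2.1

lemma ccw_lt_one (x : UnitAddCircle) : ccw x < 1 := by
  have h : ccw x < 0 + 1 := (AddCircle.equivIco (1 : ℝ) 0 x).2.2
  linarith

@[simp] lemma coe_ccw (x : UnitAddCircle) : ((ccw x : ℝ) : UnitAddCircle) = x :=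
  AddCircle.coe_equivIco

lemma ccw_coe {u : ℝ} (h0 : 0 ≤ u) (h1 : u < 1) : ccw (u : UnitAddCircle) = u := by
  unfold ccw
  rw [AddCircle.equivIco_coe_eq (p := (1 : ℝ)) (a := 0) ⟨h0, by simpa using h1⟩]

@[simp] lemma ccw_zero : ccw 0 = 0 := by
  simpa using ccw_coe (le_refl (0 : ℝ)) one_pos

lemma ccw_injective : Function.Injective ccw := fun x y h => by
  rw [← coe_ccw x, h, coe_ccw]

@[simp] lemma ccw_eq_zero {x : UnitAddCircle} : ccw x = 0 ↔ x = 0 :=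
  ⟨fun h => by rw [← coe_ccw x, h]; rfl, fun h => by rw [h, ccw_zero]⟩

lemma ccw_pos {x : UnitAddCircle} : 0 < ccw x ↔ x ≠ 0 := by
  rw [(ccw_nonneg x).lt_iff_ne, ne_comm, ne_eq, ccw_eq_zero]

lemma coe_one_eq_zero : ((1 : ℝ) : UnitAddCircle) = 0 := AddCircle.coe_period 1

lemma coe_eq_zero_iff_int {u : ℝ} : (u : UnitAddCircle) = 0 ↔ ∃ k : ℤ, (k : ℝ) = u := by
  rw [AddCircle.coe_eq_zero_iff]; simp

lemma ccw_neg {x : UnitAddCircle} (hx : x ≠ 0) : ccw (-x) = 1 - ccw x := by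
  have h1 := ccw_pos.2 hx
  have h2 := ccw_lt_one x
  have : -x = ((1 - ccw x : ℝ) : UnitAddCircle) := by
    rw [AddCircle.coe_sub, coe_ccw, coe_one_eq_zero, zero_sub]
  rw [this, ccw_coe (by linarith) (by linarith)]

lemma ccw_add (x y : UnitAddCircle) :
    ccw (x + y) = if ccw x + ccw y < 1 then ccw x + ccw y else ccw x + ccw y - 1 := by
  have hx := ccw_nonneg x
  have hy := ccw_nonneg y
  have hx' := ccw_lt_one x
  have hy' := ccw_lt_one y
  split_ifs with h
  · rw [← ccw_coe (add_nonneg hx hy) h, AddCircle.coe_add, coe_ccw, coe_ccw]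
  · rw [← ccw_coe (u := ccw x + ccw y - 1) (by linarith) (by linarith), AddCircle.coe_sub,
      AddCircle.coe_add, coe_ccw, coe_ccw, coe_one_eq_zero, sub_zero]

lemma ccw_sub (x y : UnitAddCircle) :
    ccw (x - y) = if ccw y ≤ ccw x then ccw x - ccw y else ccw x - ccw y + 1 := by
  have h := ccw_add (x - y) y
  rw [sub_add_cancel] at h
  have h1 := ccw_lt_one (x - y)
  have h2 := ccw_nonneg (x - y)
  split_ifs at h ⊢ <;> linarith [ccw_lt_one x, ccw_lt_one y, ccw_nonneg x, ccw_nonneg y]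

/-- The cyclic order in the coordinate centered at `p`. -/
lemma mem_cIoo_iff_ccw (p x y z : UnitAddCircle) : x ∈ Set.cIoo y z ↔
    (ccw (y - p) < ccw (x - p) ∧ ccw (x - p) < ccw (z - p)) ∨
    (ccw (z - p) < ccw (y - p) ∧ ccw (y - p) < ccw (x - p)) ∨
    (ccw (x - p) < ccw (z - p) ∧ ccw (z - p) < ccw (y - p)) := by
  -- Strict betweenness is the negation of the opposite weak betweenness, which the library defines
  -- through `toIcoMod` and `toIocMod`. These differ only at the base point, whence the value `1` in
  -- place of `0` when `z = y`.
  have key : x ∈ Set.cIoo y z ↔ ¬ (ccw (x - z) ≤ if z = y then 1 else ccw (y - z)) := by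
    change sbtw y x z ↔ _
    rw [sbtw_iff_not_btw]
    conv_lhs => rw [← coe_ccw x, ← coe_ccw y, ← coe_ccw z]
    rw [QuotientAddGroup.btw_coe_iff]
    have e1 : ∀ a b : UnitAddCircle, toIcoMod (zero_lt_one' ℝ) (ccw a) (ccw b) =
        ccw (b - a) + ccw a := fun a b => by
      rw [toIcoMod_eq_iff]
      refine ⟨⟨by linarith [ccw_nonneg (b - a)], by linarith [ccw_lt_one (b - a)]⟩, ?_⟩
      have : ((ccw b - (ccw (b - a) + ccw a) : ℝ) : UnitAddCircle) = 0 := by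
        rw [AddCircle.coe_sub, AddCircle.coe_add]; simp
      obtain ⟨k, hk⟩ := coe_eq_zero_iff_int.1 this
      exact ⟨k, by simp; linarith⟩
    have e2 : ∀ a b : UnitAddCircle, toIocMod (zero_lt_one' ℝ) (ccw a) (ccw b) =
        (if a = b then 1 else ccw (b - a)) + ccw a := fun a b => by
      rw [toIocMod_eq_iff]
      have : ((ccw b - (ccw (b - a) + ccw a) : ℝ) : UnitAddCircle) = 0 := by
        rw [AddCircle.coe_sub, AddCircle.coe_add]; simp
      obtain ⟨k, hk⟩ := coe_eq_zero_iff_int.1 this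
      split_ifs with hab
      · subst hab
        refine ⟨⟨by linarith, by linarith⟩, -1, by simp⟩
      · have := ccw_pos.2 (sub_ne_zero.2 (Ne.symm hab))
        exact ⟨⟨by linarith, by linarith [ccw_lt_one (b - a)]⟩, k, by simp; linarith⟩
    rw [e1, e2]
    simp
  rw [key]
  have hx := ccw_nonneg (x - p)
  have hy := ccw_nonneg (y - p)
  have hz := ccw_nonneg (z - p)
  have hx' := ccw_lt_one (x - p)
  have hy' := ccw_lt_one (y - p)
  have hz' := ccw_lt_one (z - p)
  have h1 := ccw_sub (x - p) (z - p)
  have h2 := ccw_sub (y - p) (z - p)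
  have h3 : z = y ↔ ccw (z - p) = ccw (y - p) := by
    rw [ccw_injective.eq_iff, sub_left_inj]
  rw [sub_sub_sub_cancel_right] at h1 h2
  rw [h1, h2]
  simp only [h3]
  generalize ccw (x - p) = a at *
  generalize ccw (y - p) = b at *
  generalize ccw (z - p) = c at *
  clear h1 h2 h3 key
  split_ifs <;> grind

lemma mem_cIoo_iff {p q x : UnitAddCircle} :
    x ∈ Set.cIoo p q ↔ 0 < ccw (x - p) ∧ ccw (x - p) < ccw (q - p) := by
  rw [mem_cIoo_iff_ccw p]
  simp only [sub_self, ccw_zero]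
  have := ccw_nonneg (q - p)
  have := ccw_nonneg (x - p)
  grind

lemma mem_cIcc_iff_not {p q x : UnitAddCircle} : x ∈ Set.cIcc p q ↔ x ∉ Set.cIoo q p :=
  btw_iff_not_sbtw (a := p) (b := x) (c := q)

@[simp] lemma cIoo_self (p : UnitAddCircle) : Set.cIoo p p = ∅ := by
  ext x
  rw [mem_cIoo_iff, sub_self, ccw_zero]
  have := ccw_nonneg (x - p)
  simp only [Set.mem_empty_iff_false, iff_false]
  intro h; linarith [h.2]

lemma left_not_mem_cIoo (p q : UnitAddCircle) : p ∉ Set.cIoo p q := by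
  rw [mem_cIoo_iff, sub_self, ccw_zero]; simp

lemma right_not_mem_cIoo (p q : UnitAddCircle) : q ∉ Set.cIoo p q := by
  rw [mem_cIoo_iff]; simp

lemma ccw_sub_eq_iff {p x y : UnitAddCircle} : ccw (x - p) = ccw (y - p) ↔ x = y := by
  rw [ccw_injective.eq_iff, sub_left_inj]

lemma ne_of_mem_cIoo {p q x : UnitAddCircle} (h : x ∈ Set.cIoo p q) : p ≠ q := by
  rintro rfl
  rw [cIoo_self] at h
  exact h

/-- Two different points cut the circle into two open arcs. -/
lemma mem_cIoo_or {p q x : UnitAddCircle} (h1 : x ≠ p) (h2 : x ≠ q) (h3 : p ≠ q) :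
    x ∈ Set.cIoo p q ∨ x ∈ Set.cIoo q p := by
  rw [mem_cIoo_iff_ccw p x p q, mem_cIoo_iff_ccw p x q p]
  rw [ne_eq, ← ccw_sub_eq_iff (p := p)] at h1 h2 h3
  grind

lemma disjoint_cIoo (p q : UnitAddCircle) : Disjoint (Set.cIoo p q) (Set.cIoo q p) := by
  rw [Set.disjoint_left]
  intro x h1 h2
  rw [mem_cIoo_iff_ccw p] at h1 h2
  grind

lemma cIoo_rotate {p q x : UnitAddCircle} : x ∈ Set.cIoo p q ↔ p ∈ Set.cIoo q x := by
  rw [mem_cIoo_iff_ccw p x p q, mem_cIoo_iff_ccw p p q x]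
  grind

lemma add_mem_cIoo_add {p q x y : UnitAddCircle} :
    x + y ∈ Set.cIoo (p + y) (q + y) ↔ x ∈ Set.cIoo p q := by
  rw [mem_cIoo_iff, mem_cIoo_iff, add_sub_add_right_eq_sub, add_sub_add_right_eq_sub]

lemma continuousAt_ccw {x : UnitAddCircle} (hx : x ≠ 0) : ContinuousAt ccw x :=
  continuous_subtype_val.continuousAt.comp
    (AddCircle.continuousAt_equivIco (1 : ℝ) 0 (by simpa using hx))

/-- The coordinate `ccw` is discontinuous only at `0`, and strict betweenness keeps both `x - p` and
`q - p` away from `0`. Openness in all three points jointly is what later makes crossing an open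
condition on diagrams. -/
lemma isOpen_sbtw : IsOpen {t : UnitAddCircle × UnitAddCircle × UnitAddCircle |
    t.2.1 ∈ Set.cIoo t.1 t.2.2} := by
  rw [isOpen_iff_mem_nhds]
  rintro ⟨p, x, q⟩ h
  change x ∈ Set.cIoo p q at h
  rw [mem_cIoo_iff] at h
  have hx : x - p ≠ 0 := ccw_pos.1 h.1
  have hq : q - p ≠ 0 := ccw_pos.1 (h.1.trans h.2)
  have c1 : ContinuousAt (fun t : UnitAddCircle × UnitAddCircle × UnitAddCircle =>
      ccw (t.2.1 - t.1)) (p, x, q) :=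
    ContinuousAt.comp (f := fun t : UnitAddCircle × UnitAddCircle × UnitAddCircle => t.2.1 - t.1)
      (continuousAt_ccw hx) (by fun_prop)
  have c2 : ContinuousAt (fun t : UnitAddCircle × UnitAddCircle × UnitAddCircle =>
      ccw (t.2.2 - t.1)) (p, x, q) :=
    ContinuousAt.comp (f := fun t : UnitAddCircle × UnitAddCircle × UnitAddCircle => t.2.2 - t.1)
      (continuousAt_ccw hq) (by fun_prop)
  filter_upwards [c1.tendsto.eventually_const_lt h.1, c1.tendsto.eventually_lt c2.tendsto h.2]
    with t h1 h2
  exact mem_cIoo_iff.2 ⟨h1, h2⟩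

lemma isOpen_cIoo (p q : UnitAddCircle) : IsOpen (Set.cIoo p q) :=
  isOpen_sbtw.preimage (f := fun x => (p, x, q)) (by fun_prop)

lemma isClosed_cIcc (p q : UnitAddCircle) : IsClosed (Set.cIcc p q) := by
  have : Set.cIcc p q = (Set.cIoo q p)ᶜ := by ext; exact mem_cIcc_iff_not
  rw [this]
  exact (isOpen_cIoo q p).isClosed_compl

lemma add_small_mem_cIoo {p : UnitAddCircle} {s u : ℝ} (hs : 0 < s) (hsu : s < u) (hu : u < 1) :
    p + (s : UnitAddCircle) ∈ Set.cIoo p (p + (u : UnitAddCircle)) := by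
  rw [mem_cIoo_iff, add_sub_cancel_left, add_sub_cancel_left, ccw_coe hs.le (by linarith),
    ccw_coe (by linarith) hu]
  exact ⟨hs, hsu⟩

lemma mem_cIoo_add {p x : UnitAddCircle} {u : ℝ} (h0 : 0 ≤ u) (h1 : u < 1) :
    x ∈ Set.cIoo p (p + (u : UnitAddCircle)) ↔ 0 < ccw (x - p) ∧ ccw (x - p) < u := by
  rw [mem_cIoo_iff, add_sub_cancel_left, ccw_coe h0 h1]

/-- Points slightly after `p` lie in any arc starting at `p`. -/
lemma eventually_add_mem_cIoo {p q : UnitAddCircle} (h : p ≠ q) :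
    ∀ᶠ s : ℝ in 𝓝[>] 0, p + (s : UnitAddCircle) ∈ Set.cIoo p q := by
  have h' : 0 < ccw (q - p) := ccw_pos.2 (sub_ne_zero.2 h.symm)
  filter_upwards [Ioo_mem_nhdsGT h'] with s hs
  rw [mem_cIoo_iff, add_sub_cancel_left, ccw_coe hs.1.le (hs.2.trans (ccw_lt_one _))]
  exact hs

/-- Points slightly before `q` lie in any arc ending at `q`. -/
lemma eventually_sub_mem_cIoo {p q : UnitAddCircle} (h : p ≠ q) :
    ∀ᶠ s : ℝ in 𝓝[>] 0, q - (s : UnitAddCircle) ∈ Set.cIoo p q := by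
  have h' : 0 < ccw (q - p) := ccw_pos.2 (sub_ne_zero.2 h.symm)
  filter_upwards [Ioo_mem_nhdsGT h'] with s hs
  have : q - (s : UnitAddCircle) - p = ((ccw (q - p) - s : ℝ) : UnitAddCircle) := by
    rw [AddCircle.coe_sub, coe_ccw]; abel
  rw [mem_cIoo_iff, this, ccw_coe (by linarith [hs.2]) (by linarith [hs.1, ccw_lt_one (q - p)])]
  exact ⟨by linarith [hs.2], by linarith [hs.1]⟩

lemma tendsto_add_coe (p : UnitAddCircle) :
    Tendsto (fun s : ℝ => p + (s : UnitAddCircle)) (𝓝[>] 0) (𝓝 p) := by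
  have : Continuous fun s : ℝ => p + (s : UnitAddCircle) :=
    continuous_const.add (AddCircle.continuous_mk' 1)
  simpa using (this.tendsto 0).mono_left nhdsWithin_le_nhds

lemma tendsto_sub_coe (p : UnitAddCircle) :
    Tendsto (fun s : ℝ => p - (s : UnitAddCircle)) (𝓝[>] 0) (𝓝 p) := by
  have : Continuous fun s : ℝ => p - (s : UnitAddCircle) :=
    continuous_const.sub (AddCircle.continuous_mk' 1)
  simpa using (this.tendsto 0).mono_left nhdsWithin_le_nhds

/-- A property that holds slightly after and slightly before `p` and at `p` holds near `p`. -/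
lemma eventually_nhds_circle {P : UnitAddCircle → Prop} {p : UnitAddCircle} (h0 : P p)
    (h1 : ∀ᶠ s : ℝ in 𝓝[>] 0, P (p + (s : UnitAddCircle)))
    (h2 : ∀ᶠ s : ℝ in 𝓝[>] 0, P (p - (s : UnitAddCircle))) : ∀ᶠ x in 𝓝 p, P x := by
  obtain ⟨u, hu, h1⟩ := mem_nhdsGT_iff_exists_Ioo_subset.1 h1
  obtain ⟨v, hv, h2⟩ := mem_nhdsGT_iff_exists_Ioo_subset.1 h2
  simp only [Set.mem_Ioi] at hu hv
  have key : ∀ x : ℝ, |x| < min u v → P (p + (x : UnitAddCircle)) := fun x hx => by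
    rw [lt_min_iff, abs_lt, abs_lt] at hx
    rcases lt_trichotomy x 0 with h | h | h
    · have := h2 (a := -x) ⟨by linarith, by linarith⟩
      simpa using this
    · simpa [h] using h0
    · exact h1 ⟨h, hx.1.2⟩
  have hopen : IsOpenMap (fun x : ℝ => p + (x : UnitAddCircle)) :=
    (Homeomorph.addLeft p).isOpenMap.comp QuotientAddGroup.isOpenMap_coe
  have := hopen.image_mem_nhds (x := 0) (s := {x : ℝ | |x| < min u v})
    (by
      have : IsOpen {x : ℝ | |x| < min u v} := isOpen_lt continuous_abs continuous_const
      exact this.mem_nhds (by simp [hu, hv]))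
  simp only [QuotientAddGroup.mk_zero, add_zero] at this
  filter_upwards [this]
  rintro _ ⟨x, hx, rfl⟩
  exact key x hx

/-! ## Induction along an interval and around the circle -/

/-- The infimum of the counterexamples satisfies `P` by `hl` (or by `h0`), and then `hr` pushes the
counterexamples away from their infimum. -/
lemma real_induction {P : ℝ → Prop} (h0 : P 0)
    (hr : ∀ t, 0 ≤ t → t < 1 → P t → ∀ᶠ s : ℝ in 𝓝[>] 0, P (t + s))
    (hl : ∀ t, 0 < t → t ≤ 1 → (∀ᶠ s : ℝ in 𝓝[>] 0, P (t - s)) → P t) :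
    ∀ t, 0 ≤ t → t ≤ 1 → P t := by
  by_contra! hcon
  obtain ⟨b, hb0, hb1, hb⟩ := hcon
  set S := {t : ℝ | 0 ≤ t ∧ t ≤ 1 ∧ ¬ P t} with hS
  have hne : S.Nonempty := ⟨b, hb0, hb1, hb⟩
  have hbd : BddBelow S := ⟨0, fun t ht => ht.1⟩
  set a := sInf S with ha
  have ha0 : 0 ≤ a := le_csInf hne fun t ht => ht.1
  have ha1 : a ≤ 1 := (csInf_le hbd ⟨hb0, hb1, hb⟩).trans hb1
  have hlt : ∀ t, 0 ≤ t → t < a → P t := fun t ht hta => by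
    by_contra hP
    exact absurd (csInf_le hbd (a := t) ⟨ht, by linarith, hP⟩) (not_le.2 hta)
  have hPa : P a := by
    rcases ha0.eq_or_lt with h | h
    · rw [← h]; exact h0
    · refine hl a h ha1 ?_
      filter_upwards [Ioo_mem_nhdsGT h] with s hs
      exact hlt _ (by linarith [hs.2]) (by linarith [hs.1])
  have ha1' : a < 1 := by
    rcases ha1.lt_or_eq with h | h
    · exact h
    · exfalso
      have hba : a ≤ b := csInf_le hbd ⟨hb0, hb1, hb⟩
      have : b = a := by linarith
      exact hb (this ▸ hPa)
  obtain ⟨u, hu, h1⟩ := mem_nhdsGT_iff_exists_Ioo_subset.1 (hr a ha0 ha1' hPa)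
  simp only [Set.mem_Ioi] at hu
  have : a + u ≤ a := le_csInf hne fun t ht => by
    by_contra! htu
    rcases (csInf_le hbd ht).eq_or_lt with h | h
    · exact ht.2.2 (h ▸ hPa)
    · have := h1 (a := t - a) ⟨by linarith, by linarith⟩
      simp only [Set.mem_ofPred_eq, add_sub_cancel] at this
      exact ht.2.2 this
  linarith

/-- Traces are specified only by their germs to the right and to the left of each time, and this is
the principle that turns such local rules into global statements. One turn from `t₀` reaches every
point; there is no condition on returning since `P` is a predicate on the circle itself. -/
lemma circle_induction {P : UnitAddCircle → Prop} (t₀ : UnitAddCircle) (h0 : P t₀)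
    (hr : ∀ t, P t → ∀ᶠ s : ℝ in 𝓝[>] 0, P (t + (s : UnitAddCircle)))
    (hl : ∀ t, (∀ᶠ s : ℝ in 𝓝[>] 0, P (t - (s : UnitAddCircle))) → P t) (t : UnitAddCircle) :
    P t := by
  have := real_induction (P := fun u => P (t₀ + (u : UnitAddCircle))) (by simpa using h0)
    (fun u _ _ hu => by
      filter_upwards [hr _ hu] with s hs
      rwa [AddCircle.coe_add, ← add_assoc])
    (fun u _ _ hu => hl _ (by
      filter_upwards [hu] with s hs
      rwa [AddCircle.coe_sub, ← add_sub_assoc] at hs)) (ccw (t - t₀)) (ccw_nonneg _)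
      (ccw_lt_one _).le
  simpa using this

lemma circle_induction_neg {P : UnitAddCircle → Prop} (t₀ : UnitAddCircle) (h0 : P t₀)
    (hl : ∀ t, P t → ∀ᶠ s : ℝ in 𝓝[>] 0, P (t - (s : UnitAddCircle)))
    (hr : ∀ t, (∀ᶠ s : ℝ in 𝓝[>] 0, P (t + (s : UnitAddCircle))) → P t) (t : UnitAddCircle) :
    P t := by
  have := circle_induction (P := fun x => P (-x)) (-t₀) (by simpa using h0)
    (fun t ht => by
      filter_upwards [hl _ ht] with s hs
      rwa [neg_add])
    (fun t ht => hr _ (by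
      filter_upwards [ht] with s hs
      rwa [neg_sub, sub_eq_add_neg, add_comm] at hs)) (-t)
  simpa using this

end

noncomputable section


/-! ### One-sided neighbourhoods on the circle -/

lemma eventually_forall_cIoo_add {P : UnitAddCircle → Prop} {p : UnitAddCircle}
    (h : ∀ᶠ s : ℝ in 𝓝[>] 0, P (p + (s : UnitAddCircle))) :
    ∀ᶠ s : ℝ in 𝓝[>] 0, ∀ x ∈ Set.cIoo p (p + (s : UnitAddCircle)), P x := by
  obtain ⟨u, hu, h1⟩ := mem_nhdsGT_iff_exists_Ioo_subset.1 h
  filter_upwards [Ioo_mem_nhdsGT (lt_min hu one_pos)] with s hs x hx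
  have hs2 := lt_min_iff.1 hs.2
  rw [mem_cIoo_add hs.1.le hs2.2] at hx
  have := h1 (a := ccw (x - p)) ⟨hx.1, by linarith⟩
  simpa using this

lemma eventually_forall_cIoo_sub {P : UnitAddCircle → Prop} {p : UnitAddCircle}
    (h : ∀ᶠ s : ℝ in 𝓝[>] 0, P (p - (s : UnitAddCircle))) :
    ∀ᶠ s : ℝ in 𝓝[>] 0, ∀ x ∈ Set.cIoo (p - (s : UnitAddCircle)) p, P x := by
  obtain ⟨u, hu, h1⟩ := mem_nhdsGT_iff_exists_Ioo_subset.1 h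
  filter_upwards [Ioo_mem_nhdsGT (lt_min hu one_pos)] with s hs x hx
  have hs2 := lt_min_iff.1 hs.2
  rw [mem_cIoo_iff] at hx
  have e : p - (p - (s : UnitAddCircle)) = s := by abel
  rw [e, ccw_coe hs.1.le hs2.2] at hx
  set t := ccw (x - (p - (s : UnitAddCircle)))
  have := h1 (a := s - t) ⟨by linarith, by linarith⟩
  have e2 : p - ((s - t : ℝ) : UnitAddCircle) = x := by
    rw [AddCircle.coe_sub, coe_ccw]; abel
  simp only [Set.mem_ofPred_eq, e2] at this
  exact this

lemma eventually_nhdsGT_pos_lt (u : ℝ) (hu : 0 < u) : ∀ᶠ s : ℝ in 𝓝[>] 0, 0 < s ∧ s < u :=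
  Ioo_mem_nhdsGT hu

lemma sub_coe_ne {p : UnitAddCircle} {s : ℝ} (h0 : 0 < s) (h1 : s < 1) :
    p - (s : UnitAddCircle) ≠ p := by
  intro h
  have h2 : ccw (s : UnitAddCircle) = 0 := ccw_eq_zero.2 (by simpa using h)
  rw [ccw_coe h0.le h1] at h2
  linarith

lemma add_coe_ne {p : UnitAddCircle} {s : ℝ} (h0 : 0 < s) (h1 : s < 1) :
    p + (s : UnitAddCircle) ≠ p := by
  intro h
  have h2 : ccw (s : UnitAddCircle) = 0 := ccw_eq_zero.2 (by simpa using h)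
  rw [ccw_coe h0.le h1] at h2
  linarith

/-! ## Length of the part of a set on an arc -/

/-- Translate `p` to `0` and pull back along `ℝ → ℝ/ℤ`, which preserves measure on `(0, 1]`. The end
point `1` of this interval is sent to `0` and does not lie in the arc. -/
lemma volume_real_cIoo (p q : UnitAddCircle) : volume.real (Set.cIoo p q) = ccw (q - p) := by
  have h1 : (fun x => x + p) ⁻¹' Set.cIoo p q = Set.cIoo 0 (q - p) := by
    ext x
    change x + p ∈ Set.cIoo p q ↔ _
    rw [mem_cIoo_iff, mem_cIoo_iff]
    simp
  have h2 : volume (Set.cIoo p q) = volume (Set.cIoo 0 (q - p)) := by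
    rw [← h1, measure_preimage_add_right]
  have h3 := (UnitAddCircle.measurePreserving_mk 0).measure_preimage
    (isOpen_cIoo 0 (q - p)).measurableSet.nullMeasurableSet
  rw [Measure.real, h2, ← h3, Measure.restrict_apply
    ((UnitAddCircle.measurePreserving_mk 0).measurable (isOpen_cIoo 0 (q - p)).measurableSet)]
  have h4 : ((QuotientAddGroup.mk : ℝ → UnitAddCircle) ⁻¹' Set.cIoo 0 (q - p)) ∩ Set.Ioc 0 (0 + 1)
      = Set.Ioo 0 (ccw (q - p)) := by
    ext u
    have hq := ccw_lt_one (q - p)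
    simp only [Set.mem_inter_iff, Set.mem_preimage, mem_cIoo_iff, sub_zero, Set.mem_Ioc, zero_add,
      Set.mem_Ioo]
    constructor
    · rintro ⟨⟨h1, h2⟩, h3, h4⟩
      rcases h4.lt_or_eq with h5 | h5
      · have e : ccw (QuotientAddGroup.mk u : UnitAddCircle) = u := ccw_coe h3.le h5
        rw [e] at h1 h2
        exact ⟨h1, h2⟩
      · have e : (QuotientAddGroup.mk u : UnitAddCircle) = 0 := by rw [h5]; exact coe_one_eq_zero
        rw [e, ccw_zero] at h1
        exact absurd h1 (lt_irrefl _)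
    · rintro ⟨h1, h2⟩
      have e : ccw (QuotientAddGroup.mk u : UnitAddCircle) = u := ccw_coe h1.le (by linarith)
      rw [e]
      exact ⟨⟨h1, h2⟩, h1, by linarith⟩
  rw [h4, Real.volume_Ioo, sub_zero, ENNReal.toReal_ofReal (ccw_nonneg _)]

lemma volume_singleton_circle (q : UnitAddCircle) : volume ({q} : Set UnitAddCircle) = 0 := by
  have h : ∀ s : ℝ, 0 < s → s < 1 / 2 → volume.real ({q} : Set UnitAddCircle) ≤ 2 * s :=
    fun s h0 h1 => by
      have e : q + (s : UnitAddCircle) - (q - (s : UnitAddCircle)) =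
          ((2 * s : ℝ) : UnitAddCircle) := by
        rw [two_mul, AddCircle.coe_add]; abel
      have h2 := volume_real_cIoo (q - (s : UnitAddCircle)) (q + (s : UnitAddCircle))
      rw [e, ccw_coe (by linarith) (by linarith)] at h2
      rw [← h2]
      refine measureReal_mono (Set.singleton_subset_iff.2 ?_)
      rw [mem_cIoo_iff, sub_sub_cancel, e, ccw_coe (by linarith) (by linarith),
        ccw_coe (by linarith) (by linarith)]
      exact ⟨h0, by linarith⟩
  have h0 : volume.real ({q} : Set UnitAddCircle) = 0 := by
    refine le_antisymm (le_of_forall_pos_lt_add fun ε hε => ?_) measureReal_nonneg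
    refine (h (min (ε / 4) (1 / 4)) (by positivity) ?_).trans_lt ?_
    · linarith [min_le_right (ε / 4) (1 / 4)]
    · linarith [min_le_left (ε / 4) (1 / 4)]
  exact (measureReal_eq_zero_iff).1 h0

lemma volume_real_univ_circle : volume.real (Set.univ : Set UnitAddCircle) = 1 := by
  rw [Measure.real, UnitAddCircle.measure_univ, ENNReal.toReal_one]

/-- The length of the part of `R` on the open arc from `p` to `q`. -/
def arcVol (R : Set UnitAddCircle) (p q : UnitAddCircle) : ℝ := volume.real (R ∩ Set.cIoo p q)

variable {R : Set UnitAddCircle}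

lemma arcVol_nonneg (p q : UnitAddCircle) : 0 ≤ arcVol R p q := measureReal_nonneg

lemma arcVol_le (p q : UnitAddCircle) : arcVol R p q ≤ volume.real R :=
  measureReal_mono Set.inter_subset_left

@[simp] lemma arcVol_self (p : UnitAddCircle) : arcVol R p p = 0 := by
  rw [arcVol, cIoo_self]; simp

/-- The set `R` is arbitrary: only `T` has to be measurable to split the measure, so lengths along
arcs are additive without any condition on `R`. -/
lemma measureReal_inter_union_singleton (R S T : Set UnitAddCircle) (q : UnitAddCircle)
    (hT : MeasurableSet T) (hST : Disjoint S T) :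
    volume.real (R ∩ (S ∪ T ∪ {q})) = volume.real (R ∩ S) + volume.real (R ∩ T) := by
  have h1 : volume (R ∩ (S ∪ T ∪ {q})) = volume (R ∩ (S ∪ T)) := by
    apply le_antisymm
    · rw [Set.inter_union_distrib_left]
      refine (measure_union_le _ _).trans ?_
      rw [measure_mono_null Set.inter_subset_right (volume_singleton_circle q), add_zero]
    · exact measure_mono (Set.inter_subset_inter_right _ Set.subset_union_left)
  have h2 : volume (R ∩ (S ∪ T)) = volume (R ∩ S) + volume (R ∩ T) := by
    apply le_antisymm
    · rw [Set.inter_union_distrib_left]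
      exact measure_union_le _ _
    · have h3 := measure_inter_add_sdiff (μ := volume) (R ∩ (S ∪ T)) hT
      rw [← h3, add_comm]
      exact add_le_add (measure_mono fun x hx => ⟨⟨hx.1, Or.inr hx.2⟩, hx.2⟩)
        (measure_mono fun x hx => ⟨⟨hx.1, Or.inl hx.2⟩, fun h => Set.disjoint_left.1 hST hx.2 h⟩)
  rw [Measure.real, h1, h2, ENNReal.toReal_add (measure_ne_top _ _) (measure_ne_top _ _)]
  rfl

lemma arcVol_add {p q r : UnitAddCircle} (h : q ∈ Set.cIoo p r) :
    arcVol R p r = arcVol R p q + arcVol R q r := by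
  have e : Set.cIoo p r = Set.cIoo p q ∪ Set.cIoo q r ∪ {q} := by
    ext x
    have hx := ccw_sub_eq_iff (p := p) (x := x) (y := q)
    rw [Set.mem_union, Set.mem_union, Set.mem_singleton_iff, mem_cIoo_iff_ccw p x p r,
      mem_cIoo_iff_ccw p x p q, mem_cIoo_iff_ccw p x q r, ← hx]
    rw [mem_cIoo_iff_ccw p] at h
    have := ccw_nonneg (x - p)
    have := ccw_nonneg (q - p)
    have := ccw_nonneg (r - p)
    rw [sub_self, ccw_zero] at *
    grind
  rw [arcVol, e, measureReal_inter_union_singleton _ _ _ _ (isOpen_cIoo _ _).measurableSet]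
  · rfl
  · rw [Set.disjoint_left]
    intro x h1 h2
    rw [mem_cIoo_iff_ccw p] at h h1 h2
    have := ccw_nonneg (x - p)
    have := ccw_nonneg (q - p)
    have := ccw_nonneg (r - p)
    rw [sub_self, ccw_zero] at *
    grind

lemma arcVol_compl {p q : UnitAddCircle} (h : p ≠ q) :
    arcVol R p q + arcVol R q p = volume.real R := by
  have e : R ∩ (Set.cIoo p q ∪ (Set.cIoo q p ∪ {p}) ∪ {q}) = R := by
    ext x
    simp only [Set.mem_inter_iff, Set.mem_union, Set.mem_singleton_iff, and_iff_left_iff_imp]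
    intro _
    by_cases h1 : x = p
    · exact Or.inl (Or.inr (Or.inr h1))
    by_cases h2 : x = q
    · exact Or.inr h2
    rcases mem_cIoo_or h1 h2 h with h3 | h3
    · exact Or.inl (Or.inl h3)
    · exact Or.inl (Or.inr (Or.inl h3))
  have h2 : volume.real (R ∩ (Set.cIoo q p ∪ {p})) = volume.real (R ∩ Set.cIoo q p) := by
    have := measureReal_inter_union_singleton R (Set.cIoo q p) ∅ p MeasurableSet.empty (by simp)
    simpa using this
  rw [← e, measureReal_inter_union_singleton, h2, e]
  · rfl
  · exact (isOpen_cIoo _ _).measurableSet.union (measurableSet_singleton p)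
  · rw [Set.disjoint_union_right]
    exact ⟨disjoint_cIoo p q, Set.disjoint_singleton_right.2 (left_not_mem_cIoo p q)⟩

lemma arcVol_eq_zero_of_disjoint {p q : UnitAddCircle} (h : ∀ x ∈ Set.cIoo p q, x ∉ R) :
    arcVol R p q = 0 := by
  have : R ∩ Set.cIoo p q = ∅ := by
    ext x; simp only [Set.mem_inter_iff, Set.mem_empty_iff_false, iff_false]
    exact fun hx => h x hx.2 hx.1
  rw [arcVol, this]; simp

lemma arcVol_eq_ccw_of_subset {p q : UnitAddCircle} (h : ∀ x ∈ Set.cIoo p q, x ∈ R) :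
    arcVol R p q = ccw (q - p) := by
  rw [arcVol, Set.inter_eq_right.2 h, volume_real_cIoo]

lemma exists_mem_of_arcVol_ne_zero {p q : UnitAddCircle} (h : arcVol R p q ≠ 0) :
    ∃ x ∈ Set.cIoo p q, x ∈ R := by
  by_contra! hc
  exact h (arcVol_eq_zero_of_disjoint hc)

lemma eventually_arcVol_add_eq {p : UnitAddCircle}
    (h : ∀ᶠ s : ℝ in 𝓝[>] 0, p + (s : UnitAddCircle) ∈ R) :
    ∀ᶠ s : ℝ in 𝓝[>] 0, arcVol R p (p + (s : UnitAddCircle)) = s := by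
  filter_upwards [eventually_forall_cIoo_add h, eventually_nhdsGT_pos_lt 1 one_pos] with s hs h1
  rw [arcVol_eq_ccw_of_subset hs, add_sub_cancel_left, ccw_coe h1.1.le h1.2]

lemma eventually_arcVol_add_eq_zero {p : UnitAddCircle}
    (h : ∀ᶠ s : ℝ in 𝓝[>] 0, p + (s : UnitAddCircle) ∉ R) :
    ∀ᶠ s : ℝ in 𝓝[>] 0, arcVol R p (p + (s : UnitAddCircle)) = 0 := by
  filter_upwards [eventually_forall_cIoo_add (P := fun x => x ∉ R) h] with s hs
  exact arcVol_eq_zero_of_disjoint hs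

lemma eventually_arcVol_sub_eq {p : UnitAddCircle}
    (h : ∀ᶠ s : ℝ in 𝓝[>] 0, p - (s : UnitAddCircle) ∈ R) :
    ∀ᶠ s : ℝ in 𝓝[>] 0, arcVol R (p - (s : UnitAddCircle)) p = s := by
  filter_upwards [eventually_forall_cIoo_sub h, eventually_nhdsGT_pos_lt 1 one_pos] with s hs h1
  rw [arcVol_eq_ccw_of_subset hs, sub_sub_cancel, ccw_coe h1.1.le h1.2]

lemma eventually_arcVol_sub_eq_zero {p : UnitAddCircle}
    (h : ∀ᶠ s : ℝ in 𝓝[>] 0, p - (s : UnitAddCircle) ∉ R) :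
    ∀ᶠ s : ℝ in 𝓝[>] 0, arcVol R (p - (s : UnitAddCircle)) p = 0 := by
  filter_upwards [eventually_forall_cIoo_sub (P := fun x => x ∉ R) h] with s hs
  exact arcVol_eq_zero_of_disjoint hs

lemma arcVol_pos_of_right {p q : UnitAddCircle} (hpq : p ≠ q)
    (h : ∀ᶠ s : ℝ in 𝓝[>] 0, p + (s : UnitAddCircle) ∈ R) : 0 < arcVol R p q := by
  obtain ⟨s, h1, h2, h3⟩ := (eventually_add_mem_cIoo hpq |>.and
    ((eventually_arcVol_add_eq h).and (eventually_nhdsGT_pos_lt 1 one_pos))).exists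
  rw [arcVol_add h1, h2]
  linarith [arcVol_nonneg (R := R) (p + (s : UnitAddCircle)) q]

lemma arcVol_pos_of_left {p q : UnitAddCircle} (hpq : p ≠ q)
    (h : ∀ᶠ s : ℝ in 𝓝[>] 0, q - (s : UnitAddCircle) ∈ R) : 0 < arcVol R p q := by
  obtain ⟨s, h1, h2, h3⟩ := (eventually_sub_mem_cIoo hpq |>.and
    ((eventually_arcVol_sub_eq h).and (eventually_nhdsGT_pos_lt 1 one_pos))).exists
  rw [arcVol_add h1, h2]
  linarith [arcVol_nonneg (R := R) p (q - (s : UnitAddCircle))]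

lemma arcVol_pos_of_mem {p q x : UnitAddCircle} (hx : x ∈ Set.cIoo p q)
    (h : ∀ᶠ s : ℝ in 𝓝[>] 0, x + (s : UnitAddCircle) ∈ R) : 0 < arcVol R p q := by
  have hxq : x ≠ q := by rintro rfl; exact right_not_mem_cIoo _ _ hx
  rw [arcVol_add hx]
  linarith [arcVol_nonneg (R := R) p x, arcVol_pos_of_right hxq h]

/-! ## Pinching everything outside a set -/

/-- The part of the length of `R` that is travelled from `p` to `q`, in `ℝ/ℤ`. -/
def pinch (R : Set UnitAddCircle) (p q : UnitAddCircle) : UnitAddCircle :=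
  ((arcVol R p q / volume.real R : ℝ) : UnitAddCircle)

@[simp] lemma pinch_self (p : UnitAddCircle) : pinch R p p = 0 := by simp [pinch]

lemma arcVol_div_mem (p q : UnitAddCircle) :
    0 ≤ arcVol R p q / volume.real R ∧ arcVol R p q / volume.real R ≤ 1 :=
  ⟨div_nonneg (arcVol_nonneg p q) measureReal_nonneg,
    div_le_one_of_le₀ (arcVol_le p q) measureReal_nonneg⟩

lemma pinch_swap (hR : volume.real R ≠ 0) (p q : UnitAddCircle) :
    pinch R p q + pinch R q p = 0 := by
  by_cases h : p = q
  · subst h; simp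
  · rw [pinch, pinch, ← AddCircle.coe_add, ← add_div, arcVol_compl h, div_self hR,
      coe_one_eq_zero]

lemma pinch_add_of_mem {p q r : UnitAddCircle} (h : q ∈ Set.cIoo p r) :
    pinch R p q + pinch R q r = pinch R p r := by
  rw [pinch, pinch, ← AddCircle.coe_add, ← add_div, ← arcVol_add h, pinch]

/-- When `q` is not between `p` and `r`, the path through `q` makes one extra turn. It costs the
whole length of `R`, which is `1 = 0` after normalization. -/
lemma pinch_add (hR : volume.real R ≠ 0) (p q r : UnitAddCircle) :
    pinch R p q + pinch R q r = pinch R p r := by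
  by_cases h1 : p = q
  · subst h1; simp
  by_cases h2 : q = r
  · subst h2; simp
  by_cases h3 : p = r
  · subst h3; simpa using pinch_swap hR p q
  rcases mem_cIoo_or (Ne.symm h1) h2 h3 with h | h
  · exact pinch_add_of_mem h
  · have h' : r ∈ Set.cIoo p q := by rw [cIoo_rotate]; rw [cIoo_rotate]; exact h
    have e := pinch_add_of_mem (R := R) h'
    have e2 := pinch_swap hR r q
    rw [← e, add_assoc, e2, add_zero]

lemma pinch_eq_sub (hR : volume.real R ≠ 0) (z p q : UnitAddCircle) :
    pinch R p q = pinch R z q - pinch R z p := by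
  rw [← pinch_add hR z p q]; abel

/-- The normalized length lies in `[0, 1]`, whose only integers are `0` and `1`. -/
lemma pinch_eq_zero_iff (hR : volume.real R ≠ 0) {p q : UnitAddCircle} :
    pinch R p q = 0 ↔ arcVol R p q = 0 ∨ arcVol R p q = volume.real R := by
  rw [pinch, coe_eq_zero_iff_int]
  have h := arcVol_div_mem (R := R) p q
  constructor
  · rintro ⟨k, hk⟩
    rw [← hk] at h
    have h0 : 0 ≤ k := by exact_mod_cast h.1
    have h1 : k ≤ 1 := by exact_mod_cast h.2
    interval_cases k
    · left
      have : arcVol R p q / volume.real R = 0 := by rw [← hk]; simp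
      exact (div_eq_zero_iff.1 this).resolve_right hR
    · right
      have : arcVol R p q / volume.real R = 1 := by rw [← hk]; simp
      exact (div_eq_one_iff_eq hR).1 this
  · rintro (h | h)
    · exact ⟨0, by simp [h]⟩
    · exact ⟨1, by simp [h, hR]⟩

lemma pinch_eq_zero_iff_of_ne (hR : volume.real R ≠ 0) {p q : UnitAddCircle} (hpq : p ≠ q) :
    pinch R p q = 0 ↔ arcVol R p q = 0 ∨ arcVol R q p = 0 := by
  rw [pinch_eq_zero_iff hR, ← arcVol_compl (R := R) hpq]
  simp

lemma ccw_pinch_of_lt {p q : UnitAddCircle} (h : arcVol R p q < volume.real R) :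
    ccw (pinch R p q) = arcVol R p q / volume.real R := by
  have h0 : 0 < volume.real R := (arcVol_nonneg p q).trans_lt h
  exact ccw_coe (arcVol_div_mem p q).1 ((div_lt_one h0).2 h)

lemma eventually_pinch_add_eq {p : UnitAddCircle}
    (h : ∀ᶠ s : ℝ in 𝓝[>] 0, p + (s : UnitAddCircle) ∈ R) : ∀ᶠ s : ℝ in 𝓝[>] 0,
      pinch R p (p + (s : UnitAddCircle)) = ((s / volume.real R : ℝ) : UnitAddCircle) := by
  filter_upwards [eventually_arcVol_add_eq h] with s hs
  rw [pinch, hs]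

lemma eventually_pinch_sub_eq {p : UnitAddCircle}
    (h : ∀ᶠ s : ℝ in 𝓝[>] 0, p - (s : UnitAddCircle) ∈ R) : ∀ᶠ s : ℝ in 𝓝[>] 0,
      pinch R (p - (s : UnitAddCircle)) p = ((s / volume.real R : ℝ) : UnitAddCircle) := by
  filter_upwards [eventually_arcVol_sub_eq h] with s hs
  rw [pinch, hs]

lemma eventually_pinch_sub_eq_zero {p : UnitAddCircle}
    (h : ∀ᶠ s : ℝ in 𝓝[>] 0, p - (s : UnitAddCircle) ∉ R) : ∀ᶠ s : ℝ in 𝓝[>] 0,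
      pinch R (p - (s : UnitAddCircle)) p = 0 := by
  filter_upwards [eventually_arcVol_sub_eq_zero h] with s hs
  simp [pinch, hs]

end

noncomputable section


/-! # Dual graphs -/

lemma SimpleGraph.Reachable.induct {V : Type*} {G : SimpleGraph V} {u v : V} (h : G.Reachable u v)
    {Q : V → Prop} (h0 : Q u) (hs : ∀ a b, G.Adj a b → Q a → Q b) : Q v := by
  obtain ⟨w⟩ := h
  induction w with
  | nil => exact h0
  | cons hab _ ih => exact ih (hs _ _ hab h0)

section dualGraph

variable {n : ℕ} {next : Equiv.Perm (LobePoint n)}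

lemma dualGraph_adj_inl_inr {i : Fin n} {P : IntersectionPoint next} :
    (dualGraph next).Adj (Sum.inl i) (Sum.inr P) ↔ ∃ t, (i, t) ∈ P.1 := by
  simp [dualGraph, SimpleGraph.fromRel_adj]

lemma dualGraph_adj_inr_inl {i : Fin n} {P : IntersectionPoint next} :
    (dualGraph next).Adj (Sum.inr P) (Sum.inl i) ↔ ∃ t, (i, t) ∈ P.1 := by
  rw [SimpleGraph.adj_comm, dualGraph_adj_inl_inr]

lemma not_dualGraph_adj_inl_inl {i j : Fin n} : ¬ (dualGraph next).Adj (Sum.inl i) (Sum.inl j) := by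
  simp [dualGraph, SimpleGraph.fromRel_adj]

lemma not_dualGraph_adj_inr_inr {P P' : IntersectionPoint next} :
    ¬ (dualGraph next).Adj (Sum.inr P) (Sum.inr P') := by
  simp [dualGraph, SimpleGraph.fromRel_adj]

/-- The intersection point through a point which is moved by `next`. -/
def intersectionPointOf (x : LobePoint n) (hx : next x ≠ x) : IntersectionPoint next :=
  ⟨{y | next.SameCycle x y}, x, hx, rfl⟩

lemma mem_intersectionPointOf (x : LobePoint n) (hx : next x ≠ x) :
    x ∈ (intersectionPointOf x hx).1 := Equiv.Perm.SameCycle.refl _ _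

lemma next_mem_intersectionPointOf (x : LobePoint n) (hx : next x ≠ x) :
    next x ∈ (intersectionPointOf x hx).1 :=
  (Equiv.Perm.SameCycle.refl next x).apply_right

lemma IntersectionPoint.sameCycle {P : IntersectionPoint next} {x y : LobePoint n} (hx : x ∈ P.1)
    (hy : y ∈ P.1) : next.SameCycle x y := by
  obtain ⟨P, z, hz, rfl⟩ := P
  exact (Equiv.Perm.SameCycle.symm hx).trans hy

lemma IntersectionPoint.mem_of_sameCycle {P : IntersectionPoint next} {x y : LobePoint n}
    (hx : x ∈ P.1) (h : next.SameCycle x y) : y ∈ P.1 := by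
  obtain ⟨P, z, hz, rfl⟩ := P
  exact Equiv.Perm.SameCycle.trans hx h

lemma IntersectionPoint.eq_of_mem {P P' : IntersectionPoint next} {x : LobePoint n}
    (h : x ∈ P.1) (h' : x ∈ P'.1) : P = P' := by
  apply Subtype.ext
  ext y
  exact ⟨fun hy => mem_of_sameCycle h' (sameCycle h hy),
    fun hy => mem_of_sameCycle h (sameCycle h' hy)⟩

lemma IntersectionPoint.exists_mem (P : IntersectionPoint next) : ∃ x, x ∈ P.1 := by
  obtain ⟨P, z, hz, rfl⟩ := P
  exact ⟨z, Equiv.Perm.SameCycle.refl _ _⟩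

lemma IntersectionPoint.next_ne (P : IntersectionPoint next) {x : LobePoint n} (hx : x ∈ P.1) :
    next x ≠ x := by
  obtain ⟨P, z, hz, rfl⟩ := P
  intro h
  exact hz ((Equiv.Perm.SameCycle.apply_eq_self_iff hx).2 h)

lemma eq_of_sameCycle_of_next {α : Type*} {ρ : LobePoint n → α} (h : ∀ x, ρ (next x) = ρ x)
    {x y : LobePoint n} (hxy : next.SameCycle x y) : ρ x = ρ y := by
  have key : ∀ (m : ℕ) x, ρ ((next ^ m) x) = ρ x := fun m => by
    induction m with
    | zero => simp
    | succ m ih => intro x; rw [pow_succ', Equiv.Perm.mul_apply, h, ih]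
  obtain ⟨m, rfl⟩ := hxy
  obtain ⟨m, rfl | rfl⟩ := m.eq_nat_or_neg
  · rw [zpow_natCast, key]
  · have := key m ((next ^ (-(m : ℤ))) x)
    rw [← this, ← zpow_natCast, ← Equiv.Perm.mul_apply, ← zpow_add]
    simp

/-- A configuration of circles with compatible retractions onto all circles has no cycles. -/
lemma dualGraph_isAcyclic (ρ : Fin n → LobePoint n → UnitAddCircle)
    (h1 : ∀ i s, ρ i (i, s) = s) (h2 : ∀ i j s s', j ≠ i → ρ i (j, s) = ρ i (j, s'))
    (h3 : ∀ i x, ρ i (next x) = ρ i x) : (dualGraph next).IsAcyclic := by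
  have key : ∀ (i : Fin n) (P : IntersectionPoint next), (dualGraph next).Adj (Sum.inl i)
      (Sum.inr P) → (dualGraph next).IsBridge s(Sum.inr P, Sum.inl i) := fun i P hiP => by
    rw [SimpleGraph.isBridge_iff]
    intro hr
    obtain ⟨t, ht⟩ := dualGraph_adj_inl_inr.1 hiP
    -- The edge is a bridge: everything that can be reached from `P` without it retracts to the
    -- single point `t` of the `i`-th lobe, and is not that lobe.
    have := hr.induct (Q := fun v => match v with
      | Sum.inl j => j ≠ i ∧ ∀ s, ρ i (j, s) = t
      | Sum.inr P' => ∀ x ∈ P'.1, ρ i x = t)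
      (fun x hx => by
        rw [← h1 i t]
        exact eq_of_sameCycle_of_next (h3 i) (IntersectionPoint.sameCycle hx ht))
      (by
        rintro (j | P') (j' | P'') hadj hQ
        · exact absurd (SimpleGraph.deleteEdges_le _ hadj) not_dualGraph_adj_inl_inl
        · intro x hx
          obtain ⟨s, hs⟩ := dualGraph_adj_inl_inr.1 (SimpleGraph.deleteEdges_le _ hadj)
          rw [← hQ.2 s]
          exact eq_of_sameCycle_of_next (h3 i) (IntersectionPoint.sameCycle hx hs)
        · obtain ⟨s, hs⟩ := dualGraph_adj_inr_inl.1 (SimpleGraph.deleteEdges_le _ hadj)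
          have hv := hQ _ hs
          have hne : j' ≠ i := by
            -- The `i`-th lobe can only be entered at a point with `ρ i`-value `t`, that is at `(i,
            -- t)`, and the intersection point through it is `P`. This is the deleted edge.
            rintro rfl
            rw [h1] at hv
            subst hv
            have hPP : P = P' := IntersectionPoint.eq_of_mem ht hs
            subst hPP
            rw [SimpleGraph.deleteEdges_adj] at hadj
            exact hadj.2 rfl
          exact ⟨hne, fun s' => (h2 i j' s' s hne).trans hv⟩
        · exact absurd (SimpleGraph.deleteEdges_le _ hadj) not_dualGraph_adj_inr_inr)
    exact this.1 rfl
  rw [SimpleGraph.isAcyclic_iff_forall_adj_isBridge]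
  rintro (j | P') (j' | P'') hadj
  · exact absurd hadj not_dualGraph_adj_inl_inl
  · rw [Sym2.eq_swap]; exact key _ _ hadj
  · exact key _ _ hadj.symm
  · exact absurd hadj not_dualGraph_adj_inr_inr

end dualGraph

/-! # Boundary traces -/

/-- The point reached from `x` after the time `s` along the lobe of `x`. -/
def lobeShift {n : ℕ} (size : Fin n → ℝ) (x : LobePoint n) (s : ℝ) : LobePoint n :=
  (x.1, x.2 + ((s / size x.1 : ℝ) : UnitAddCircle))

@[simp] lemma lobeShift_fst {n : ℕ} (size : Fin n → ℝ) (x : LobePoint n) (s : ℝ) :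
    (lobeShift size x s).1 = x.1 := rfl

lemma lobeShift_lobeShift {n : ℕ} (size : Fin n → ℝ) (x : LobePoint n) (s s' : ℝ) :
    lobeShift size (lobeShift size x s) s' = lobeShift size x (s + s') := by
  simp only [lobeShift, add_div, AddCircle.coe_add, add_assoc]

@[simp] lemma lobeShift_zero {n : ℕ} (size : Fin n → ℝ) (x : LobePoint n) :
    lobeShift size x 0 = x := by simp [lobeShift]

lemma lobeShift_injective {n : ℕ} (size : Fin n → ℝ) (s : ℝ) :
    Function.Injective fun x : LobePoint n => lobeShift size x s := fun x y h => by
  have := congrArg (fun x => lobeShift size x (-s)) h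
  simpa [lobeShift_lobeShift] using this

/-- The boundary of a cactus, traced by `φ` (with left limits `ψ`), with the retractions `ρ i` onto
the lobes. -/
structure BoundaryTrace (n : ℕ) where
  size : Fin n → ℝ
  φ : UnitAddCircle → LobePoint n
  ψ : UnitAddCircle → LobePoint n
  ρ : Fin n → LobePoint n → UnitAddCircle
  size_pos : ∀ i, 0 < size i
  sum_size : ∑ i, size i = 1
  right : ∀ t, ∀ᶠ s : ℝ in 𝓝[>] 0, φ (t + (s : UnitAddCircle)) = lobeShift size (φ t) s
  left : ∀ t, ∀ᶠ s : ℝ in 𝓝[>] 0, φ (t - (s : UnitAddCircle)) = lobeShift size (ψ t) (-s)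
  ρ_self : ∀ i s, ρ i (i, s) = s
  ρ_const : ∀ i j s s', j ≠ i → ρ i (j, s) = ρ i (j, s')
  ρ_glue : ∀ i t, ρ i (φ t) = ρ i (ψ t)
  visit : ∀ i, ∃ t, (φ t).1 = i

namespace BoundaryTrace

variable {n : ℕ} (T : BoundaryTrace n)

/-- The pinching map, projected to the `i`-th lobe. -/
def f (i : Fin n) (t : UnitAddCircle) : UnitAddCircle := T.ρ i (T.φ t)

lemma f_eq_ψ (i : Fin n) (t : UnitAddCircle) : T.f i t = T.ρ i (T.ψ t) := T.ρ_glue i t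

lemma f_φ (t : UnitAddCircle) : T.f (T.φ t).1 t = (T.φ t).2 := T.ρ_self _ _

lemma f_ψ (t : UnitAddCircle) : T.f (T.ψ t).1 t = (T.ψ t).2 := by
  rw [f_eq_ψ]; exact T.ρ_self _ _

lemma φ_eq (t : UnitAddCircle) : T.φ t = ((T.φ t).1, T.f (T.φ t).1 t) := by rw [f_φ]

lemma ψ_eq (t : UnitAddCircle) : T.ψ t = ((T.ψ t).1, T.f (T.ψ t).1 t) := by rw [f_ψ]

/-- The left limit at `t + s` is read off at a slightly earlier time `t + (s - s')`, where the
motion of `φ` after `t` is known. -/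
lemma ψ_right (t : UnitAddCircle) :
    ∀ᶠ s : ℝ in 𝓝[>] 0, T.ψ (t + (s : UnitAddCircle)) = lobeShift T.size (T.φ t) s := by
  obtain ⟨u, hu, h1⟩ := mem_nhdsGT_iff_exists_Ioo_subset.1 (T.right t)
  filter_upwards [Ioo_mem_nhdsGT hu] with s hs
  obtain ⟨s', h2, h3⟩ := ((T.left (t + (s : UnitAddCircle))).and
    (eventually_nhdsGT_pos_lt s hs.1)).exists
  have h4 : T.φ (t + ((s - s' : ℝ) : UnitAddCircle)) = lobeShift T.size (T.φ t) (s - s') :=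
    h1 (a := s - s') ⟨by linarith, by linarith [hs.2]⟩
  rw [AddCircle.coe_sub, ← add_sub_assoc, h2, sub_eq_add_neg, ← lobeShift_lobeShift] at h4
  exact lobeShift_injective _ _ h4

lemma ψ_left (t : UnitAddCircle) :
    ∀ᶠ s : ℝ in 𝓝[>] 0, T.ψ (t - (s : UnitAddCircle)) = lobeShift T.size (T.ψ t) (-s) := by
  obtain ⟨u, hu, h1⟩ := mem_nhdsGT_iff_exists_Ioo_subset.1 (T.left t)
  filter_upwards [Ioo_mem_nhdsGT hu] with s hs
  obtain ⟨s', h2, h3⟩ := ((T.left (t - (s : UnitAddCircle))).and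
    (eventually_nhdsGT_pos_lt (u - s) (by linarith [hs.2]))).exists
  have h4 : T.φ (t - ((s + s' : ℝ) : UnitAddCircle)) = lobeShift T.size (T.ψ t) (-(s + s')) :=
    h1 (a := s + s') ⟨by linarith [hs.1], by linarith [hs.2]⟩
  rw [AddCircle.coe_add, ← sub_sub, h2, neg_add, ← lobeShift_lobeShift] at h4
  exact lobeShift_injective _ _ h4

/-- The open part of the circle that is mapped to the `k`-th lobe. -/
def region (k : Fin n) : Set UnitAddCircle := {t | (T.φ t).1 = k ∧ (T.ψ t).1 = k}

lemma isOpen_region (k : Fin n) : IsOpen (T.region k) := by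
  rw [isOpen_iff_mem_nhds]
  intro t ht
  refine eventually_nhds_circle (P := fun x => x ∈ T.region k) ht ?_ ?_
  · filter_upwards [T.right t, T.ψ_right t] with s h1 h2
    exact ⟨by rw [h1]; exact ht.1, by rw [h2]; exact ht.1⟩
  · filter_upwards [T.left t, T.ψ_left t] with s h1 h2
    exact ⟨by rw [h1]; exact ht.2, by rw [h2]; exact ht.2⟩

lemma eventually_right_mem (t : UnitAddCircle) :
    ∀ᶠ s : ℝ in 𝓝[>] 0, t + (s : UnitAddCircle) ∈ T.region (T.φ t).1 := by
  filter_upwards [T.right t, T.ψ_right t] with s h1 h2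
  exact ⟨by rw [h1]; rfl, by rw [h2]; rfl⟩

lemma eventually_left_mem (t : UnitAddCircle) :
    ∀ᶠ s : ℝ in 𝓝[>] 0, t - (s : UnitAddCircle) ∈ T.region (T.ψ t).1 := by
  filter_upwards [T.left t, T.ψ_left t] with s h1 h2
  exact ⟨by rw [h1]; rfl, by rw [h2]; rfl⟩

lemma eventually_right_not_mem {t : UnitAddCircle} {k : Fin n} (h : (T.φ t).1 ≠ k) :
    ∀ᶠ s : ℝ in 𝓝[>] 0, t + (s : UnitAddCircle) ∉ T.region k := by
  filter_upwards [T.eventually_right_mem t] with s h1 h2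
  exact h (h1.1.symm.trans h2.1)

lemma eventually_left_not_mem {t : UnitAddCircle} {k : Fin n} (h : (T.ψ t).1 ≠ k) :
    ∀ᶠ s : ℝ in 𝓝[>] 0, t - (s : UnitAddCircle) ∉ T.region k := by
  filter_upwards [T.eventually_left_mem t] with s h1 h2
  exact h (h1.1.symm.trans h2.1)

lemma f_right (i : Fin n) (t : UnitAddCircle) : ∀ᶠ s : ℝ in 𝓝[>] 0,
    T.f i (t + (s : UnitAddCircle)) =
      T.f i t + if (T.φ t).1 = i then ((s / T.size i : ℝ) : UnitAddCircle) else 0 := by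
  filter_upwards [T.right t] with s h
  rw [f, f, h]
  split_ifs with hi
  · subst hi; rw [lobeShift, T.ρ_self, ← f, T.f_φ]
  · rw [add_zero]; exact T.ρ_const _ _ _ _ hi

lemma f_left (i : Fin n) (t : UnitAddCircle) : ∀ᶠ s : ℝ in 𝓝[>] 0,
    T.f i (t - (s : UnitAddCircle)) =
      T.f i t - if (T.ψ t).1 = i then ((s / T.size i : ℝ) : UnitAddCircle) else 0 := by
  filter_upwards [T.left t] with s h
  rw [f_eq_ψ _ _ t, f, h]
  split_ifs with hi
  · subst hi
    rw [lobeShift, T.ρ_self, ← f_eq_ψ, T.f_ψ, neg_div, AddCircle.coe_neg, sub_eq_add_neg]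
  · rw [sub_zero]; exact T.ρ_const _ _ _ _ hi

/-- Although `φ` jumps from one lobe to another, its retraction does not: by `ρ_glue` the value at
`t` agrees with the value at the left limit. -/
lemma continuous_f (i : Fin n) : Continuous (T.f i) := by
  rw [continuous_iff_continuousAt]
  intro t
  rw [ContinuousAt, tendsto_def]
  intro U hU
  have hc : Tendsto (fun s : ℝ => ((s / T.size i : ℝ) : UnitAddCircle)) (𝓝[>] 0) (𝓝 0) := by
    have : Continuous fun s : ℝ => ((s / T.size i : ℝ) : UnitAddCircle) :=
      (AddCircle.continuous_mk' 1).comp (continuous_id.div_const _)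
    simpa using (this.tendsto 0).mono_left nhdsWithin_le_nhds
  have hc0 : ∀ p : Prop, [Decidable p] → Tendsto (fun s : ℝ => if p then
      ((s / T.size i : ℝ) : UnitAddCircle) else 0) (𝓝[>] 0) (𝓝 0) := fun p _ => by
    split_ifs
    · exact hc
    · exact tendsto_const_nhds
  refine eventually_nhds_circle (P := fun x => T.f i x ∈ U) (mem_of_mem_nhds hU) ?_ ?_
  · have h2 : Tendsto (fun s : ℝ => T.f i t + if (T.φ t).1 = i then
      ((s / T.size i : ℝ) : UnitAddCircle) else 0) (𝓝[>] 0) (𝓝 (T.f i t)) := by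
      simpa using tendsto_const_nhds.add (hc0 _)
    filter_upwards [T.f_right i t, h2 hU] with s h1 h2
    rw [h1]; exact h2
  · have h2 : Tendsto (fun s : ℝ => T.f i t - if (T.ψ t).1 = i then
      ((s / T.size i : ℝ) : UnitAddCircle) else 0) (𝓝[>] 0) (𝓝 (T.f i t)) := by
      simpa using tendsto_const_nhds.sub (hc0 _)
    filter_upwards [T.f_left i t, h2 hU] with s h1 h2
    rw [h1]; exact h2

lemma volume_region_pos (k : Fin n) : 0 < volume.real (T.region k) := by
  obtain ⟨t, rfl⟩ := T.visit k
  obtain ⟨s, hs⟩ := (T.eventually_right_mem t).exists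
  have := (T.isOpen_region _).measure_pos volume ⟨_, hs⟩
  exact ENNReal.toReal_pos this.ne' (measure_ne_top _ _)

lemma volume_region_ne (k : Fin n) : volume.real (T.region k) ≠ 0 := (T.volume_region_pos k).ne'

/-- The pinching map moves with speed `1 / size k` along the `k`-th region and rests elsewhere, so
its increment is the length of that region travelled. This is proved by induction along the arc. -/
lemma f_eq_add_arcVol (k : Fin n) {p q : UnitAddCircle} : T.f k q = T.f k p +
    ((arcVol (T.region k) p q / T.size k : ℝ) : UnitAddCircle) := by
  -- The hypothesis `u < 1` stops the induction before `p + u` returns to `p`, where the arc from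
  -- `p` becomes empty and lengths cease to be additive.
  have := real_induction (P := fun u => u < 1 → T.f k (p + (u : UnitAddCircle)) = T.f k p +
    ((arcVol (T.region k) p (p + (u : UnitAddCircle)) / T.size k : ℝ) : UnitAddCircle))
    (by simp) ?_ ?_ (ccw (q - p)) (ccw_nonneg _) (ccw_lt_one _).le (ccw_lt_one _)
  · simpa using this
  · intro u h0 h1 hu
    have hv : ∀ᶠ s : ℝ in 𝓝[>] 0, arcVol (T.region k) (p + (u : UnitAddCircle))
        (p + (u : UnitAddCircle) + (s : UnitAddCircle)) =
        if (T.φ (p + (u : UnitAddCircle))).1 = k then s else 0 := by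
      split_ifs with hk
      · exact eventually_arcVol_add_eq (by rw [← hk]; exact T.eventually_right_mem _)
      · exact eventually_arcVol_add_eq_zero (T.eventually_right_not_mem hk)
    filter_upwards [T.f_right k (p + (u : UnitAddCircle)), hv, eventually_nhdsGT_pos_lt 1 one_pos]
      with s h2 h3 hs h4
    have h5 : arcVol (T.region k) p (p + ((u + s : ℝ) : UnitAddCircle)) =
        arcVol (T.region k) p (p + (u : UnitAddCircle)) + arcVol (T.region k)
          (p + (u : UnitAddCircle)) (p + (u : UnitAddCircle) + (s : UnitAddCircle)) := by
      rcases h0.eq_or_lt with h | h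
      · subst h; simp
      · rw [arcVol_add (add_small_mem_cIoo h (by linarith [hs.1]) h4), AddCircle.coe_add,
          add_assoc]
    rw [h5, AddCircle.coe_add, ← add_assoc, h2, hu h1, h3, add_div, AddCircle.coe_add, add_assoc]
    split_ifs <;> simp
  · intro u h0 h1 hu h2
    have hv : ∀ᶠ s : ℝ in 𝓝[>] 0, arcVol (T.region k)
        (p + (u : UnitAddCircle) - (s : UnitAddCircle)) (p + (u : UnitAddCircle)) =
        if (T.ψ (p + (u : UnitAddCircle))).1 = k then s else 0 := by
      split_ifs with hk
      · exact eventually_arcVol_sub_eq (by rw [← hk]; exact T.eventually_left_mem _)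
      · exact eventually_arcVol_sub_eq_zero (T.eventually_left_not_mem hk)
    obtain ⟨s, h3, h4, h5, hs⟩ := ((T.f_left k (p + (u : UnitAddCircle))).and (hv.and
      (hu.and (eventually_nhdsGT_pos_lt u h0)))).exists
    have h6 := h5 (by linarith)
    have h7 : arcVol (T.region k) p (p + (u : UnitAddCircle)) =
        arcVol (T.region k) p (p + ((u - s : ℝ) : UnitAddCircle)) + arcVol (T.region k)
          (p + (u : UnitAddCircle) - (s : UnitAddCircle)) (p + (u : UnitAddCircle)) := by
      rw [arcVol_add (add_small_mem_cIoo (s := u - s) (by linarith) (by linarith) h2),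
        AddCircle.coe_sub, add_sub_assoc]
    rw [AddCircle.coe_sub, ← add_sub_assoc] at h6 h7
    rw [h7, h4, add_div, AddCircle.coe_add, ← add_assoc, ← h6, h3]
    split_ifs <;> simp

/-- A full turn brings the pinching map back to its value, so the length of the region is an
integral multiple of the size, positive since the region is nonempty and open. Hence every length is
at least the size. The lengths add up to at most `1`, the sum of the sizes, so all inequalities are
equalities and the degree is `1`. -/
lemma volume_region (k : Fin n) : volume.real (T.region k) = T.size k := by
  have hint : ∀ k, ∃ m : ℤ, (m : ℝ) = volume.real (T.region k) / T.size k := fun k => by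
    rw [← coe_eq_zero_iff_int]
    obtain ⟨s, hs⟩ := (eventually_nhdsGT_pos_lt 1 one_pos).exists
    have hne := sub_coe_ne (p := 0) hs.1 hs.2
    rw [← arcVol_compl hne, add_div, AddCircle.coe_add]
    have h1 := T.f_eq_add_arcVol k (p := 0 - (s : UnitAddCircle)) (q := 0)
    have h2 := T.f_eq_add_arcVol k (p := 0) (q := 0 - (s : UnitAddCircle))
    rw [h1, add_assoc] at h2
    exact left_eq_add.1 h2
  choose m hm using hint
  have hm' : ∀ k, volume.real (T.region k) = m k * T.size k := fun k => by
    rw [hm, div_mul_cancel₀ _ (T.size_pos k).ne']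
  have hm1 : ∀ k, (1 : ℝ) ≤ m k := fun k => by
    have : (0 : ℝ) < m k := by rw [hm]; exact div_pos (T.volume_region_pos k) (T.size_pos k)
    have : 0 < m k := by exact_mod_cast this
    exact_mod_cast this
  have hsum : ∑ k, volume.real (T.region k) ≤ 1 := by
    rw [← measureReal_biUnion_finset]
    · exact (measureReal_mono (Set.subset_univ _)).trans volume_real_univ_circle.le
    · intro i _ j _ hij
      exact Set.disjoint_left.2 fun x h1 h2 => hij (h1.1.symm.trans h2.1)
    · exact fun i _ => (T.isOpen_region i).measurableSet
  have hle : ∀ k, T.size k ≤ volume.real (T.region k) := fun k => by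
    rw [hm']; nlinarith [hm1 k, T.size_pos k]
  have heq : ∑ k, T.size k = ∑ k, volume.real (T.region k) :=
    le_antisymm (Finset.sum_le_sum fun k _ => hle k) (hsum.trans T.sum_size.ge)
  exact ((Finset.sum_eq_sum_iff_of_le fun k _ => hle k).1 heq k (Finset.mem_univ k)).symm

lemma f_sub_f (k : Fin n) (p q : UnitAddCircle) : T.f k q - T.f k p = pinch (T.region k) p q := by
  rw [T.f_eq_add_arcVol k (p := p) (q := q), pinch, volume_region, add_sub_cancel_left]

lemma f_eq_iff {k : Fin n} {p q : UnitAddCircle} (hpq : p ≠ q) : T.f k p = T.f k q ↔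
    arcVol (T.region k) p q = 0 ∨ arcVol (T.region k) q p = 0 := by
  rw [← pinch_eq_zero_iff_of_ne (T.volume_region_ne k) hpq, ← f_sub_f, sub_eq_zero, eq_comm]

/-- Equal values at `p ≠ q` force one of the two arcs between them to contain no length of the
common region, but each of `p` and `q` is followed by an interval of it. -/
lemma φ_injective : Function.Injective T.φ := fun p q h => by
  by_contra hpq
  have h1 : T.f (T.φ p).1 p = T.f (T.φ p).1 q := by rw [f, f, h]
  rw [T.f_eq_iff hpq] at h1
  have h2 := arcVol_pos_of_right hpq (T.eventually_right_mem p)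
  have h3 := arcVol_pos_of_right (Ne.symm hpq) (T.eventually_right_mem q)
  rw [← h] at h3
  rcases h1 with h1 | h1 <;> linarith

lemma ψ_injective : Function.Injective T.ψ := fun p q h => by
  by_contra hpq
  have h1 : T.f (T.ψ p).1 p = T.f (T.ψ p).1 q := by rw [f_eq_ψ, f_eq_ψ, h]
  rw [T.f_eq_iff hpq] at h1
  have h2 := arcVol_pos_of_left (Ne.symm hpq) (T.eventually_left_mem p)
  have h3 := arcVol_pos_of_left hpq (T.eventually_left_mem q)
  rw [← h] at h3
  rcases h1 with h1 | h1 <;> linarith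

lemma exists_ne_f (k : Fin n) (t : UnitAddCircle) : ∃ t', T.f k t' ≠ T.f k t := by
  obtain ⟨p, rfl⟩ := T.visit k
  by_contra! h
  obtain ⟨s, h1, h2⟩ := ((T.right p).and (eventually_nhdsGT_pos_lt 1 one_pos)).exists
  obtain ⟨s, h1, h2⟩ := ((T.f_right _ p).and
    (eventually_nhdsGT_pos_lt _ (T.size_pos (T.φ p).1))).exists
  rw [h, h p, if_pos rfl, left_eq_add] at h1
  have h3 := ccw_coe (u := s / T.size (T.φ p).1) (div_pos h2.1 (T.size_pos _)).le
    ((div_lt_one (T.size_pos _)).2 h2.2)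
  rw [h1, ccw_zero] at h3
  linarith [div_pos h2.1 (T.size_pos (T.φ p).1)]

/-- The last time at which a value of the pinching map is taken. -/
lemma exists_φ_of_f_eq (k : Fin n) (t : UnitAddCircle) :
    ∃ t', T.f k t' = T.f k t ∧ (T.φ t').1 = k := by
  by_contra! h
  obtain ⟨t₁, ht₁⟩ := T.exists_ne_f k t
  refine ht₁ (circle_induction (P := fun x => T.f k x = T.f k t) t rfl (fun x hx => ?_)
    (fun x hx => ?_) t₁)
  · filter_upwards [T.f_right k x] with s hs
    rw [hs, if_neg (h x hx), add_zero, hx]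
  · exact ((isClosed_singleton (x := T.f k t)).preimage (T.continuous_f k)).mem_of_tendsto
      (tendsto_sub_coe x) hx

lemma exists_ψ_of_f_eq (k : Fin n) (t : UnitAddCircle) :
    ∃ t', T.f k t' = T.f k t ∧ (T.ψ t').1 = k := by
  by_contra! h
  obtain ⟨t₁, ht₁⟩ := T.exists_ne_f k t
  refine ht₁ (circle_induction_neg (P := fun x => T.f k x = T.f k t) t rfl (fun x hx => ?_)
    (fun x hx => ?_) t₁)
  · filter_upwards [T.f_left k x] with s hs
    rw [hs, if_neg (h x hx), sub_zero, hx]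
  · exact ((isClosed_singleton (x := T.f k t)).preimage (T.continuous_f k)).mem_of_tendsto
      (tendsto_add_coe x) hx

lemma eventually_mul {P : ℝ → Prop} {r : ℝ} (hr : 0 < r) (h : ∀ᶠ s : ℝ in 𝓝[>] 0, P s) :
    ∀ᶠ s : ℝ in 𝓝[>] 0, P (r * s) := by
  obtain ⟨u, hu, h1⟩ := mem_nhdsGT_iff_exists_Ioo_subset.1 h
  simp only [Set.mem_Ioi] at hu
  filter_upwards [Ioo_mem_nhdsGT (div_pos hu hr)] with s hs
  exact h1 (a := r * s) ⟨mul_pos hr hs.1, by rw [mul_comm]; exact (lt_div_iff₀ hr).1 hs.2⟩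

/-- The range is closed by compactness. It also extends to the right of each of its points, because
the value is taken at some time from which the trace moves on along the `k`-th lobe. -/
lemma f_surjective (k : Fin n) : Function.Surjective (T.f k) := fun x => by
  refine circle_induction (P := fun x => ∃ t, T.f k t = x) (T.f k 0) ⟨0, rfl⟩ ?_ ?_ x
  · rintro _ ⟨t, rfl⟩
    obtain ⟨t', h1, h2⟩ := T.exists_φ_of_f_eq k t
    filter_upwards [eventually_mul (T.size_pos k) (T.f_right k t')] with s hs
    refine ⟨_, hs.trans ?_⟩
    rw [if_pos h2, h1, mul_div_cancel_left₀ _ (T.size_pos k).ne']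
  · intro t ht
    exact (isCompact_range (T.continuous_f k)).isClosed.mem_of_tendsto (tendsto_sub_coe t) ht

lemma φ_surjective : Function.Surjective T.φ := fun ⟨k, x⟩ => by
  obtain ⟨t, rfl⟩ := T.f_surjective k x
  obtain ⟨t', h1, rfl⟩ := T.exists_φ_of_f_eq k t
  exact ⟨t', by rw [← h1, ← φ_eq]⟩

lemma ψ_surjective : Function.Surjective T.ψ := fun ⟨k, x⟩ => by
  obtain ⟨t, rfl⟩ := T.f_surjective k x
  obtain ⟨t', h1, rfl⟩ := T.exists_ψ_of_f_eq k t
  exact ⟨t', by rw [← h1, ← ψ_eq]⟩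

/-- The boundary trace as a bijection. -/
def φEquiv : UnitAddCircle ≃ LobePoint n := Equiv.ofBijective T.φ ⟨T.φ_injective, T.φ_surjective⟩

/-- The left limits of the boundary trace as a bijection. -/
def ψEquiv : UnitAddCircle ≃ LobePoint n := Equiv.ofBijective T.ψ ⟨T.ψ_injective, T.ψ_surjective⟩

/-- The permutation describing the intersection points. -/
def next : Equiv.Perm (LobePoint n) := T.ψEquiv.symm.trans T.φEquiv

@[simp] lemma next_ψ (t : UnitAddCircle) : T.next (T.ψ t) = T.φ t := by
  change T.φEquiv (T.ψEquiv.symm (T.ψEquiv t)) = _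
  rw [Equiv.symm_apply_apply]; rfl

@[simp] lemma next_symm_φ (t : UnitAddCircle) : T.next.symm (T.φ t) = T.ψ t := by
  rw [Equiv.symm_apply_eq, next_ψ]

lemma ρ_next (i : Fin n) (x : LobePoint n) : T.ρ i (T.next x) = T.ρ i x := by
  obtain ⟨t, rfl⟩ := T.ψ_surjective x
  rw [next_ψ, T.ρ_glue]

/-- Near every time the only possible jump is at that time itself; compactness of the circle then
leaves finitely many jumps. -/
lemma finite_jumps : {t | T.φ t ≠ T.ψ t}.Finite := by
  have hcl : ∀ t, ∀ᶠ x in 𝓝 t, x = t ∨ T.φ x = T.ψ x := fun t => by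
    refine eventually_nhds_circle (Or.inl rfl) ?_ ?_
    · filter_upwards [T.right t, T.ψ_right t] with s h1 h2
      exact Or.inr (h1.trans h2.symm)
    · filter_upwards [T.left t, T.ψ_left t] with s h1 h2
      exact Or.inr (h1.trans h2.symm)
  obtain ⟨S, -, hS⟩ := isCompact_univ.elim_nhds_subcover
    (fun t : UnitAddCircle => {x | x = t ∨ T.φ x = T.ψ x}) (fun t _ => hcl t)
  refine S.finite_toSet.subset fun x hx => ?_
  obtain ⟨t, ht, h⟩ := Set.mem_iUnion₂.1 (hS (Set.mem_univ x))
  rcases h with rfl | h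
  · exact ht
  · exact absurd h hx

lemma dualGraph_isTree : (dualGraph T.next).IsTree := by
  constructor
  · have hφ : ∀ t, (dualGraph T.next).Reachable (Sum.inl (T.φ 0).1) (Sum.inl (T.φ t).1) :=
      circle_induction 0 (SimpleGraph.Reachable.refl _)
        (fun t ht => by
          filter_upwards [T.right t] with s hs
          rw [hs]; exact ht)
        -- When the trace changes lobes at `t`, the old and the new lobe meet in the intersection
        -- point through `ψ t`, which gives a path of two edges.
        (fun t ht => by
          obtain ⟨s, h1, h2⟩ := ((T.left t).and ht).exists
          rw [h1, lobeShift_fst] at h2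
          by_cases h : T.φ t = T.ψ t
          · rw [h]; exact h2
          · have hne : T.next (T.ψ t) ≠ T.ψ t := by rwa [next_ψ]
            have a1 : (dualGraph T.next).Adj (Sum.inl (T.ψ t).1)
              (Sum.inr (intersectionPointOf _ hne)) :=
              dualGraph_adj_inl_inr.2 ⟨_, mem_intersectionPointOf _ hne⟩
            have a2 : (dualGraph T.next).Adj (Sum.inr (intersectionPointOf _ hne))
              (Sum.inl (T.φ t).1) := dualGraph_adj_inr_inl.2 ⟨(T.φ t).2, by
                have := next_mem_intersectionPointOf _ hne
                rwa [next_ψ] at this⟩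
            exact h2.trans (a1.reachable.trans a2.reachable))
    have hall : ∀ v, (dualGraph T.next).Reachable (Sum.inl (T.φ 0).1) v := by
      rintro (i | P)
      · obtain ⟨t, rfl⟩ := T.visit i
        exact hφ t
      · obtain ⟨⟨i, x⟩, hx⟩ := P.exists_mem
        obtain ⟨t, rfl⟩ := T.visit i
        exact (hφ t).trans (dualGraph_adj_inl_inr.2 ⟨x, hx⟩ : (dualGraph T.next).Adj _ _).reachable
    exact
      { preconnected := fun u v => (hall u).symm.trans (hall v)
        nonempty := ⟨Sum.inl (T.φ 0).1⟩ }
  · exact dualGraph_isAcyclic T.ρ T.ρ_self T.ρ_const T.ρ_next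

/-- The cactus with a given boundary trace. -/
def toCactus : Cactus n where
  size := T.size
  next := T.next
  base := T.φ 0
  size_pos := T.size_pos
  sum_size := T.sum_size
  finite_points := by
    refine (T.finite_jumps.image T.ψ).subset fun x hx => ?_
    obtain ⟨t, rfl⟩ := T.ψ_surjective x
    exact ⟨t, by simpa using hx, rfl⟩
  eq_of_sameCycle := fun i t t' h => by
    have := eq_of_sameCycle_of_next (T.ρ_next i) h
    rwa [T.ρ_self, T.ρ_self] at this
  isTree := T.dualGraph_isTree

lemma isTrace : T.toCactus.IsTrace T.φ := by
  refine ⟨rfl, fun t => ⟨T.right t, ?_⟩⟩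
  filter_upwards [T.left t] with s hs
  change _ = ((T.next.symm (T.φ t)).1, (T.next.symm (T.φ t)).2 -
        ((s / T.size (T.next.symm (T.φ t)).1 : ℝ) : UnitAddCircle))
  rw [hs, next_symm_φ, lobeShift, neg_div, AddCircle.coe_neg, sub_eq_add_neg]

lemma eq_of_isTrace {φ : UnitAddCircle → LobePoint n} (h : T.toCactus.IsTrace φ) : φ = T.φ := by
  funext t
  refine circle_induction (P := fun t => φ t = T.φ t) 0 h.1 (fun t ht => ?_) (fun t ht => ?_) t
  · filter_upwards [(h.2 t).1, T.right t] with s h1 h2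
    rw [h1, h2, ht]; rfl
  · obtain ⟨s, h1, h2, h3⟩ := (ht.and ((h.2 t).2.and (T.isTrace.2 t).2)).exists
    rw [h2, h3] at h1
    have h4 : (T.toCactus.next.symm (φ t)).1 = (T.toCactus.next.symm (T.φ t)).1 :=
      (Prod.mk.inj h1).1
    have h5 := congrArg Prod.snd h1
    simp only [h4, sub_left_inj] at h5
    exact T.toCactus.next.symm.injective (Prod.ext h4 h5)

/-- The pinching map, with values in the lobes. -/
def pinchMap (i : Fin n) : C(UnitAddCircle, UnitAddCircle) := ⟨T.f i, T.continuous_f i⟩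

lemma isPinchingMap : T.toCactus.IsPinchingMap T.pinchMap := by
  refine ⟨T.φ, T.isTrace, fun i t => ⟨?_, fun h => ?_⟩⟩
  · rintro rfl; exact T.f_φ t
  · filter_upwards [T.f_right i t] with s hs
    rw [if_neg h, add_zero] at hs
    exact hs

/-- This shows that the choice made by `epsilon` is harmless: the trace is unique, and a continuous
map that follows it on the `i`-th lobe and is locally constant to the right elsewhere is determined
by circle induction. -/
lemma pinchingMap_toCactus : T.toCactus.pinchingMap = T.pinchMap := by
  have h : T.toCactus.IsPinchingMap T.toCactus.pinchingMap :=
    Classical.epsilon_spec ⟨_, T.isPinchingMap⟩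
  obtain ⟨φ, h1, h2⟩ := h
  rw [T.eq_of_isTrace h1] at h2
  funext i
  ext t
  obtain ⟨t₀, ht₀⟩ := T.visit i
  refine circle_induction (P := fun t => T.toCactus.pinchingMap i t = T.pinchMap i t) t₀ ?_
    (fun t ht => ?_) (fun t ht => ?_) t
  · rw [(h2 i t₀).1 ht₀, ← T.f_φ, ht₀]; rfl
  · by_cases h : (T.φ t).1 = i
    · filter_upwards [T.right t] with s hs
      have h3 : (T.φ (t + (s : UnitAddCircle))).1 = i := by rw [hs]; exact h
      rw [(h2 i _).1 h3, ← T.f_φ, h3]; rfl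
    · filter_upwards [(h2 i t).2 h, T.f_right i t] with s h3 h4
      rw [if_neg h, add_zero] at h4
      rw [h3, ht]; exact h4.symm
  · exact (isClosed_eq (T.toCactus.pinchingMap i).continuous
      (T.pinchMap i).continuous).mem_of_tendsto (tendsto_sub_coe t) ht

@[simp] lemma pinchingMap_apply (i : Fin n) (t : UnitAddCircle) :
    T.toCactus.pinchingMap i t = T.f i t := by rw [pinchingMap_toCactus]; rfl

/-- Cacti are determined by the lobes visited by the trace and one value of each pinching map. -/
lemma toCactus_eq {T T' : BoundaryTrace n} (h : ∀ t, (T.φ t).1 = (T'.φ t).1)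
    (h' : ∀ i, ∃ t, T.f i t = T'.f i t) : T.toCactus = T'.toCactus := by
  have hψ : ∀ t, (T.ψ t).1 = (T'.ψ t).1 := fun t => by
    obtain ⟨s, h1, h2⟩ := ((T.left t).and (T'.left t)).exists
    have := h (t - (s : UnitAddCircle))
    rwa [h1, h2] at this
  have hreg : ∀ k, T.region k = T'.region k := fun k => by
    ext t; change _ ∧ _ ↔ _ ∧ _
    rw [h, hψ]
  have hf : ∀ i t, T.f i t = T'.f i t := fun i t => by
    obtain ⟨t₀, h0⟩ := h' i
    have h1 := T.f_sub_f i t₀ t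
    rw [hreg, ← T'.f_sub_f, h0] at h1
    exact sub_left_injective h1
  have eφ : ∀ t, T.φ t = T'.φ t := fun t => by rw [φ_eq, φ_eq T', h, hf]
  have eψ : ∀ t, T.ψ t = T'.ψ t := fun t => by rw [ψ_eq, ψ_eq T', hψ, hf]
  apply Cactus.ext
  · funext i
    change T.size i = T'.size i
    rw [← volume_region, hreg, volume_region]
  · change T.next = T'.next
    ext1 x
    obtain ⟨t, rfl⟩ := T.ψ_surjective x
    rw [next_ψ, eψ, next_ψ, eφ]
  · exact eφ 0

end BoundaryTrace

end

noncomputable section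


/-! # Every cactus has a boundary trace -/

namespace Cactus

variable {n : ℕ} (a : Cactus n)

/-- The dual graph without the edges at the `i`-th lobe. -/
def graphAvoiding (i : Fin n) : SimpleGraph (Fin n ⊕ IntersectionPoint a.next) where
  Adj v w := (dualGraph a.next).Adj v w ∧ v ≠ Sum.inl i ∧ w ≠ Sum.inl i
  symm := ⟨fun _ _ h => ⟨h.1.symm, h.2.2, h.2.1⟩⟩
  loopless := ⟨fun v h => (dualGraph a.next).loopless.irrefl v h.1⟩

/-- Along a walk from the `i`-th lobe to `v`, the vertex following the last visit of this lobe is an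
intersection point on it, and the rest of the walk avoids the lobe. -/
lemma exists_root (i : Fin n) (v : Fin n ⊕ IntersectionPoint a.next) (hv : v ≠ Sum.inl i) :
    ∃ P t, (i, t) ∈ P.1 ∧ (a.graphAvoiding i).Reachable v (Sum.inr P) := by
  have h := (a.isTree.connected.preconnected (Sum.inl i) v).induct
    (Q := fun v => v = Sum.inl i ∨
      ∃ P t, (i, t) ∈ P.1 ∧ (a.graphAvoiding i).Reachable v (Sum.inr P)) (Or.inl rfl)
    (fun v w hvw hv => by
      by_cases hw : w = Sum.inl i
      · exact Or.inl hw
      right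
      by_cases hvi : v = Sum.inl i
      · subst hvi
        rcases w with j | P
        · exact absurd hvw not_dualGraph_adj_inl_inl
        · obtain ⟨t, ht⟩ := dualGraph_adj_inl_inr.1 hvw
          exact ⟨P, t, ht, SimpleGraph.Reachable.refl _⟩
      · obtain ⟨P, t, ht, hr⟩ := hv.resolve_left hvi
        have hadj : (a.graphAvoiding i).Adj w v := ⟨hvw.symm, hw, hvi⟩
        exact ⟨P, t, ht, hadj.reachable.trans hr⟩)
  exact h.resolve_left hv

/-- Two different points at which the lobe meets the same branch would give a path from the lobe to
`P'` avoiding the edge between them, which is a bridge in a tree. -/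
lemma root_unique (i : Fin n) {P P' : IntersectionPoint a.next} {t t' : UnitAddCircle}
    (h : (i, t) ∈ P.1) (h' : (i, t') ∈ P'.1)
    (hr : (a.graphAvoiding i).Reachable (Sum.inr P) (Sum.inr P')) : P = P' := by
  by_contra hne
  have hb := SimpleGraph.isAcyclic_iff_forall_adj_isBridge.1 a.isTree.isAcyclic
    (dualGraph_adj_inl_inr.2 ⟨t', h'⟩ : (dualGraph a.next).Adj (Sum.inl i) (Sum.inr P'))
  rw [SimpleGraph.isBridge_iff] at hb
  apply hb
  have h1 : ((dualGraph a.next).deleteEdges {s(Sum.inl i, Sum.inr P')}).Adj (Sum.inl i)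
      (Sum.inr P) := by
    rw [SimpleGraph.deleteEdges_adj]
    refine ⟨dualGraph_adj_inl_inr.2 ⟨t, h⟩, fun h2 => hne ?_⟩
    simpa using h2
  refine h1.reachable.trans (hr.mono fun v w hvw => ?_)
  rw [SimpleGraph.deleteEdges_adj]
  refine ⟨hvw.1, fun h2 => ?_⟩
  rw [Set.mem_singleton_iff, Sym2.eq_iff] at h2
  rcases h2 with h2 | h2
  · exact hvw.2.1 h2.1
  · exact hvw.2.2 h2.2

/-- The retractions of a cactus onto its lobes. -/
lemma exists_retraction : ∃ ρ : Fin n → LobePoint n → UnitAddCircle, (∀ i s, ρ i (i, s) = s) ∧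
    (∀ i j s s', j ≠ i → ρ i (j, s) = ρ i (j, s')) ∧ ∀ i x, ρ i (a.next x) = ρ i x := by
  classical
  have h : ∀ i j : Fin n, ∃ (t : UnitAddCircle), j ≠ i →
      ∃ P, (i, t) ∈ P.1 ∧ (a.graphAvoiding i).Reachable (Sum.inl j) (Sum.inr P) := fun i j => by
    by_cases hji : j = i
    · exact ⟨0, fun h => absurd hji h⟩
    · obtain ⟨P, t, h1, h2⟩ := a.exists_root i (Sum.inl j) (by simpa using hji)
      exact ⟨t, fun _ => ⟨P, h1, h2⟩⟩
  choose t ht using h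
  have huniq : ∀ (i j : Fin n) (P : IntersectionPoint a.next) (s : UnitAddCircle), j ≠ i →
      (i, s) ∈ P.1 → (a.graphAvoiding i).Reachable (Sum.inl j) (Sum.inr P) → t i j = s := by
    intro i j P s hji hs hr
    obtain ⟨P', h1, h2⟩ := ht i j hji
    have := a.root_unique i h1 hs (h2.symm.trans hr)
    subst this
    exact a.eq_of_sameCycle i _ _ (IntersectionPoint.sameCycle h1 hs)
  refine ⟨fun i x => if x.1 = i then x.2 else t i x.1, fun i s => by simp, fun i j s s' h => by
    simp [h], fun i x => ?_⟩
  by_cases hx : a.next x = x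
  · rw [hx]
  have hP1 := mem_intersectionPointOf x hx
  have hP2 := next_mem_intersectionPointOf x hx
  set P := intersectionPointOf x hx
  -- A nontrivial step of `next` changes the lobe, since an intersection point meets each circle
  -- only once.
  have hne : (a.next x).1 ≠ x.1 := fun h => by
    have h1 : a.next.SameCycle (x.1, (a.next x).2) (x.1, x.2) := by
      have e : (x.1, (a.next x).2) = a.next x := Prod.ext h.symm rfl
      rw [e]
      exact IntersectionPoint.sameCycle hP2 hP1
    exact hx (Prod.ext h (a.eq_of_sameCycle _ _ _ h1))
  have hadj : ∀ y ∈ P.1, y.1 ≠ i → (a.graphAvoiding i).Adj (Sum.inl y.1) (Sum.inr P) :=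
    fun y hy hyi => ⟨dualGraph_adj_inl_inr.2 ⟨y.2, hy⟩, by simpa using hyi, by simp⟩
  simp only
  by_cases h1 : x.1 = i
  · subst h1
    rw [if_neg hne, if_pos rfl]
    exact huniq _ _ P _ hne hP1 (hadj _ hP2 hne).reachable
  · by_cases h2 : (a.next x).1 = i
    · subst h2
      rw [if_pos rfl, if_neg h1]
      exact (huniq _ _ P _ h1 hP2 (hadj _ hP1 h1).reachable).symm
    · rw [if_neg h1, if_neg h2]
      obtain ⟨P', h3, h4⟩ := ht i x.1 h1
      exact huniq _ _ P' _ h2 h3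
        ((hadj _ hP2 h2).reachable.trans ((hadj _ hP1 h1).symm.reachable.trans h4))

/-- The points of the lobes at which the trace is cut. -/
def cuts : Set (LobePoint n) := {x | a.next x ≠ x} ∪ {a.base} ∪ Set.range fun i => (i, 0)

lemma finite_cuts : a.cuts.Finite :=
  (a.finite_points.union (Set.finite_singleton _)).union (Set.finite_range _)

lemma next_mem_cuts {x : LobePoint n} (hx : x ∈ a.cuts) : a.next x ∈ a.cuts := by
  by_cases h : a.next x = x
  · rwa [h]
  · exact Or.inl (Or.inl fun h' => h (a.next.injective h'))

lemma coe_injOn_Ioc : Set.InjOn (fun d : ℝ => (d : UnitAddCircle)) (Set.Ioc 0 1) := by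
  intro d hd d' hd' h
  have h1 : ((d - d' : ℝ) : UnitAddCircle) = 0 := by
    rw [AddCircle.coe_sub]; exact sub_eq_zero.2 h
  obtain ⟨k, hk⟩ := coe_eq_zero_iff_int.1 h1
  have h2 : (-1 : ℝ) < k := by rw [hk]; linarith [hd.1, hd'.2]
  have h3 : (k : ℝ) < 1 := by rw [hk]; linarith [hd.2, hd'.1]
  have h4 : -1 < k := by exact_mod_cast h2
  have h5 : k < 1 := by exact_mod_cast h3
  have : k = 0 := by omega
  rw [this] at hk
  simp at hk
  linarith

/-- There are finitely many cuts, so a first one ahead exists as soon as there is one within a full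
turn. The marked point of the lobe is such a cut. The distance `1` is allowed, for a lobe with a
single cut. -/
lemma exists_hit (x : LobePoint n) : ∃ d : ℝ, 0 < d ∧ d ≤ 1 ∧
    (x.1, x.2 + (d : UnitAddCircle)) ∈ a.cuts ∧
    ∀ d' : ℝ, 0 < d' → d' < d → (x.1, x.2 + (d' : UnitAddCircle)) ∉ a.cuts := by
  set S : Set ℝ := {d | d ∈ Set.Ioc (0 : ℝ) 1 ∧ (x.1, x.2 + (d : UnitAddCircle)) ∈ a.cuts}
  have hfin : S.Finite := by
    refine Set.Finite.of_finite_image (f := fun d : ℝ => (x.1, x.2 + (d : UnitAddCircle)))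
      (a.finite_cuts.subset ?_) ?_
    · rintro _ ⟨d, hd, rfl⟩; exact hd.2
    · intro d hd d' hd' h
      exact coe_injOn_Ioc hd.1 hd'.1 (add_left_cancel (Prod.mk.inj h).2)
  have hne : S.Nonempty := by
    -- This is the distance from `x` to the marked point of its lobe.
    refine ⟨1 - ccw x.2, ⟨by linarith [ccw_lt_one x.2], by linarith [ccw_nonneg x.2]⟩, ?_⟩
    rw [AddCircle.coe_sub, coe_ccw, coe_one_eq_zero, zero_sub, add_neg_cancel]
    exact Or.inr ⟨x.1, rfl⟩
  obtain ⟨d, hd, hmin⟩ := Set.exists_min_image S id hfin hne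
  refine ⟨d, hd.1.1, hd.1.2, hd.2, fun d' h1 h2 h3 => ?_⟩
  have := hmin d' ⟨⟨h1, by linarith [hd.1.2]⟩, h3⟩
  simp only [id] at this
  linarith

/-- The distance, in the parameter of the lobe, to the next cut. -/
def gap (x : LobePoint n) : ℝ := (a.exists_hit x).choose

lemma gap_pos (x : LobePoint n) : 0 < a.gap x := (a.exists_hit x).choose_spec.1

lemma gap_le_one (x : LobePoint n) : a.gap x ≤ 1 := (a.exists_hit x).choose_spec.2.1

/-- The next cut on the same lobe. -/
def hit (x : LobePoint n) : LobePoint n := (x.1, x.2 + (a.gap x : UnitAddCircle))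

lemma hit_mem_cuts (x : LobePoint n) : a.hit x ∈ a.cuts := (a.exists_hit x).choose_spec.2.2.1

lemma not_mem_cuts_of_lt_gap (x : LobePoint n) {d : ℝ} (h0 : 0 < d) (h1 : d < a.gap x) :
    (x.1, x.2 + (d : UnitAddCircle)) ∉ a.cuts := (a.exists_hit x).choose_spec.2.2.2 d h0 h1

/-- The arcs between consecutive cuts are disjoint. -/
lemma cut_unique {x y : LobePoint n} (hx : x ∈ a.cuts) (hy : y ∈ a.cuts) (hxy : x.1 = y.1)
    {d e : ℝ} (hd : 0 < d) (hdx : d ≤ a.gap x) (he : 0 < e) (hey : e ≤ a.gap y)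
    (h : x.2 + (d : UnitAddCircle) = y.2 + (e : UnitAddCircle)) : x = y := by
  rcases lt_trichotomy d e with hde | hde | hde
  · exfalso
    refine a.not_mem_cuts_of_lt_gap y (d := e - d) (by linarith) (by linarith) ?_
    rw [AddCircle.coe_sub, ← add_sub_assoc, ← h, add_sub_cancel_right, ← hxy]
    exact hx
  · subst hde
    exact Prod.ext hxy (add_right_cancel h)
  · exfalso
    refine a.not_mem_cuts_of_lt_gap x (d := d - e) (by linarith) (by linarith) ?_
    rw [AddCircle.coe_sub, ← add_sub_assoc, h, add_sub_cancel_right, hxy]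
    exact hy

lemma volume_real_arc (p : UnitAddCircle) {u : ℝ} (h0 : 0 < u) (h1 : u ≤ 1) :
    MeasurableSet {w : UnitAddCircle | 0 < ccw (w - p) ∧ ccw (w - p) < u} ∧
    volume.real {w : UnitAddCircle | 0 < ccw (w - p) ∧ ccw (w - p) < u} = u := by
  rcases h1.lt_or_eq with h1 | rfl
  · have : {w : UnitAddCircle | 0 < ccw (w - p) ∧ ccw (w - p) < u} =
        Set.cIoo p (p + (u : UnitAddCircle)) := by
      ext w; rw [mem_cIoo_add h0.le h1]; rfl
    rw [this, volume_real_cIoo, add_sub_cancel_left, ccw_coe h0.le h1]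
    exact ⟨(isOpen_cIoo _ _).measurableSet, rfl⟩
  · have : {w : UnitAddCircle | 0 < ccw (w - p) ∧ ccw (w - p) < 1} = {p}ᶜ := by
      ext w
      change 0 < ccw (w - p) ∧ ccw (w - p) < 1 ↔ w ≠ p
      simp [ccw_lt_one, ccw_pos, sub_eq_zero]
    rw [this]
    refine ⟨(measurableSet_singleton p).compl, ?_⟩
    have h := measureReal_compl (μ := (volume : Measure UnitAddCircle)) (measurableSet_singleton p)
    rw [h, volume_real_univ_circle, Measure.real, volume_singleton_circle]
    simp

/-- The open arcs that begin at the different cuts and end at the next cut are disjoint parts of a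
circle of length `1`. -/
lemma sum_gap_le (i : Fin n) (S : Finset (LobePoint n)) (hS : ∀ x ∈ S, x ∈ a.cuts ∧ x.1 = i) :
    ∑ x ∈ S, a.gap x ≤ 1 := by
  have h : ∑ x ∈ S, a.gap x = volume.real
      (⋃ x ∈ S, {w : UnitAddCircle | 0 < ccw (w - x.2) ∧ ccw (w - x.2) < a.gap x}) := by
    rw [measureReal_biUnion_finset]
    · exact Finset.sum_congr rfl fun x _ =>
        (volume_real_arc x.2 (a.gap_pos x) (a.gap_le_one x)).2.symm
    · intro x hx y hy hxy
      refine Set.disjoint_left.2 fun w hw hw' => hxy ?_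
      refine a.cut_unique (hS x hx).1 (hS y hy).1 ((hS x hx).2.trans (hS y hy).2.symm) hw.1 hw.2.le
        hw'.1 hw'.2.le ?_
      simp
    · exact fun x _ => (volume_real_arc x.2 (a.gap_pos x) (a.gap_le_one x)).1
  rw [h]
  exact (measureReal_mono (Set.subset_univ _)).trans volume_real_univ_circle.le

/-- The cut that follows a cut along the boundary. -/
def step (x : a.cuts) : a.cuts := ⟨a.next (a.hit x.1), a.next_mem_cuts (a.hit_mem_cuts x.1)⟩

lemma hit_injOn : Set.InjOn a.hit a.cuts := fun x hx y hy h =>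
  a.cut_unique hx hy (Prod.mk.inj h).1 (a.gap_pos x) le_rfl (a.gap_pos y) le_rfl (Prod.mk.inj h).2

lemma step_injective : Function.Injective a.step := fun x y h =>
  Subtype.ext (a.hit_injOn x.2 y.2 (a.next.injective (congrArg Subtype.val h)))

lemma exists_hit_eq {x : LobePoint n} (hx : x ∈ a.cuts) : ∃ y ∈ a.cuts, a.hit y = x := by
  have := a.finite_cuts.to_subtype
  have hinj : Function.Injective fun y : a.cuts => (⟨a.hit y.1, a.hit_mem_cuts y.1⟩ : a.cuts) :=
    fun y z h => Subtype.ext (a.hit_injOn y.2 z.2 (congrArg Subtype.val h))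
  obtain ⟨y, hy⟩ := Finite.surjective_of_injective hinj ⟨x, hx⟩
  exact ⟨y.1, y.2, congrArg Subtype.val hy⟩

/-- The `k`-th cut met along the boundary, starting at the base point. -/
def cutAt (k : ℕ) : LobePoint n := (a.step^[k] ⟨a.base, Or.inl (Or.inr rfl)⟩).1

@[simp] lemma cutAt_zero : a.cutAt 0 = a.base := rfl

/-- The number of arcs of the boundary. -/
def period : ℕ := Function.minimalPeriod a.step ⟨a.base, Or.inl (Or.inr rfl)⟩

lemma period_pos : 0 < a.period := by
  have := a.finite_cuts.to_subtype
  exact Function.minimalPeriod_pos_of_mem_periodicPts (a.step_injective.mem_periodicPts _)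

lemma cutAt_mem (k : ℕ) : a.cutAt k ∈ a.cuts := Subtype.prop _

lemma cutAt_succ (k : ℕ) : a.cutAt (k + 1) = a.next (a.hit (a.cutAt k)) := by
  rw [cutAt, Function.iterate_succ_apply']; rfl

lemma cutAt_add_period (k : ℕ) : a.cutAt (k + a.period) = a.cutAt k := by
  rw [cutAt, Function.iterate_add_apply, period, Function.iterate_minimalPeriod]; rfl

lemma cutAt_period : a.cutAt a.period = a.base := by
  have := a.cutAt_add_period 0
  rwa [zero_add] at this

lemma cutAt_injOn : Set.InjOn a.cutAt (Set.Iio a.period) := fun _ hk _ hl h =>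
  Function.iterate_injOn_Iio_minimalPeriod hk hl (Subtype.ext h)

lemma cutAt_mod (k : ℕ) : ∃ l < a.period, a.cutAt l = a.cutAt k := by
  refine ⟨k % a.period, Nat.mod_lt _ a.period_pos, ?_⟩
  rw [cutAt, cutAt, period, Function.iterate_mod_minimalPeriod_eq]

lemma mem_range_cutAt_of_step {y : LobePoint n} (hy : y ∈ a.cuts)
    (h : a.next (a.hit y) ∈ Set.range a.cutAt) : y ∈ Set.range a.cutAt := by
  obtain ⟨k, hk⟩ := h
  rw [← a.cutAt_add_period, show k + a.period = (k + a.period - 1) + 1 by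
    have := a.period_pos; omega, cutAt_succ] at hk
  exact ⟨_, a.hit_injOn (a.cutAt_mem _) hy (a.next.injective hk)⟩

/-- Follow the retraction onto the `i`-th lobe along the orbit of the base point: it advances by the
gap on arcs of this lobe, is constant on other arcs and unchanged by `next`. It returns to its value
after a period, so the total advance is an integer. -/
lemma exists_int_sum_gap (i : Fin n) : ∃ m : ℤ,
    (m : ℝ) = ∑ k ∈ Finset.range a.period, if (a.cutAt k).1 = i then a.gap (a.cutAt k) else 0 := by
  obtain ⟨ρ, h1, h2, h3⟩ := a.exists_retraction
  have key : ∀ m : ℕ, ((∑ k ∈ Finset.range m, if (a.cutAt k).1 = i then a.gap (a.cutAt k) else 0 :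
      ℝ) : UnitAddCircle) = ρ i (a.cutAt m) - ρ i a.base := fun m => by
    induction m with
    | zero => simp
    | succ m ih =>
      rw [Finset.sum_range_succ, AddCircle.coe_add, ih, cutAt_succ, h3]
      split_ifs with h
      · have e : a.cutAt m = (i, (a.cutAt m).2) := by rw [← h]
        have e2 : a.hit (a.cutAt m) = (i, (a.cutAt m).2 + (a.gap (a.cutAt m) : UnitAddCircle)) := by
          rw [hit, h]
        rw [e2, h1]
        nth_rw 1 [e]
        rw [h1]; abel
      · have e2 : ρ i (a.hit (a.cutAt m)) = ρ i (a.cutAt m) := h2 _ _ _ _ h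
        rw [e2]; simp
  have := key a.period
  rw [cutAt_period, sub_self] at this
  exact coe_eq_zero_iff_int.1 this

/-- The gaps of the visited arcs of a visited lobe add up to a positive integer that is at most `1`,
hence to `1`. There is no room left for an arc that is not visited, so the orbit traverses all of
the lobe exactly once. -/
lemma mem_range_cutAt_of_lobe {x : LobePoint n} (hx : x ∈ a.cuts) {k : ℕ}
    (hk : (a.cutAt k).1 = x.1) : x ∈ Set.range a.cutAt ∧
    ∑ k ∈ Finset.range a.period, (if (a.cutAt k).1 = x.1 then a.gap (a.cutAt k) else 0) = 1 := by
  classical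
  obtain ⟨m, hm⟩ := a.exists_int_sum_gap x.1
  obtain ⟨l, hl, hlk⟩ := a.cutAt_mod k
  have e : ∑ k ∈ Finset.range a.period, (if (a.cutAt k).1 = x.1 then a.gap (a.cutAt k) else 0) =
      ∑ y ∈ ((Finset.range a.period).filter fun k => (a.cutAt k).1 = x.1).image a.cutAt,
        a.gap y := by
    rw [Finset.sum_image, Finset.sum_filter]
    intro k hk l hl h
    exact a.cutAt_injOn (by simpa using (Finset.mem_filter.1 hk).1)
      (by simpa using (Finset.mem_filter.1 hl).1) h
  have hpos : 0 < ∑ k ∈ Finset.range a.period,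
      (if (a.cutAt k).1 = x.1 then a.gap (a.cutAt k) else 0) := by
    refine Finset.sum_pos' (fun k _ => ?_) ⟨l, Finset.mem_range.2 hl, ?_⟩
    · split_ifs
      · exact (a.gap_pos _).le
      · exact le_rfl
    · rw [if_pos (by rw [hlk, hk])]; exact a.gap_pos _
  have hmem : ∀ y ∈ ((Finset.range a.period).filter fun k => (a.cutAt k).1 = x.1).image a.cutAt,
      y ∈ a.cuts ∧ y.1 = x.1 := by
    intro y hy
    obtain ⟨k, hk, rfl⟩ := Finset.mem_image.1 hy
    exact ⟨a.cutAt_mem k, (Finset.mem_filter.1 hk).2⟩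
  have hle := a.sum_gap_le x.1 _ hmem
  rw [← e, ← hm] at hle
  rw [← hm] at hpos
  have h1 : m = 1 := by
    have h1 : 0 < m := by exact_mod_cast hpos
    have h2 : m ≤ 1 := by exact_mod_cast hle
    omega
  subst h1
  refine ⟨?_, by rw [← hm]; simp⟩
  by_contra hcon
  have h2 := a.sum_gap_le x.1 (insert x
    (((Finset.range a.period).filter fun k => (a.cutAt k).1 = x.1).image a.cutAt)) (fun y hy => by
      rcases Finset.mem_insert.1 hy with rfl | hy
      · exact ⟨hx, rfl⟩
      · exact hmem y hy)
  rw [Finset.sum_insert, ← e, ← hm] at h2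
  · have := a.gap_pos x
    push_cast at h2
    linarith
  · intro hx'
    obtain ⟨k, -, hk⟩ := Finset.mem_image.1 hx'
    exact hcon ⟨k, hk⟩

/-- Compare both sides with the cut `y` preceding `x` on its lobe, whose successor along the
boundary is `next x`. The cuts `x` and `y` share a lobe, and a lobe is visited completely or not at
all. -/
lemma next_mem_range_cutAt_iff (x : LobePoint n) :
    a.next x ∈ Set.range a.cutAt ↔ x ∈ Set.range a.cutAt := by
  by_cases h : a.next x = x
  · rw [h]
  have hx : x ∈ a.cuts := Or.inl (Or.inl h)
  obtain ⟨y, hy, hyx⟩ := a.exists_hit_eq hx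
  have hyx1 : y.1 = x.1 := by rw [← hyx]; rfl
  constructor
  · intro h1
    rw [← hyx] at h1
    obtain ⟨k, hk⟩ := a.mem_range_cutAt_of_step hy h1
    exact (a.mem_range_cutAt_of_lobe hx (k := k) (by rw [hk, hyx1])).1
  · rintro ⟨k, hk⟩
    obtain ⟨l, rfl⟩ := (a.mem_range_cutAt_of_lobe hy (k := k) (by rw [hk, hyx1])).1
    exact ⟨l + 1, by rw [cutAt_succ, hyx]⟩

/-- Being visited spreads along the edges of the dual graph: from a lobe to the intersection points
on it, and from an intersection point to all lobes through it. The graph is connected. -/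
lemma exists_cutAt_lobe (i : Fin n) : ∃ k, (a.cutAt k).1 = i := by
  have := (a.isTree.connected.preconnected (Sum.inl a.base.1) (Sum.inl i)).induct
    (Q := fun v => match v with
      | Sum.inl j => ∃ k, (a.cutAt k).1 = j
      | Sum.inr P => ∀ x ∈ P.1, x ∈ Set.range a.cutAt) ⟨0, rfl⟩ (by
    rintro (j | P) (j' | P') hadj hQ
    · exact absurd hadj not_dualGraph_adj_inl_inl
    · obtain ⟨t, ht⟩ := dualGraph_adj_inl_inr.1 hadj
      obtain ⟨k, hk⟩ := hQ
      have h1 := (a.mem_range_cutAt_of_lobe (x := (j, t)) (Or.inl (Or.inl (P'.next_ne ht))) hk).1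
      intro y hy
      have := eq_of_sameCycle_of_next (ρ := fun x => x ∈ Set.range a.cutAt)
        (fun x => propext (a.next_mem_range_cutAt_iff x)) (IntersectionPoint.sameCycle ht hy)
      exact this ▸ h1
    · obtain ⟨t, ht⟩ := dualGraph_adj_inr_inl.1 hadj
      obtain ⟨k, hk⟩ := hQ _ ht
      exact ⟨k, by rw [hk]⟩
    · exact absurd hadj not_dualGraph_adj_inr_inr)
  exact this

/-- The time at which the trace reaches the `k`-th cut. -/
def timeAt (k : ℕ) : ℝ := ∑ l ∈ Finset.range k, a.gap (a.cutAt l) * a.size (a.cutAt l).1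

@[simp] lemma timeAt_zero : a.timeAt 0 = 0 := by simp [timeAt]

lemma timeAt_succ (k : ℕ) :
    a.timeAt (k + 1) = a.timeAt k + a.gap (a.cutAt k) * a.size (a.cutAt k).1 :=
  Finset.sum_range_succ _ _

lemma timeAt_strictMono : StrictMono a.timeAt := strictMono_nat_of_lt_succ fun k => by
  rw [timeAt_succ]
  linarith [mul_pos (a.gap_pos (a.cutAt k)) (a.size_pos (a.cutAt k).1)]

/-- Each lobe is visited and its gaps add up to `1`, so the time spent on it is its size. -/
lemma timeAt_period : a.timeAt a.period = 1 := by
  rw [← a.sum_size, timeAt]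
  have : ∀ l ∈ Finset.range a.period, a.gap (a.cutAt l) * a.size (a.cutAt l).1 =
      ∑ i, (if (a.cutAt l).1 = i then a.gap (a.cutAt l) else 0) * a.size i := fun l _ => by
    simp
  rw [Finset.sum_congr rfl this, Finset.sum_comm]
  refine Finset.sum_congr rfl fun i _ => ?_
  obtain ⟨k, hk⟩ := a.exists_cutAt_lobe i
  have := (a.mem_range_cutAt_of_lobe (x := (i, 0)) (Or.inr ⟨i, rfl⟩) hk).2
  rw [← Finset.sum_mul, this, one_mul]

lemma exists_timeAt_le {u : ℝ} (h0 : 0 ≤ u) (h1 : u < 1) :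
    ∃ k < a.period, a.timeAt k ≤ u ∧ u < a.timeAt (k + 1) := by
  have hex : ∃ k, u < a.timeAt (k + 1) := by
    refine ⟨a.period - 1, ?_⟩
    rw [Nat.sub_add_cancel a.period_pos, timeAt_period]
    exact h1
  classical
  refine ⟨Nat.find hex, ?_, ?_, Nat.find_spec hex⟩
  · have := Nat.find_min' hex (m := a.period - 1) (by
      rw [Nat.sub_add_cancel a.period_pos, timeAt_period]; exact h1)
    have := a.period_pos
    omega
  · rcases Nat.eq_zero_or_pos (Nat.find hex) with h | h
    · rw [h, timeAt_zero]; exact h0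
    · have := Nat.find_min hex (m := Nat.find hex - 1) (by omega)
      rw [Nat.sub_add_cancel h] at this
      exact not_lt.1 this

/-- The boundary trace of a cactus. -/
def trace (t : UnitAddCircle) : LobePoint n :=
  lobeShift a.size (a.cutAt (a.exists_timeAt_le (ccw_nonneg t) (ccw_lt_one t)).choose)
    (ccw t - a.timeAt (a.exists_timeAt_le (ccw_nonneg t) (ccw_lt_one t)).choose)

lemma trace_coe {k : ℕ} (hk : k < a.period) {u : ℝ} (h0 : a.timeAt k ≤ u)
    (h1 : u < a.timeAt (k + 1)) :
    a.trace (u : UnitAddCircle) = lobeShift a.size (a.cutAt k) (u - a.timeAt k) := by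
  have hu0 : 0 ≤ u := by
    rw [← a.timeAt_zero]
    exact (a.timeAt_strictMono.monotone (Nat.zero_le k)).trans h0
  have hu1 : u < 1 := by
    rw [← a.timeAt_period]
    exact h1.trans_le (a.timeAt_strictMono.monotone hk)
  have hs := (a.exists_timeAt_le (ccw_nonneg (u : UnitAddCircle)) (ccw_lt_one _)).choose_spec
  unfold trace
  generalize (a.exists_timeAt_le (ccw_nonneg (u : UnitAddCircle)) (ccw_lt_one _)).choose = l at *
  rw [ccw_coe hu0 hu1] at *
  have : l = k := by
    have h3 := a.timeAt_strictMono.lt_iff_lt.1 (hs.2.1.trans_lt h1)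
    have h4 := a.timeAt_strictMono.lt_iff_lt.1 (h0.trans_lt hs.2.2)
    omega
  rw [this]

lemma trace_right (t : UnitAddCircle) : ∀ᶠ s : ℝ in 𝓝[>] 0,
    a.trace (t + (s : UnitAddCircle)) = lobeShift a.size (a.trace t) s := by
  obtain ⟨k, hk, h1, h2⟩ := a.exists_timeAt_le (ccw_nonneg t) (ccw_lt_one t)
  filter_upwards [eventually_nhdsGT_pos_lt (a.timeAt (k + 1) - ccw t) (by linarith)] with s hs
  have e := a.trace_coe hk h1 h2
  have e2 := a.trace_coe hk (u := ccw t + s) (by linarith [hs.1]) (by linarith [hs.2])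
  rw [AddCircle.coe_add] at e2
  rw [coe_ccw] at e e2
  rw [e, e2, lobeShift_lobeShift]
  congr 1; ring

lemma trace_left (t : UnitAddCircle) : ∀ᶠ s : ℝ in 𝓝[>] 0,
    a.trace (t - (s : UnitAddCircle)) = lobeShift a.size (a.next.symm (a.trace t)) (-s) := by
  -- Representing times in `(0, 1]` treats the initial time as the end of the last arc, as is
  -- appropriate for left limits.
  obtain ⟨u, h0, h1, rfl⟩ : ∃ u : ℝ, 0 < u ∧ u ≤ 1 ∧ (u : UnitAddCircle) = t := by
    by_cases h : t = 0
    · exact ⟨1, one_pos, le_rfl, by rw [coe_one_eq_zero, h]⟩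
    · exact ⟨ccw t, ccw_pos.2 h, (ccw_lt_one t).le, coe_ccw t⟩
  obtain ⟨k, hk, h2, h3⟩ : ∃ k < a.period, a.timeAt k < u ∧ u ≤ a.timeAt (k + 1) := by
    classical
    have hex : ∃ k, u ≤ a.timeAt k := ⟨a.period, by rw [timeAt_period]; exact h1⟩
    have hpos : Nat.find hex ≠ 0 := fun h => by
      have := Nat.find_spec hex
      rw [h, timeAt_zero] at this
      linarith
    refine ⟨Nat.find hex - 1, ?_, ?_, ?_⟩
    · have := Nat.find_min' hex (m := a.period) (by rw [timeAt_period]; exact h1)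
      omega
    · have := Nat.find_min hex (m := Nat.find hex - 1) (by omega)
      exact not_le.1 this
    · rw [Nat.sub_add_cancel (Nat.pos_of_ne_zero hpos)]
      exact Nat.find_spec hex
  -- The left limit of the trace at `u` is the point of the `k`-th arc at distance `u - timeAt k`.
  -- Inside the arc it is not a cut, so `next` fixes it; at the end of the arc `next` carries it to
  -- the following cut.
  have key : a.next.symm (a.trace (u : UnitAddCircle)) =
      lobeShift a.size (a.cutAt k) (u - a.timeAt k) := by
    rw [Equiv.symm_apply_eq]
    rcases h3.lt_or_eq with h3 | h3
    · rw [a.trace_coe hk h2.le h3]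
      have hd : (u - a.timeAt k) / a.size (a.cutAt k).1 < a.gap (a.cutAt k) := by
        rw [div_lt_iff₀ (a.size_pos _)]
        rw [timeAt_succ] at h3
        linarith
      have hn := a.not_mem_cuts_of_lt_gap (a.cutAt k)
        (div_pos (by linarith) (a.size_pos _)) hd
      by_contra hne
      exact hn (Or.inl (Or.inl (Ne.symm hne)))
    · have hstep : a.next (lobeShift a.size (a.cutAt k) (u - a.timeAt k)) = a.cutAt (k + 1) := by
        rw [cutAt_succ, hit, lobeShift]
        congr 4
        rw [h3, timeAt_succ, add_sub_cancel_left, mul_div_cancel_right₀ _ (a.size_pos _).ne']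
      rw [hstep]
      rcases (Nat.succ_le_of_lt hk).lt_or_eq with h4 | h4
      · rw [a.trace_coe h4 h3.ge (h3.trans_lt (a.timeAt_strictMono (Nat.lt_succ_self _))), h3,
          sub_self, lobeShift_zero]
      · have hu : u = 1 := by rw [h3, ← timeAt_period, ← h4]
        rw [hu, coe_one_eq_zero, show k + 1 = a.period from h4, cutAt_period]
        have := a.trace_coe (k := 0) a.period_pos (u := 0) (by simp) (by
          rw [← a.timeAt_zero]; exact a.timeAt_strictMono (by simp))
        simpa using this
  filter_upwards [eventually_nhdsGT_pos_lt (u - a.timeAt k) (by linarith)] with s hs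
  rw [key, ← AddCircle.coe_sub, lobeShift_lobeShift, a.trace_coe hk (by linarith [hs.2])
    (by linarith [hs.1])]
  congr 1; ring

lemma trace_zero : a.trace 0 = a.base := by
  have := a.trace_coe (k := 0) a.period_pos (u := 0) (by simp) (by
    rw [← a.timeAt_zero]; exact a.timeAt_strictMono (by simp))
  simpa using this

lemma exists_trace_lobe (i : Fin n) : ∃ t, (a.trace t).1 = i := by
  obtain ⟨k, hk⟩ := a.exists_cutAt_lobe i
  obtain ⟨l, hl, hlk⟩ := a.cutAt_mod k
  refine ⟨(a.timeAt l : ℝ), ?_⟩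
  rw [a.trace_coe hl le_rfl (a.timeAt_strictMono (Nat.lt_succ_self l)), lobeShift_fst, hlk, hk]

/-- Taking `next.symm ∘ trace` for the left limits makes the permutation of the resulting boundary
trace equal to `next`; compatibility of the retractions with `next` is then the gluing condition. -/
theorem exists_boundaryTrace : ∃ T : BoundaryTrace n, T.toCactus = a := by
  obtain ⟨ρ, h1, h2, h3⟩ := a.exists_retraction
  refine ⟨⟨a.size, a.trace, fun t => a.next.symm (a.trace t), ρ, a.size_pos, a.sum_size,
    a.trace_right, a.trace_left, h1, h2, fun i t => by
      rw [← h3 i (a.next.symm (a.trace t)), Equiv.apply_symm_apply], a.exists_trace_lobe⟩, ?_⟩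
  set T : BoundaryTrace n := _
  change T.toCactus = a
  apply Cactus.ext
  · rfl
  · change T.next = a.next
    ext1 x
    obtain ⟨t, rfl⟩ := T.ψ_surjective x
    rw [T.next_ψ]
    exact (Equiv.apply_symm_apply a.next (a.trace t)).symm
  · exact a.trace_zero

/-- A chosen boundary trace of a cactus. -/
def boundary : BoundaryTrace n := a.exists_boundaryTrace.choose

@[simp] lemma toCactus_boundary : a.boundary.toCactus = a := a.exists_boundaryTrace.choose_spec

end Cactus

end

noncomputable section


/-! # The operad of cacti -/

namespace BoundaryTrace

variable {n : ℕ}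

/-- Renumbering the lobes. -/
def act (T : BoundaryTrace n) (σ : Equiv.Perm (Fin n)) : BoundaryTrace n where
  size i := T.size (σ i)
  φ t := (σ.symm (T.φ t).1, (T.φ t).2)
  ψ t := (σ.symm (T.ψ t).1, (T.ψ t).2)
  ρ i x := T.ρ (σ i) (σ x.1, x.2)
  size_pos i := T.size_pos _
  sum_size := by rw [← T.sum_size]; exact Equiv.sum_comp σ T.size
  right t := by
    filter_upwards [T.right t] with s hs
    rw [hs]; simp [lobeShift]
  left t := by
    filter_upwards [T.left t] with s hs
    rw [hs]; simp [lobeShift]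
  ρ_self i s := T.ρ_self _ _
  ρ_const i j s s' h := T.ρ_const _ _ _ _ (by simpa using h)
  ρ_glue i t := by simpa using T.ρ_glue (σ i) t
  visit i := by
    obtain ⟨t, ht⟩ := T.visit (σ i)
    exact ⟨t, by simp [ht]⟩

lemma act_f (T : BoundaryTrace n) (σ : Equiv.Perm (Fin n)) (i : Fin n) :
    (T.act σ).f i = T.f (σ i) := by
  funext t; simp [f, act]

lemma act_isRelabeling (T : BoundaryTrace n) (σ : Equiv.Perm (Fin n)) :
    T.toCactus.IsRelabeling σ (T.act σ).toCactus := by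
  refine ⟨fun i => rfl, fun x => ?_, ?_⟩
  · obtain ⟨t, rfl⟩ := (T.act σ).ψ_surjective x
    change Prod.map σ id ((T.act σ).next _) = T.next _
    rw [next_ψ]
    have h : Prod.map σ id ((T.act σ).ψ t) = T.ψ t := by simp [act]
    rw [h, next_ψ]
    simp [act]
  · change Prod.map σ id ((T.act σ).φ 0) = T.φ 0
    simp [act]

lemma eventually_div {P : ℝ → Prop} {r : ℝ} (hr : 0 < r) (h : ∀ᶠ s : ℝ in 𝓝[>] 0, P s) :
    ∀ᶠ s : ℝ in 𝓝[>] 0, P (s / r) := by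
  filter_upwards [eventually_mul (inv_pos.2 hr) h] with s hs
  rwa [div_eq_inv_mul]

variable {m : ℕ} {k : Fin m → ℕ}

/-- The inclusion of the lobes of the `i`-th cactus into those of the composite. -/
def incl (i : Fin m) (x : LobePoint (k i)) : LobePoint (∑ i, k i) :=
  (finSigmaFinEquiv ⟨i, x.1⟩, x.2)

@[simp] lemma incl_fst (i : Fin m) (x : LobePoint (k i)) :
    (incl i x).1 = finSigmaFinEquiv ⟨i, x.1⟩ := rfl

/-- The lobe of the outer cactus of a composite. -/
abbrev outer (l : Fin (∑ i, k i)) : Fin m := (finSigmaFinEquiv.symm l).1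

/-- The lobe of the inner cactus of a composite. -/
abbrev inner (l : Fin (∑ i, k i)) : Fin (k (outer l)) := (finSigmaFinEquiv.symm l).2

/-- Forgetting the inner structure of a composite. -/
def collapse (U : ∀ i, BoundaryTrace (k i)) (x : LobePoint (∑ i, k i)) : LobePoint m :=
  (outer x.1, (U (outer x.1)).φEquiv.symm (inner x.1, x.2))

@[simp] lemma φEquiv_symm_φ (T : BoundaryTrace n) (t : UnitAddCircle) : T.φEquiv.symm (T.φ t) = t :=
  T.φEquiv.symm_apply_apply t

@[simp] lemma φ_φEquiv_symm (T : BoundaryTrace n) (x : LobePoint n) : T.φ (T.φEquiv.symm x) = x :=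
  T.φEquiv.apply_symm_apply x

lemma collapse_incl (U : ∀ i, BoundaryTrace (k i)) (i : Fin m) (x : LobePoint (k i)) :
    collapse U (incl i x) = (i, (U i).φEquiv.symm x) := by
  -- Stating the identity for every pair equal to `⟨i, x.1⟩` lets the dependent second component be
  -- replaced by substitution. The same device is used below wherever `finSigmaFinEquiv` is
  -- inverted.
  have h : ∀ y : (Σ i, Fin (k i)), y = ⟨i, x.1⟩ →
      ((y.1, (U y.1).φEquiv.symm (y.2, x.2)) : LobePoint m) = (i, (U i).φEquiv.symm x) := by
    rintro _ rfl; rfl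
  exact h _ (by simp [incl])

lemma f_φEquiv_symm (T : BoundaryTrace n) (j : Fin n) (x : LobePoint n) :
    T.f j (T.φEquiv.symm x) = T.ρ j x := by rw [f, φ_φEquiv_symm]

/-- The gluing condition of the composite. Since `collapse` inverts `φ`, it may move a left limit of
the inner trace to another time, but one with the same value under the inner pinching map. If the
outer left limit is on another lobe than `i`, the outer retraction ignores the time altogether. -/
lemma comp_ρ_ψ (T : BoundaryTrace m) (U : ∀ i, BoundaryTrace (k i)) (i : Fin m) (j : Fin (k i))
    (t : UnitAddCircle) :
    (U i).f j (T.ρ i (collapse U (incl (T.ψ t).1 ((U (T.ψ t).1).ψ (T.ψ t).2)))) =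
      (U i).f j (T.f i t) := by
  rw [collapse_incl, f_eq_ψ T]
  by_cases h : (T.ψ t).1 = i
  · subst h
    rw [T.ρ_self]
    have : T.ρ (T.ψ t).1 (T.ψ t) = (T.ψ t).2 := T.ρ_self _ _
    rw [this, f_φEquiv_symm, ← f_eq_ψ]
  · congr 1
    exact T.ρ_const _ _ _ _ h

lemma lobeShift_incl (T : BoundaryTrace m) (U : ∀ i, BoundaryTrace (k i)) (i : Fin m)
    (x : LobePoint (k i)) (s : ℝ) :
    lobeShift (fun l : Fin (∑ i, k i) => T.size (outer l) * (U (outer l)).size (inner l))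
      (incl i x) s = incl i (lobeShift (U i).size x (s / T.size i)) := by
  have h : ∀ y : (Σ i, Fin (k i)), y = ⟨i, x.1⟩ →
      T.size y.1 * (U y.1).size y.2 = T.size i * (U i).size x.1 := by
    rintro _ rfl; rfl
  have h' := h (finSigmaFinEquiv.symm (finSigmaFinEquiv ⟨i, x.1⟩)) (by simp)
  simp only [lobeShift, incl, h', div_div]

/-- The composite of boundary traces. -/
def comp (T : BoundaryTrace m) (U : ∀ i, BoundaryTrace (k i)) : BoundaryTrace (∑ i, k i) where
  size l := T.size (outer l) * (U (outer l)).size (inner l)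
  φ t := incl (T.φ t).1 ((U (T.φ t).1).φ (T.φ t).2)
  ψ t := incl (T.ψ t).1 ((U (T.ψ t).1).ψ (T.ψ t).2)
  ρ l x := (U (outer l)).f (inner l) (T.ρ (outer l) (collapse U x))
  size_pos l := mul_pos (T.size_pos _) ((U _).size_pos _)
  sum_size := by
    have h : ∑ l : Fin (∑ i, k i), T.size (outer l) * (U (outer l)).size (inner l) =
        ∑ y : (Σ i, Fin (k i)), T.size y.1 * (U y.1).size y.2 :=
      Equiv.sum_comp finSigmaFinEquiv.symm
        (fun y : (Σ i, Fin (k i)) => T.size y.1 * (U y.1).size y.2)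
    rw [h, Fintype.sum_sigma]
    simp_rw [← Finset.mul_sum, (U _).sum_size, mul_one]
    exact T.sum_size
  right t := by
    filter_upwards [T.right t, eventually_div (T.size_pos (T.φ t).1)
      ((U (T.φ t).1).right (T.φ t).2)] with s h1 h2
    rw [h1]
    change incl (T.φ t).1 ((U (T.φ t).1).φ ((T.φ t).2 + _)) = _
    rw [h2, lobeShift_incl]
  left t := by
    filter_upwards [T.left t, eventually_div (T.size_pos (T.ψ t).1)
      ((U (T.ψ t).1).left (T.ψ t).2)] with s h1 h2
    rw [h1]
    change incl (T.ψ t).1 ((U (T.ψ t).1).φ ((T.ψ t).2 + _)) = _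
    rw [neg_div, AddCircle.coe_neg, ← sub_eq_add_neg, h2, lobeShift_incl, neg_div]
  ρ_self l s := by
    have : ((l, s) : LobePoint _) = incl (outer l) (inner l, s) := by simp [incl, outer, inner]
    rw [this, collapse_incl, T.ρ_self, f_φEquiv_symm, (U _).ρ_self]
  ρ_const l l' s s' h := by
    change (U (outer l)).f (inner l) (T.ρ (outer l) (outer l', _)) =
      (U (outer l)).f (inner l) (T.ρ (outer l) (outer l', _))
    obtain ⟨⟨i, j⟩, rfl⟩ := finSigmaFinEquiv.surjective l
    obtain ⟨⟨i', j'⟩, rfl⟩ := finSigmaFinEquiv.surjective l'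
    have h1 := collapse_incl U i' (j', s)
    have h2 := collapse_incl U i' (j', s')
    change (U (outer _)).f (inner _) (T.ρ (outer _) (collapse U (incl i' (j', s)))) =
      (U (outer _)).f (inner _) (T.ρ (outer _) (collapse U (incl i' (j', s'))))
    rw [h1, h2]
    have key : ∀ y : (Σ i, Fin (k i)), (⟨i', j'⟩ : Σ i, Fin (k i)) ≠ y →
      (U y.1).f y.2 (T.ρ y.1 (i', (U i').φEquiv.symm (j', s))) =
      (U y.1).f y.2 (T.ρ y.1 (i', (U i').φEquiv.symm (j', s'))) := by
      rintro ⟨i, j⟩ hne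
      by_cases hi : i' = i
      · subst hi
        rw [T.ρ_self, T.ρ_self, f_φEquiv_symm, f_φEquiv_symm]
        refine (U i').ρ_const _ _ _ _ fun hj => hne ?_
        simp only at hj
        rw [hj]
      · exact congrArg _ (T.ρ_const _ _ _ _ hi)
    exact key _ (by simpa using h)
  ρ_glue l t := by
    rw [comp_ρ_ψ, collapse_incl, φEquiv_symm_φ]
    rfl
  visit l := by
    obtain ⟨x, hx⟩ := (U (outer l)).visit (inner l)
    obtain ⟨t, ht⟩ := T.φ_surjective (outer l, x)
    exact ⟨t, by rw [ht, incl_fst, hx]; simp⟩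

/-- Pinching onto an inner lobe can be done in two stages, first onto the outer lobe and then inside
it. All operad identities rest on this formula. -/
lemma comp_f (T : BoundaryTrace m) (U : ∀ i, BoundaryTrace (k i)) (l : Fin (∑ i, k i)) :
    (T.comp U).f l = (U (outer l)).f (inner l) ∘ T.f (outer l) := by
  funext t
  change (U (outer l)).f (inner l) (T.ρ (outer l) (collapse U (incl _ _))) = _
  rw [collapse_incl, φEquiv_symm_φ]
  rfl

lemma comp_isComposite (T : BoundaryTrace m) (U : ∀ i, BoundaryTrace (k i)) :
    T.toCactus.IsComposite (fun i => (U i).toCactus) (T.comp U).toCactus := by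
  refine ⟨fun i => (U i).φEquiv, fun i => (U i).isTrace, fun i j => ?_, rfl, fun i x => ?_⟩
  · change T.size (outer _) * (U (outer _)).size (inner _) = T.size i * (U i).size j
    have h : ∀ y : (Σ i, Fin (k i)), y = ⟨i, j⟩ →
      T.size y.1 * (U y.1).size y.2 = T.size i * (U i).size j := by rintro _ rfl; rfl
    exact h _ (by simp)
  · obtain ⟨x', rfl⟩ := (U i).ψ_surjective x
    obtain ⟨t, ht⟩ := T.ψ_surjective (i, x')
    have h1 : incl i ((U i).ψ x') = (T.comp U).ψ t := by
      change _ = incl (T.ψ t).1 ((U (T.ψ t).1).ψ (T.ψ t).2)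
      rw [ht]
    change (T.comp U).next (incl i ((U i).ψ x')) = _
    rw [h1, next_ψ]
    change _ = incl (T.next (i, (U i).φEquiv.symm ((U i).next ((U i).ψ x')))).1 _
    have h2 : T.next (i, (U i).φEquiv.symm ((U i).next ((U i).ψ x'))) = T.φ t := by
      rw [next_ψ, φEquiv_symm_φ, ← ht, next_ψ]
    have h3 : ∀ y, y = T.φ t → (T.comp U).φ t = incl y.1 ((U y.1).φEquiv y.2) := by
      rintro _ rfl; rfl
    exact h3 _ h2

/-- The trace of the one-lobe cactus whose base point is its marked point. -/
def unit : BoundaryTrace 1 where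
  size _ := 1
  φ t := (0, t)
  ψ t := (0, t)
  ρ _ x := x.2
  size_pos _ := one_pos
  sum_size := by simp
  right t := by simp [lobeShift]
  left t := by simp [lobeShift, sub_eq_add_neg]
  ρ_self i s := rfl
  ρ_const i j s s' h := absurd (Subsingleton.elim j i) h
  ρ_glue i t := rfl
  visit i := ⟨0, Subsingleton.elim _ _⟩

lemma unit_f (i : Fin 1) : unit.f i = id := rfl

end BoundaryTrace

/-! ### Pinching maps as coordinates on the space of cacti -/

namespace Cactus

variable {n : ℕ}

lemma boundary_size (a : Cactus n) : a.boundary.size = a.size :=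
  congrArg Cactus.size a.toCactus_boundary

lemma pinchingMap_apply (a : Cactus n) (i : Fin n) (t : UnitAddCircle) :
    a.pinchingMap i t = a.boundary.f i t := by
  rw [← BoundaryTrace.pinchingMap_apply, toCactus_boundary]

/-- The lobe on which the trace runs is the one whose pinching map is moving, so the pinching maps
reveal the lobes visited; `BoundaryTrace.toCactus_eq` does the rest. -/
lemma ext_pinchingMap {a a' : Cactus n} (h : a.pinchingMap = a'.pinchingMap) : a = a' := by
  have hf : ∀ i t, a.boundary.f i t = a'.boundary.f i t := fun i t => by
    rw [← pinchingMap_apply, ← pinchingMap_apply, h]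
  rw [← a.toCactus_boundary, ← a'.toCactus_boundary]
  refine BoundaryTrace.toCactus_eq (fun t => ?_) fun i => ⟨0, hf i 0⟩
  by_contra hne
  set i := (a.boundary.φ t).1 with hi
  have hp := a.boundary.size_pos i
  obtain ⟨s, h1, h2, h3⟩ := ((a.boundary.f_right i t).and ((a'.boundary.f_right i t).and
    (eventually_nhdsGT_pos_lt _ hp))).exists
  rw [if_pos rfl, hf, h2, if_neg (Ne.symm hne), hf, add_zero, left_eq_add] at h1
  have h4 := ccw_coe (div_pos h3.1 hp).le ((div_lt_one hp).2 h3.2)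
  rw [h1, ccw_zero] at h4
  linarith [div_pos h3.1 hp]

lemma heq_of_pinchingMap {b c : ℕ} (h : b = c) {x : Cactus b} {y : Cactus c}
    (hxy : ∀ i, x.pinchingMap i = y.pinchingMap (finCongr h i)) : HEq x y := by
  subst h
  exact heq_of_eq (ext_pinchingMap (funext hxy))

/-- Renumbering the lobes of a cactus. -/
def act (a : Cactus n) (σ : Equiv.Perm (Fin n)) : Cactus n := (a.boundary.act σ).toCactus

lemma act_size (a : Cactus n) (σ : Equiv.Perm (Fin n)) (i : Fin n) :
    (a.act σ).size i = a.size (σ i) := by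
  rw [← boundary_size a]; rfl

@[simp] lemma act_pinchingMap (a : Cactus n) (σ : Equiv.Perm (Fin n)) (i : Fin n) :
    (a.act σ).pinchingMap i = a.pinchingMap (σ i) := by
  ext t
  rw [act, BoundaryTrace.pinchingMap_apply, BoundaryTrace.act_f, pinchingMap_apply]

variable {m : ℕ} {k : Fin m → ℕ}

/-- The composite of cacti. -/
def comp (a : Cactus m) (b : ∀ i, Cactus (k i)) : Cactus (∑ i, k i) :=
  (a.boundary.comp fun i => (b i).boundary).toCactus

lemma comp_size (a : Cactus m) (b : ∀ i, Cactus (k i)) (l : Fin (∑ i, k i)) :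
    (a.comp b).size l = a.size (BoundaryTrace.outer l) *
      (b (BoundaryTrace.outer l)).size (BoundaryTrace.inner l) := by
  rw [← boundary_size a, ← boundary_size (b _)]; rfl

lemma comp_pinchingMap (a : Cactus m) (b : ∀ i, Cactus (k i)) (l : Fin (∑ i, k i)) :
    (a.comp b).pinchingMap l = ((b (BoundaryTrace.outer l)).pinchingMap
      (BoundaryTrace.inner l)).comp (a.pinchingMap (BoundaryTrace.outer l)) := by
  ext t
  rw [comp, BoundaryTrace.pinchingMap_apply, BoundaryTrace.comp_f, ContinuousMap.comp_apply,
    pinchingMap_apply, pinchingMap_apply]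
  rfl

lemma comp_pinchingMap_mk (a : Cactus m) (b : ∀ i, Cactus (k i)) (i : Fin m) (j : Fin (k i)) :
    (a.comp b).pinchingMap (finSigmaFinEquiv ⟨i, j⟩) =
      ((b i).pinchingMap j).comp (a.pinchingMap i) := by
  rw [comp_pinchingMap]
  have h : ∀ y : (Σ i, Fin (k i)), y = ⟨i, j⟩ →
    ((b y.1).pinchingMap y.2).comp (a.pinchingMap y.1) =
      ((b i).pinchingMap j).comp (a.pinchingMap i) := by rintro _ rfl; rfl
  exact h _ (by simp)

/-- The one-lobe cactus whose base point is its marked point. -/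
def unit : Cactus 1 := BoundaryTrace.unit.toCactus

@[simp] lemma unit_pinchingMap (i : Fin 1) : unit.pinchingMap i = ContinuousMap.id _ := by
  ext t; rw [unit, BoundaryTrace.pinchingMap_apply, BoundaryTrace.unit_f]; rfl

lemma isInducing : IsInducing fun a : Cactus n => (a.size, a.pinchingMap) := ⟨rfl⟩

lemma continuous_size (i : Fin n) : Continuous fun a : Cactus n => a.size i :=
  (continuous_apply i).comp (continuous_fst.comp isInducing.continuous)

lemma continuous_pinchingMap (i : Fin n) : Continuous fun a : Cactus n => a.pinchingMap i :=
  (continuous_apply i).comp (continuous_snd.comp isInducing.continuous)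

/-- Used for the quotient property of the contraction, where compact images must be closed. -/
instance : T2Space (Cactus n) :=
  T2Space.of_injective_continuous (f := fun a : Cactus n => (a.size, a.pinchingMap))
    (fun _ _ h => ext_pinchingMap (Prod.mk.inj h).2) isInducing.continuous

lemma continuous_iff {X : Type*} [TopologicalSpace X] {g : X → Cactus n} : Continuous g ↔
    (∀ i, Continuous fun x => (g x).size i) ∧ ∀ i, Continuous fun x => (g x).pinchingMap i := by
  rw [isInducing.continuous_iff]
  change Continuous (fun x => ((g x).size, (g x).pinchingMap)) ↔ _
  rw [continuous_prodMk, continuous_pi_iff, continuous_pi_iff]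

lemma continuous_act (σ : Equiv.Perm (Fin n)) : Continuous fun a : Cactus n => a.act σ := by
  rw [continuous_iff]
  simp only [act_size, act_pinchingMap]
  exact ⟨fun i => continuous_size _, fun i => continuous_pinchingMap _⟩

lemma continuous_comp : Continuous fun p : Cactus m × (∀ i, Cactus (k i)) => p.1.comp p.2 := by
  rw [continuous_iff]
  simp only [comp_size, comp_pinchingMap]
  have h2 : ∀ i, Continuous fun p : Cactus m × (∀ i, Cactus (k i)) => p.2 i :=
    fun i => (continuous_apply i).comp continuous_snd
  refine ⟨fun l => ?_, fun l => ?_⟩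
  · exact ((continuous_size _).comp continuous_fst).mul ((continuous_size _).comp (h2 _))
  · exact ContinuousMap.continuous_comp'.comp
      (((continuous_pinchingMap _).comp continuous_fst).prodMk
        ((continuous_pinchingMap _).comp (h2 _)))

end Cactus

/-! ## The lexicographic numbering -/

lemma finSigmaFinEquiv_val {m : ℕ} {k : Fin m → ℕ} (i : Fin m) (j : Fin (k i)) :
    (finSigmaFinEquiv ⟨i, j⟩ : ℕ) = ∑ t ∈ Finset.Iio i, k t + j := by
  rw [finSigmaFinEquiv_apply]
  congr 1
  refine Finset.sum_bij (fun t _ => Fin.castLE i.2.le t) ?_ ?_ ?_ ?_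
  · exact fun t _ => Finset.mem_Iio.2 (Fin.lt_def.2 t.2)
  · exact fun t _ t' _ h => Fin.castLE_injective _ h
  · intro t ht
    exact ⟨⟨t, Fin.lt_def.1 (Finset.mem_Iio.1 ht)⟩, Finset.mem_univ _, rfl⟩
  · intro t _; rfl

lemma finSigmaFinEquiv_lt_of_lt {m : ℕ} {k : Fin m → ℕ} {i i' : Fin m} (h : i' < i)
    (j : Fin (k i)) (j' : Fin (k i')) :
    (finSigmaFinEquiv ⟨i', j'⟩ : Fin (∑ i, k i)) < finSigmaFinEquiv ⟨i, j⟩ := by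
  rw [Fin.lt_def, finSigmaFinEquiv_val, finSigmaFinEquiv_val]
  have h1 : ∑ t ∈ Finset.Iio i', k t + k i' ≤ ∑ t ∈ Finset.Iio i, k t := by
    rw [add_comm, ← Finset.sum_insert (by simp)]
    refine Finset.sum_le_sum_of_subset fun t ht => ?_
    rcases Finset.mem_insert.1 ht with rfl | ht
    · simpa using h
    · simpa using (Finset.mem_Iio.1 ht).trans h
  have := j'.2
  omega

lemma finSigmaFinEquiv_lt_iff {m : ℕ} {k : Fin m → ℕ} {i : Fin m} (j j' : Fin (k i)) :
    (finSigmaFinEquiv ⟨i, j'⟩ : Fin (∑ i, k i)) < finSigmaFinEquiv ⟨i, j⟩ ↔ j' < j := by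
  rw [Fin.lt_def, finSigmaFinEquiv_val, finSigmaFinEquiv_val, Fin.lt_def]
  simp

lemma sum_univ_eq_Iio_add {m : ℕ} (i : Fin m) (G : Fin m → ℕ) :
    ∑ t, G t = ∑ t ∈ Finset.Iio i, G t + (G i + ∑ t ∈ Finset.Ioi i, G t) := by
  have e3 : (Finset.univ : Finset (Fin m)) = Finset.Iio i ∪ ({i} ∪ Finset.Ioi i) := by
    ext t
    simp only [Finset.mem_univ, Finset.mem_union, Finset.mem_Iio, Finset.mem_singleton,
      Finset.mem_Ioi, true_iff]
    exact lt_trichotomy t i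
  rw [e3, Finset.sum_union, Finset.sum_union, Finset.sum_singleton]
  · simp
  · rw [Finset.disjoint_left]
    intro t h1 h2
    rw [Finset.mem_Iio] at h1
    rcases Finset.mem_union.1 h2 with h3 | h3
    · rw [Finset.mem_singleton] at h3
      exact h1.ne h3
    · exact h1.asymm (Finset.mem_Ioi.1 h3)

/-- The total size of the blocks before the position `(i, j)` splits into the complete blocks before
`i` and the part of the `i`-th block before `j`. This identifies the two iterated lexicographic
numberings in the associativity axiom. -/
lemma sum_Iio_finSigmaFinEquiv {m : ℕ} {k : Fin m → ℕ} (g : Fin (∑ i, k i) → ℕ) (i : Fin m)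
    (j : Fin (k i)) : ∑ l ∈ Finset.Iio (finSigmaFinEquiv ⟨i, j⟩), g l =
      ∑ i' ∈ Finset.Iio i, ∑ j', g (finSigmaFinEquiv ⟨i', j'⟩) +
        ∑ j' ∈ Finset.Iio j, g (finSigmaFinEquiv ⟨i, j'⟩) := by
  have e1 : Finset.Iio (finSigmaFinEquiv ⟨i, j⟩ : Fin (∑ i, k i)) =
      Finset.univ.filter (· < finSigmaFinEquiv ⟨i, j⟩) := by ext; simp
  have e2 : Finset.Iio j = Finset.univ.filter (· < j) := by ext; simp
  rw [e1, Finset.sum_filter, ← Equiv.sum_comp finSigmaFinEquiv, Fintype.sum_sigma,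
    sum_univ_eq_Iio_add i]
  · congr 1
    · refine Finset.sum_congr rfl fun i' hi' => Finset.sum_congr rfl fun j' _ => ?_
      rw [if_pos (finSigmaFinEquiv_lt_of_lt (Finset.mem_Iio.1 hi') _ _)]
    · rw [e2, Finset.sum_filter]
      have : ∑ x ∈ Finset.Ioi i, ∑ y, (if (finSigmaFinEquiv ⟨x, y⟩ : Fin (∑ i, k i)) <
          finSigmaFinEquiv ⟨i, j⟩ then g (finSigmaFinEquiv ⟨x, y⟩) else 0) = 0 := by
        refine Finset.sum_eq_zero fun i' hi' => Finset.sum_eq_zero fun j' _ => ?_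
        rw [if_neg (finSigmaFinEquiv_lt_of_lt (Finset.mem_Ioi.1 hi') _ _).asymm]
      rw [this, add_zero]
      simp only [finSigmaFinEquiv_lt_iff]

/-! ### The operad axioms for cacti -/

namespace Cactus

variable {m : ℕ} {k : Fin m → ℕ}

lemma comp_assoc {q : ∀ i, Fin (k i) → ℕ} (x : Cactus m) (y : ∀ i, Cactus (k i))
    (z : ∀ i j, Cactus (q i j)) :
    HEq (comp (comp x y) (fun l : Fin (∑ i, k i) =>
          z (finSigmaFinEquiv.symm l).1 (finSigmaFinEquiv.symm l).2))
        (comp x (fun i => comp (y i) (z i))) := by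
  have hsum : ∑ l : Fin (∑ i, k i), q (finSigmaFinEquiv.symm l).1 (finSigmaFinEquiv.symm l).2 =
      ∑ i, ∑ j, q i j := by
    rw [← Fintype.sum_sigma (f := fun y : (Σ i, Fin (k i)) => q y.1 y.2)]
    exact Equiv.sum_comp finSigmaFinEquiv.symm (fun y : (Σ i, Fin (k i)) => q y.1 y.2)
  refine heq_of_pinchingMap hsum fun l => ?_
  obtain ⟨⟨L, c⟩, rfl⟩ := finSigmaFinEquiv.surjective l
  have e : finCongr hsum (finSigmaFinEquiv ⟨L, c⟩) =
      finSigmaFinEquiv ⟨(finSigmaFinEquiv.symm L).1,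
        finSigmaFinEquiv ⟨(finSigmaFinEquiv.symm L).2, c⟩⟩ := by
    apply Fin.ext
    rw [finCongr_apply, Fin.val_cast, finSigmaFinEquiv_val, finSigmaFinEquiv_val,
      finSigmaFinEquiv_val, ← add_assoc]
    congr 1
    have h := sum_Iio_finSigmaFinEquiv
      (fun l : Fin (∑ i, k i) => q (finSigmaFinEquiv.symm l).1 (finSigmaFinEquiv.symm l).2)
      (finSigmaFinEquiv.symm L).1 (finSigmaFinEquiv.symm L).2
    have hg : ∀ y : (Σ i, Fin (k i)), q (finSigmaFinEquiv.symm (finSigmaFinEquiv y)).1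
        (finSigmaFinEquiv.symm (finSigmaFinEquiv y)).2 = q y.1 y.2 := fun y =>
      congrArg (fun y : (Σ i, Fin (k i)) => q y.1 y.2) (finSigmaFinEquiv.symm_apply_apply y)
    simp only [Sigma.eta, Equiv.apply_symm_apply, hg] at h
    exact h
  rw [e, comp_pinchingMap_mk, comp_pinchingMap_mk, comp_pinchingMap_mk, comp_pinchingMap]
  rfl

lemma unit_comp {n : ℕ} (y : Cactus n) : HEq (comp unit (fun _ : Fin 1 => y)) y := by
  have hsum : ∑ _ : Fin 1, n = n := by simp
  refine heq_of_pinchingMap hsum fun l => ?_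
  obtain ⟨⟨i, j⟩, rfl⟩ := finSigmaFinEquiv.surjective l
  have e : finCongr hsum (finSigmaFinEquiv ⟨i, j⟩) = j := by
    apply Fin.ext
    rw [finCongr_apply, Fin.val_cast, finSigmaFinEquiv_val]
    have : Finset.Iio i = ∅ := by
      ext t; simp [Subsingleton.elim t i]
    rw [this]; simp
  rw [e, comp_pinchingMap_mk, unit_pinchingMap]
  rfl

lemma comp_unit {n : ℕ} (x : Cactus n) : HEq (comp x (fun _ : Fin n => unit)) x := by
  have hsum : ∑ _ : Fin n, 1 = n := by simp
  refine heq_of_pinchingMap hsum fun l => ?_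
  obtain ⟨⟨i, j⟩, rfl⟩ := finSigmaFinEquiv.surjective l
  have e : finCongr hsum (finSigmaFinEquiv ⟨i, j⟩) = i := by
    apply Fin.ext
    rw [finCongr_apply, Fin.val_cast, finSigmaFinEquiv_val]
    simp
  rw [e, comp_pinchingMap_mk, unit_pinchingMap]
  rfl

lemma reindexAlong_pinchingMap {b c : ℕ} (e : Fin b ≃ Fin c) (x : Cactus c) (i : Fin b) :
    (reindexAlong (O := Cactus) act e x).pinchingMap i = x.pinchingMap (e i) := by
  obtain rfl : c = b := by simpa using (Fintype.card_congr e).symm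
  unfold reindexAlong
  simp only [cast_eq, act_pinchingMap]
  rfl

/-- The operad of cacti. -/
def operad : TopOperad Cactus where
  act := act
  comp := comp
  unit := unit
  continuous_act := continuous_act
  continuous_comp := continuous_comp
  act_one x := ext_pinchingMap (funext fun i => by simp)
  act_mul x σ τ := ext_pinchingMap (funext fun i => by simp)
  unit_comp := unit_comp
  comp_unit := comp_unit
  comp_assoc := comp_assoc
  act_comp x y σ := ext_pinchingMap (funext fun l => by
    obtain ⟨⟨i, j⟩, rfl⟩ := finSigmaFinEquiv.surjective l
    rw [comp_pinchingMap_mk, reindexAlong_pinchingMap, act_pinchingMap]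
    simp only [Equiv.trans_apply, Equiv.symm_apply_apply]
    exact (comp_pinchingMap_mk x y (σ i) j).symm)
  comp_act x y τ := ext_pinchingMap (funext fun l => by
    obtain ⟨⟨i, j⟩, rfl⟩ := finSigmaFinEquiv.surjective l
    rw [comp_pinchingMap_mk, act_pinchingMap, act_pinchingMap]
    simp only [Equiv.permCongr_apply, Equiv.symm_apply_apply]
    exact (comp_pinchingMap_mk x y i (τ i j)).symm)

lemma operad_isCactusOperad : IsCactusOperad operad := by
  refine ⟨fun n a σ => ?_, fun m k a b => ?_, rfl⟩
  · have := BoundaryTrace.act_isRelabeling a.boundary σ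
    rwa [toCactus_boundary] at this
  · have := BoundaryTrace.comp_isComposite a.boundary fun i => (b i).boundary
    simp only [toCactus_boundary] at this
    exact this

end Cactus

end

noncomputable section


/-! # Noncrossing labelings of the circle -/

lemma finite_of_isolated {S : Set UnitAddCircle}
    (hr : ∀ t : UnitAddCircle, ∀ᶠ s : ℝ in 𝓝[>] 0, t + (s : UnitAddCircle) ∉ S)
    (hl : ∀ t : UnitAddCircle, ∀ᶠ s : ℝ in 𝓝[>] 0, t - (s : UnitAddCircle) ∉ S) : S.Finite := by
  have hcl : ∀ t, ∀ᶠ x in 𝓝 t, x = t ∨ x ∉ S := fun t =>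
    eventually_nhds_circle (Or.inl rfl) ((hr t).mono fun _ h => Or.inr h)
      ((hl t).mono fun _ h => Or.inr h)
  obtain ⟨F, -, hF⟩ := isCompact_univ.elim_nhds_subcover
    (fun t : UnitAddCircle => {x | x = t ∨ x ∉ S}) (fun t _ => hcl t)
  refine F.finite_toSet.subset fun x hx => ?_
  obtain ⟨t, ht, h⟩ := Set.mem_iUnion₂.1 (hF (Set.mem_univ x))
  rcases h with rfl | h
  · exact ht
  · exact absurd hx h

lemma volume_real_finite {S : Set UnitAddCircle} (hS : S.Finite) : volume S = 0 := by
  have h : S = ⋃ x ∈ S, {x} := by simp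
  rw [h]
  exact (measure_biUnion_null_iff hS.countable).2 fun x _ => volume_singleton_circle x

lemma eventually_add_not_mem_finite {S : Set UnitAddCircle} (hS : S.Finite) (t : UnitAddCircle) :
    ∀ᶠ s : ℝ in 𝓝[>] 0, t + (s : UnitAddCircle) ∉ S := by
  have h : ∀ᶠ x in 𝓝 t, x ∉ S \ {t} :=
    (hS.subset Set.sdiff_subset).isClosed.isOpen_compl.mem_nhds fun h => h.2 rfl
  filter_upwards [(tendsto_add_coe t).eventually h, eventually_nhdsGT_pos_lt 1 one_pos]
    with s h1 h2 h3
  exact h1 ⟨h3, add_coe_ne h2.1 h2.2⟩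

lemma eventually_sub_not_mem_finite {S : Set UnitAddCircle} (hS : S.Finite) (t : UnitAddCircle) :
    ∀ᶠ s : ℝ in 𝓝[>] 0, t - (s : UnitAddCircle) ∉ S := by
  have h : ∀ᶠ x in 𝓝 t, x ∉ S \ {t} :=
    (hS.subset Set.sdiff_subset).isClosed.isOpen_compl.mem_nhds fun h => h.2 rfl
  filter_upwards [(tendsto_sub_coe t).eventually h, eventually_nhdsGT_pos_lt 1 one_pos]
    with s h1 h2 h3
  exact h1 ⟨h3, sub_coe_ne h2.1 h2.2⟩

/-- A noncrossing labeling of the circle: `A t` is the label of the interval starting at `t`, and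
`B t` the label of the interval ending at `t`. -/
structure CircleLabeling (n : ℕ) where
  A : UnitAddCircle → Fin n
  B : UnitAddCircle → Fin n
  right : ∀ t, ∀ᶠ s : ℝ in 𝓝[>] 0,
    A (t + (s : UnitAddCircle)) = A t ∧ B (t + (s : UnitAddCircle)) = A t
  left : ∀ t, ∀ᶠ s : ℝ in 𝓝[>] 0,
    A (t - (s : UnitAddCircle)) = B t ∧ B (t - (s : UnitAddCircle)) = B t
  visit : ∀ k, ∃ t, A t = k
  noncrossing : ∀ p q p' q', A p = A p' → A q = A q' → q ∈ Set.cIoo p p' → q' ∈ Set.cIoo p' p →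
    A p = A q

namespace CircleLabeling

variable {n : ℕ} (L : CircleLabeling n)

/-- The open intervals with label `k`. -/
def region (k : Fin n) : Set UnitAddCircle := {t | L.A t = k ∧ L.B t = k}

lemma isOpen_region (k : Fin n) : IsOpen (L.region k) := by
  rw [isOpen_iff_mem_nhds]
  intro t ht
  refine eventually_nhds_circle (P := fun x => x ∈ L.region k) ht ?_ ?_
  · filter_upwards [L.right t] with s h
    exact ⟨h.1.trans ht.1, h.2.trans ht.1⟩
  · filter_upwards [L.left t] with s h
    exact ⟨h.1.trans ht.2, h.2.trans ht.2⟩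

lemma eventually_right_mem (t : UnitAddCircle) :
    ∀ᶠ s : ℝ in 𝓝[>] 0, t + (s : UnitAddCircle) ∈ L.region (L.A t) := L.right t

lemma eventually_left_mem (t : UnitAddCircle) :
    ∀ᶠ s : ℝ in 𝓝[>] 0, t - (s : UnitAddCircle) ∈ L.region (L.B t) := L.left t

lemma eventually_left_not_mem {t : UnitAddCircle} {k : Fin n} (h : L.B t ≠ k) :
    ∀ᶠ s : ℝ in 𝓝[>] 0, t - (s : UnitAddCircle) ∉ L.region k := by
  filter_upwards [L.left t] with s h1 h2
  exact h (h1.1.symm.trans h2.1)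

lemma volume_region_pos (k : Fin n) : 0 < volume.real (L.region k) := by
  obtain ⟨t, rfl⟩ := L.visit k
  obtain ⟨s, hs⟩ := (L.eventually_right_mem t).exists
  have := (L.isOpen_region _).measure_pos volume ⟨_, hs⟩
  exact ENNReal.toReal_pos this.ne' (measure_ne_top _ _)

lemma volume_region_ne (k : Fin n) : volume.real (L.region k) ≠ 0 := (L.volume_region_pos k).ne'

lemma finite_jumps : {t | L.A t ≠ L.B t}.Finite :=
  finite_of_isolated (fun t => (L.right t).mono fun _ h h' => h' (h.1.trans h.2.symm))
    (fun t => (L.left t).mono fun _ h h' => h' (h.1.trans h.2.symm))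

lemma sum_volume_region : ∑ k, volume.real (L.region k) = 1 := by
  rw [← measureReal_biUnion_finset]
  · have h : (Set.univ : Set UnitAddCircle) ⊆
        (⋃ k ∈ (Finset.univ : Finset (Fin n)), L.region k) ∪ {t | L.A t ≠ L.B t} := by
      intro t _
      by_cases h : L.A t = L.B t
      · exact Or.inl (Set.mem_iUnion₂.2 ⟨L.A t, Finset.mem_univ _, rfl, h.symm⟩)
      · exact Or.inr h
    have h1 := (measureReal_mono (μ := (volume : Measure UnitAddCircle)) h).trans
      (measureReal_union_le _ _)
    rw [volume_real_univ_circle, Measure.real, Measure.real,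
      volume_real_finite L.finite_jumps, ENNReal.toReal_zero, add_zero] at h1
    exact le_antisymm
      ((measureReal_mono (Set.subset_univ _)).trans volume_real_univ_circle.le) h1
  · intro i _ j _ hij
    exact Set.disjoint_left.2 fun x h1 h2 => hij (h1.1.symm.trans h2.1)
  · exact fun i _ => (L.isOpen_region i).measurableSet

/-- If both arcs between `p` and `p'` contained points labeled `k`, such points and `p, p'` would
alternate with different labels. -/
lemma pinch_eq_zero_of_A_eq {k : Fin n} {p p' : UnitAddCircle} (h : L.A p = L.A p')
    (hk : L.A p ≠ k) : pinch (L.region k) p p' = 0 := by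
  by_cases hpp : p = p'
  · rw [hpp, pinch_self]
  rw [pinch_eq_zero_iff_of_ne (L.volume_region_ne k) hpp]
  by_contra! hcon
  obtain ⟨q, hq, hqk⟩ := exists_mem_of_arcVol_ne_zero hcon.1
  obtain ⟨q', hq', hqk'⟩ := exists_mem_of_arcVol_ne_zero hcon.2
  exact hk ((L.noncrossing p q p' q' h (hqk.1.trans hqk'.1.symm) hq hq').trans hqk.1)

/-- The boundary trace given by a noncrossing labeling and the marked points `z k`. -/
def toTrace (z : Fin n → UnitAddCircle) : BoundaryTrace n where
  size k := volume.real (L.region k)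
  φ t := (L.A t, pinch (L.region (L.A t)) (z (L.A t)) t)
  ψ t := (L.B t, pinch (L.region (L.B t)) (z (L.B t)) t)
  -- Another lobe is contracted to the image of any time at which it is visited; by
  -- `pinch_eq_zero_of_A_eq` the choice does not matter.
  ρ k x := if x.1 = k then x.2 else pinch (L.region k) (z k) (L.visit x.1).choose
  size_pos := L.volume_region_pos
  sum_size := L.sum_volume_region
  right t := by
    filter_upwards [L.right t, eventually_pinch_add_eq (L.eventually_right_mem t)] with s h1 h2
    rw [h1.1, lobeShift, ← h2, pinch_add (L.volume_region_ne _)]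
  left t := by
    filter_upwards [L.left t, eventually_pinch_sub_eq (L.eventually_left_mem t)] with s h1 h2
    rw [h1.1, lobeShift, neg_div, AddCircle.coe_neg, ← h2, ← sub_eq_add_neg]
    exact Prod.ext rfl (eq_sub_iff_add_eq.2 (pinch_add (L.volume_region_ne _) _ _ _))
  ρ_self k s := by simp
  ρ_const k j s s' h := by simp [h]
  ρ_glue k t := by
    have hA : (if L.A t = k then pinch (L.region (L.A t)) (z (L.A t)) t else
        pinch (L.region k) (z k) (L.visit (L.A t)).choose) = pinch (L.region k) (z k) t := by
      split_ifs with h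
      · rw [h]
      · have h1 := L.pinch_eq_zero_of_A_eq (k := k) (L.visit (L.A t)).choose_spec
          (by rw [(L.visit (L.A t)).choose_spec]; exact h)
        rw [← pinch_add (L.volume_region_ne k) (z k) _ t, h1, add_zero]
    have hB : (if L.B t = k then pinch (L.region (L.B t)) (z (L.B t)) t else
        pinch (L.region k) (z k) (L.visit (L.B t)).choose) = pinch (L.region k) (z k) t := by
      split_ifs with h
      · rw [h]
      -- Noncrossing is stated in terms of labels after a point, so a label before `t` is examined
      -- at the earlier time `t - s`; no part of the region `k` is passed in between.
      · obtain ⟨s, h1, h2⟩ := ((L.left t).and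
          (eventually_pinch_sub_eq_zero (L.eventually_left_not_mem h))).exists
        have h3 := L.pinch_eq_zero_of_A_eq (k := k)
          ((L.visit (L.B t)).choose_spec.trans h1.1.symm)
          (by rw [(L.visit (L.B t)).choose_spec]; exact h)
        rw [← pinch_add (L.volume_region_ne k) (z k) (L.visit (L.B t)).choose t,
          ← pinch_add (L.volume_region_ne k) _ (t - (s : UnitAddCircle)) t, h2, h3, add_zero,
          add_zero]
    exact hA.trans hB.symm
  visit := L.visit

lemma toTrace_region (z : Fin n → UnitAddCircle) (k : Fin n) :
    (L.toTrace z).region k = L.region k := rfl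

lemma toTrace_f (z : Fin n → UnitAddCircle) (k : Fin n) (t : UnitAddCircle) :
    (L.toTrace z).f k t = pinch (L.region k) (z k) t := by
  obtain ⟨t', h1, h2⟩ := (L.toTrace z).exists_φ_of_f_eq k (z k)
  have h3 := (L.toTrace z).f_φ t'
  rw [h2] at h3
  have h4 : ((L.toTrace z).φ t').2 = pinch (L.region (L.A t')) (z (L.A t')) t' := rfl
  have h5 : L.A t' = k := h2
  rw [h4, h5] at h3
  have h6 := (L.toTrace z).f_sub_f k t' t
  rw [h3, toTrace_region, sub_eq_iff_eq_add, add_comm, pinch_add (L.volume_region_ne k)] at h6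
  exact h6

end CircleLabeling

/-! # Chord diagrams -/

/-- If `a` separates the pair `q, q'` from the pair `p, p'` while `b` separates each pair
internally, then all four combinations of sides occur, which for chords means that they cross. -/
lemma not_crossing_of_sides {Q : Type*} (a b : Q → Prop)
    (hside : ∀ q₁ q₂ q₃ q₄, a q₁ → b q₁ → a q₂ → ¬ b q₂ → ¬ a q₃ → b q₃ → ¬ a q₄ → ¬ b q₄ → False)
    {q q' p p' : Q} (h1 : a q ↔ a q') (h2 : a p ↔ a p') (h3 : ¬ (a q ↔ a p)) (h4 : ¬ (b q ↔ b q'))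
    (h5 : ¬ (b p ↔ b p')) : False := by
  obtain ⟨x, x', hx, hx', hb, hb'⟩ : ∃ x x', a x ∧ a x' ∧ b x ∧ ¬ b x' := by
    by_cases s : a q
    · by_cases t : b q
      · exact ⟨q, q', s, h1.1 s, t, fun t' => h4 (iff_of_true t t')⟩
      · exact ⟨q', q, h1.1 s, s, by_contra fun t' => h4 (iff_of_false t t'), t⟩
    · have s' : a p := by_contra fun s' => h3 (iff_of_false s s')
      by_cases t : b p
      · exact ⟨p, p', s', h2.1 s', t, fun t' => h5 (iff_of_true t t')⟩
      · exact ⟨p', p, h2.1 s', s', by_contra fun t' => h5 (iff_of_false t t'), t⟩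
  obtain ⟨y, y', hy, hy', hc, hc'⟩ : ∃ y y', ¬ a y ∧ ¬ a y' ∧ b y ∧ ¬ b y' := by
    by_cases s : a q
    · have s' : ¬ a p := fun s' => h3 (iff_of_true s s')
      by_cases t : b p
      · exact ⟨p, p', s', fun s => s' (h2.2 s), t, fun t' => h5 (iff_of_true t t')⟩
      · exact ⟨p', p, fun s => s' (h2.2 s), s', by_contra fun t' => h5 (iff_of_false t t'), t⟩
    · by_cases t : b q
      · exact ⟨q, q', s, fun s' => s (h1.2 s'), t, fun t' => h4 (iff_of_true t t')⟩
      · exact ⟨q', q, fun s' => s (h1.2 s'), s, by_contra fun t' => h4 (iff_of_false t t'), t⟩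
  exact hside x x' y y' hx hb hx' hb' hy hc hy' hc'

/-- Pairwise noncrossing chords separate a set into at most one more class than there are
chords. -/
lemma card_le_of_separated {Q J : Type*} (side : Q → J → Prop)
    (hside : ∀ h j, h ≠ j → ∀ q₁ q₂ q₃ q₄, side q₁ h → side q₁ j → side q₂ h → ¬ side q₂ j →
      ¬ side q₃ h → side q₃ j → ¬ side q₄ h → ¬ side q₄ j → False) (F : Finset J) :
    ∀ S : Finset Q, (∀ q ∈ S, ∀ q' ∈ S, q ≠ q' → ∃ j ∈ F, ¬ (side q j ↔ side q' j)) →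
      S.card ≤ F.card + 1 := by
  classical
  induction F using Finset.induction_on with
  | empty =>
    intro S hS
    rw [Finset.card_empty, zero_add, Finset.card_le_one]
    intro q hq q' hq'
    by_contra hne
    obtain ⟨j, hj, -⟩ := hS q hq q' hq' hne
    simp at hj
  | insert j F hj ih =>
    intro S hS
    rw [Finset.card_insert_of_notMem hj]
    -- If two points of `S` are separated by the new chord `j` only, one of them is removed; the
    -- claim is that the chords of `F` separate all the remaining points.
    by_cases hex : ∃ q ∈ S, ∃ q' ∈ S, q ≠ q' ∧ ∀ h ∈ F, (side q h ↔ side q' h)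
    · obtain ⟨q, hq, q', hq', hne, hqq⟩ := hex
      have hjq : ¬ (side q j ↔ side q' j) := by
        obtain ⟨h, hh, hs⟩ := hS q hq q' hq' hne
        rcases Finset.mem_insert.1 hh with rfl | hh
        · exact hs
        · exact absurd (hqq h hh) hs
      have := ih (S.erase q) (fun p hp p' hp' hpp => by
        rw [Finset.mem_erase] at hp hp'
        by_contra! hcon
        have hjp : ¬ (side p j ↔ side p' j) := by
          obtain ⟨h, hh, hs⟩ := hS p hp.2 p' hp'.2 hpp
          rcases Finset.mem_insert.1 hh with rfl | hh
          · exact hs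
          · exact absurd (hcon h hh) hs
        -- If the chords of `F` do not tell `q` from `p` either, then `q, p, p'` would lie pairwise
        -- on different sides of `j`. Otherwise some chord `h` of `F` separates `{q, q'}` from `{p,
        -- p'}` and so crosses `j`.
        by_cases hqp : ∀ h ∈ F, (side q h ↔ side p h)
        · have h1 : ∀ x ∈ S, q ≠ x → (∀ h ∈ F, (side q h ↔ side x h)) →
              ¬ (side q j ↔ side x j) := fun x hx hqx hall => by
            obtain ⟨h, hh, hs⟩ := hS q hq x hx hqx
            rcases Finset.mem_insert.1 hh with rfl | hh
            · exact hs
            · exact absurd (hall h hh) hs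
          have h2 := h1 p hp.2 (Ne.symm hp.1) hqp
          have h3 := h1 p' hp'.2 (Ne.symm hp'.1) fun h hh => (hqp h hh).trans (hcon h hh)
          by_cases s : side q j
          · exact hjp (iff_of_false (fun h => h2 (iff_of_true s h)) fun h => h3 (iff_of_true s h))
          · exact hjp (iff_of_true (by_contra fun h => h2 (iff_of_false s h))
              (by_contra fun h => h3 (iff_of_false s h)))
        · push Not at hqp
          obtain ⟨h, hh, hs⟩ := hqp
          have hhj : h ≠ j := by rintro rfl; exact hj hh
          exact not_crossing_of_sides (fun q => side q h) (fun q => side q j) (hside h j hhj)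
            (hqq h hh) (hcon h hh) (fun hiff => by
              rcases hs with hs | hs
              exacts [hs.2 (hiff.1 hs.1), hs.1 (hiff.2 hs.2)]) hjq hjp)
      rw [Finset.card_erase_of_mem hq] at this
      omega
    · push Not at hex
      have := ih S fun q hq q' hq' hne => by
        obtain ⟨h, hh, hs⟩ := hex q hq q' hq' hne
        refine ⟨h, hh, fun hiff => ?_⟩
        rcases hs with hs | hs
        · exact hs.2 (hiff.1 hs.1)
        · exact hs.1 (hiff.2 hs.2)
      omega

lemma mem_cIoo_of_no_endpoint {p r x x' y z : UnitAddCircle} (hx : x ∈ Set.cIoo p r)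
    (hx' : x' ∈ Set.cIoo p r) (hy : y ∉ Set.cIoo p r) (hz : z ∉ Set.cIoo p r)
    (h : x ∈ Set.cIoo y z) : x' ∈ Set.cIoo y z := by
  rw [mem_cIoo_iff] at hx hx' hy hz
  rw [mem_cIoo_iff_ccw p] at h ⊢
  have := ccw_nonneg (y - p)
  have := ccw_nonneg (z - p)
  grind

/-- If two chords cross, the end points alternate. -/
lemma exists_endpoints_of_crossing {x y x' y' q₁ q₂ q₃ q₄ : UnitAddCircle}
    (h1 : q₁ ∈ Set.cIoo x y) (h1' : q₁ ∈ Set.cIoo x' y') (h2 : q₂ ∈ Set.cIoo x y)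
    (h2' : q₂ ∈ Set.cIoo y' x') (h3 : q₃ ∈ Set.cIoo y x) (h3' : q₃ ∈ Set.cIoo x' y')
    (h4 : q₄ ∈ Set.cIoo y x) (h4' : q₄ ∈ Set.cIoo y' x') :
    (x' ∈ Set.cIoo x y ∧ y' ∈ Set.cIoo y x) ∨ (y' ∈ Set.cIoo x y ∧ x' ∈ Set.cIoo y x) := by
  simp only [mem_cIoo_iff_ccw x, sub_self, ccw_zero] at *
  have := ccw_nonneg (y - x)
  have := ccw_nonneg (x' - x)
  have := ccw_nonneg (y' - x)
  have := ccw_nonneg (q₁ - x)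
  have := ccw_nonneg (q₂ - x)
  have := ccw_nonneg (q₃ - x)
  have := ccw_nonneg (q₄ - x)
  generalize ccw (y - x) = a at *
  generalize ccw (x' - x) = b at *
  generalize ccw (y' - x) = c at *
  generalize ccw (q₁ - x) = d1 at *
  generalize ccw (q₂ - x) = d2 at *
  generalize ccw (q₃ - x) = d3 at *
  generalize ccw (q₄ - x) = d4 at *
  grind

/-- Crossing of chords is a symmetric relation. -/
lemma crossing_symm {x y x' y' : UnitAddCircle} (h : x' ∈ Set.cIoo x y) (h' : y' ∈ Set.cIoo y x) :
    x ∈ Set.cIoo y' x' ∧ y ∈ Set.cIoo x' y' := by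
  simp only [mem_cIoo_iff_ccw x, sub_self, ccw_zero] at *
  have := ccw_nonneg (y - x)
  have := ccw_nonneg (x' - x)
  have := ccw_nonneg (y' - x)
  grind

namespace ChordDiagram

variable {n : ℕ} (c : ChordDiagram n)

lemma pt_ne (j : Fin (n - 1)) (b : Bool) : c.pt j b ≠ c.pt j (!b) := by
  cases b
  · exact c.ne j
  · exact (c.ne j).symm

lemma finite_vertices : c.vertices.Finite := by
  have : c.vertices = Set.range fun x : Fin (n - 1) × Bool => c.pt x.1 x.2 := by
    ext p; simp [vertices, eq_comm]
  rw [this]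
  exact Set.finite_range _

lemma pt_mem_vertices (j : Fin (n - 1)) (b : Bool) : c.pt j b ∈ c.vertices := ⟨j, b, rfl⟩

lemma ne_pt {p : UnitAddCircle} (hp : p ∉ c.vertices) (j : Fin (n - 1)) (b : Bool) :
    p ≠ c.pt j b := fun h => hp ⟨j, b, h⟩

lemma isOpen_region (k : Fin n) : IsOpen (c.region k) := by
  have : c.region k = ⋂ x : {x : Fin (n - 1) × Bool // c.lab x.1 x.2 = k},
      chordArc c.pt x.1.1 x.1.2 := by
    ext p
    simp [region, openRegion]
  rw [this]
  exact isOpen_iInter_of_finite fun x => isOpen_cIoo _ _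

lemma region_subset {j : Fin (n - 1)} {b : Bool} {k : Fin n} (h : c.lab j b = k) {p : UnitAddCircle}
    (hp : p ∈ c.region k) : p ∈ chordArc c.pt j b := hp j b h

lemma mem_chordArc_or {p : UnitAddCircle} (hp : p ∉ c.vertices) (j : Fin (n - 1)) (b : Bool) :
    p ∈ chordArc c.pt j b ∨ p ∈ chordArc c.pt j (!b) := by
  have := mem_cIoo_or (c.ne_pt hp j b) (c.ne_pt hp j (!b)) (c.pt_ne j b)
  simpa only [chordArc, Bool.not_not] using this

lemma not_mem_chordArc_not {p : UnitAddCircle} {j : Fin (n - 1)} {b : Bool}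
    (hp : p ∈ chordArc c.pt j b) : p ∉ chordArc c.pt j (!b) := by
  have := Set.disjoint_left.1 (disjoint_cIoo (c.pt j b) (c.pt j (!b))) hp
  simpa only [chordArc, Bool.not_not] using this

lemma exists_mem_region (k : Fin n) : ∃ p ∈ c.region k, p ∉ c.vertices := by
  by_contra! h
  have h1 : volume (c.region k) = 0 :=
    measure_mono_null h (volume_real_finite c.finite_vertices)
  exact (c.region_pos k).ne' h1

lemma existsUnique_mem {p : UnitAddCircle} (hp : p ∉ c.vertices) : ∃! k, p ∈ c.region k :=
  c.existsUnique_region p (c.ne_pt hp)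

/-- Different regions are separated by a chord. -/
lemma exists_separating {k : Fin n} {q : UnitAddCircle} (hq : q ∉ c.vertices)
    (hqk : q ∉ c.region k) : ∃ j b, c.lab j b = k ∧ q ∈ chordArc c.pt j (!b) := by
  simp only [region, openRegion, Set.mem_ofPred_eq, not_forall] at hqk
  obtain ⟨j, b, h, h'⟩ := hqk
  exact ⟨j, b, h, (c.mem_chordArc_or hq j b).resolve_left h'⟩

/-- A chord does not separate a region. -/
lemma same_side_of_not_vertex {j : Fin (n - 1)} {b : Bool} {k : Fin n} {p q : UnitAddCircle}
    (hp : p ∈ c.region k) (hq : q ∈ c.region k) (hp' : p ∉ c.vertices) (hq' : q ∉ c.vertices)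
    (h : p ∈ chordArc c.pt j b) : q ∈ chordArc c.pt j b := by
  classical
  by_contra hcon
  have hqj : q ∈ chordArc c.pt j (!b) := (c.mem_chordArc_or hq' j b).resolve_left hcon
  choose rep hrep hrep' using c.exists_mem_region
  let side : {p // p ∉ c.vertices} → Fin (n - 1) → Prop := fun p j => p.1 ∈ chordArc c.pt j false
  have hside : ∀ (p : {p // p ∉ c.vertices}) j, p.1 ∈ chordArc c.pt j true ↔ ¬ side p j :=
    fun p j => ⟨fun h => c.not_mem_chordArc_not h,
      fun h => (c.mem_chordArc_or p.2 j false).resolve_left h⟩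
  have hsep : ∀ (x y : {p // p ∉ c.vertices}) (j : Fin (n - 1)) (b : Bool),
      x.1 ∈ chordArc c.pt j b → y.1 ∈ chordArc c.pt j (!b) → ¬ (side x j ↔ side y j) := by
    intro x y j b hx hy
    cases b
    · have := (hside y j).1 hy
      exact fun h => this (h.1 hx)
    · have := (hside x j).1 hx
      exact fun h => this (h.2 hy)
  have hsep' : ∀ (k k' : Fin n) (x y : {p // p ∉ c.vertices}), x.1 ∈ c.region k →
      y.1 ∈ c.region k' → k ≠ k' → ∃ j ∈ Finset.univ, ¬ (side x j ↔ side y j) := by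
    intro k k' x y hx hy hne
    obtain ⟨j, b, h1, h2⟩ := c.exists_separating y.2
      (fun h => hne ((c.existsUnique_mem y.2).unique h hy))
    exact ⟨j, Finset.mem_univ _, hsep x y j b (c.region_subset h1 hx) h2⟩
  -- One point from each of the `n` regions, with `p` representing the region `k`, together with the
  -- extra point `q` gives `n + 1` points pairwise separated by `n - 1` chords, one too many.
  let g : Option (Fin n) → {p // p ∉ c.vertices} := fun o => match o with
    | none => ⟨q, hq'⟩
    | some k' => if k' = k then ⟨p, hp'⟩ else ⟨rep k', hrep' k'⟩
  have hg : ∀ k', (g (some k')).1 ∈ c.region k' := by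
    intro k'
    simp only [g]
    split_ifs with h
    · rw [h]; exact hp
    · exact hrep k'
  have hgsep : ∀ o o', o ≠ o' → ∃ j ∈ Finset.univ, ¬ (side (g o) j ↔ side (g o') j) := by
    have h0 : ∀ k', ∃ j ∈ Finset.univ, ¬ (side (g none) j ↔ side (g (some k')) j) := fun k' => by
      by_cases hk : k' = k
      · refine ⟨j, Finset.mem_univ _, fun h' => hsep (g (some k')) (g none) j b ?_ hqj h'.symm⟩
        simp only [g, if_pos hk]
        exact h
      · exact hsep' k k' _ _ hq (hg k') (Ne.symm hk)
    rintro (_ | k₁) (_ | k₂) hne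
    · exact absurd rfl hne
    · exact h0 k₂
    · obtain ⟨j, hj, h⟩ := h0 k₁
      exact ⟨j, hj, fun h' => h h'.symm⟩
    · exact hsep' k₁ k₂ _ _ (hg k₁) (hg k₂) (fun h => hne (by rw [h]))
  have hginj : Function.Injective g := fun o o' h => by
    by_contra hne
    obtain ⟨j, -, hj⟩ := hgsep o o' hne
    exact hj (by rw [h])
  have hcard := card_le_of_separated side (fun h j _ q₁ q₂ q₃ q₄ a1 a2 a3 a4 a5 a6 a7 a8 => by
    rw [← hside] at a4 a5 a7 a8
    rcases exists_endpoints_of_crossing a1 a2 a3 a4 a5 a6 a7 a8 with h' | h'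
    · exact c.flat h j false h'
    · exact c.flat h j true h') Finset.univ (Finset.univ.image g) (by
    intro x hx y hy hxy
    obtain ⟨o, -, rfl⟩ := Finset.mem_image.1 hx
    obtain ⟨o', -, rfl⟩ := Finset.mem_image.1 hy
    exact hgsep o o' fun h => hxy (by rw [h]))
  rw [Finset.card_image_of_injective _ hginj] at hcard
  simp only [Finset.card_univ, Fintype.card_option, Fintype.card_fin] at hcard
  have := k.pos
  omega

lemma eventually_add_not_vertex (t : UnitAddCircle) :
    ∀ᶠ s : ℝ in 𝓝[>] 0, t + (s : UnitAddCircle) ∉ c.vertices :=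
  eventually_add_not_mem_finite c.finite_vertices t

lemma eventually_sub_not_vertex (t : UnitAddCircle) :
    ∀ᶠ s : ℝ in 𝓝[>] 0, t - (s : UnitAddCircle) ∉ c.vertices :=
  eventually_sub_not_mem_finite c.finite_vertices t

lemma eventually_add_mem_chordArc (j : Fin (n - 1)) (b : Bool) :
    ∀ᶠ s : ℝ in 𝓝[>] 0, c.pt j b + (s : UnitAddCircle) ∈ chordArc c.pt j b :=
  eventually_add_mem_cIoo (c.pt_ne j b)

lemma eventually_sub_mem_chordArc (j : Fin (n - 1)) (b : Bool) :
    ∀ᶠ s : ℝ in 𝓝[>] 0, c.pt j b - (s : UnitAddCircle) ∈ chordArc c.pt j (!b) := by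
  have := eventually_sub_mem_cIoo (c.pt_ne j b).symm
  simpa only [chordArc, Bool.not_not] using this

/-- The intervals on the two sides of a vertex have different labels. -/
lemma labels_ne (j : Fin (n - 1)) (b : Bool) {k : Fin n}
    (h1 : ∀ᶠ s : ℝ in 𝓝[>] 0, c.pt j b + (s : UnitAddCircle) ∈ c.region k)
    (h2 : ∀ᶠ s : ℝ in 𝓝[>] 0, c.pt j b - (s : UnitAddCircle) ∈ c.region k) : False := by
  obtain ⟨s, a1, a2, a3, a4, a5, a6⟩ := (h1.and (h2.and ((c.eventually_add_not_vertex _).and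
    ((c.eventually_sub_not_vertex _).and ((c.eventually_add_mem_chordArc j b).and
    (c.eventually_sub_mem_chordArc j b)))))).exists
  exact c.not_mem_chordArc_not (c.same_side_of_not_vertex a1 a2 a3 a4 a5) a6

/-- Regions are open, so a vertex in a region would have the same label on both sides. -/
lemma not_vertex_of_mem_region {k : Fin n} {p : UnitAddCircle} (hp : p ∈ c.region k) :
    p ∉ c.vertices := by
  rintro ⟨j, b, rfl⟩
  have h := (c.isOpen_region k).mem_nhds hp
  exact c.labels_ne j b (tendsto_add_coe _ h) (tendsto_sub_coe _ h)

lemma region_disjoint {k k' : Fin n} {p : UnitAddCircle} (h : p ∈ c.region k)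
    (h' : p ∈ c.region k') : k = k' :=
  (c.existsUnique_mem (c.not_vertex_of_mem_region h)).unique h h'

lemma same_side {j : Fin (n - 1)} {b : Bool} {k : Fin n} {p q : UnitAddCircle}
    (hp : p ∈ c.region k) (hq : q ∈ c.region k) (h : p ∈ chordArc c.pt j b) :
    q ∈ chordArc c.pt j b :=
  c.same_side_of_not_vertex hp hq (c.not_vertex_of_mem_region hp) (c.not_vertex_of_mem_region hq) h

lemma mem_region_of_no_vertex {p r x x' : UnitAddCircle} (h : ∀ v ∈ Set.cIoo p r, v ∉ c.vertices)
    (hx : x ∈ Set.cIoo p r) (hx' : x' ∈ Set.cIoo p r) {k : Fin n} (hk : x ∈ c.region k) :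
    x' ∈ c.region k := fun j b hj =>
  mem_cIoo_of_no_endpoint hx hx' (fun hv => h _ hv (c.pt_mem_vertices _ _))
    (fun hv => h _ hv (c.pt_mem_vertices _ _)) (hk j b hj)

lemma exists_labelAfter (p : UnitAddCircle) : ∃ k, c.LabelAfter p k := by
  obtain ⟨s, h1, h2, h3⟩ := ((eventually_forall_cIoo_add (P := fun x => x ∉ c.vertices)
    (c.eventually_add_not_vertex p)).and ((eventually_nhdsGT_pos_lt 1 one_pos).and
    (eventually_forall_cIoo_add (P := fun x => x ∉ c.vertices)
    (c.eventually_add_not_vertex p)))).exists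
  have hx : p + ((s / 2 : ℝ) : UnitAddCircle) ∈ Set.cIoo p (p + (s : UnitAddCircle)) :=
    add_small_mem_cIoo (by linarith) (by linarith) h2.2
  obtain ⟨k, hk, -⟩ := c.existsUnique_mem (h1 _ hx)
  refine ⟨k, ?_⟩
  filter_upwards [eventually_nhdsGT_pos_lt s h2.1] with s' hs'
  exact c.mem_region_of_no_vertex h1 hx (add_small_mem_cIoo hs'.1 hs'.2 h2.2) hk

lemma exists_labelBefore (p : UnitAddCircle) : ∃ k, c.LabelBefore p k := by
  obtain ⟨s, h1, h2⟩ := ((eventually_forall_cIoo_sub (P := fun x => x ∉ c.vertices)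
    (c.eventually_sub_not_vertex p)).and (eventually_nhdsGT_pos_lt 1 one_pos)).exists
  have hmem : ∀ s', 0 < s' → s' < s →
      p - (s' : UnitAddCircle) ∈ Set.cIoo (p - (s : UnitAddCircle)) p := by
    intro s' h3 h4
    have := add_small_mem_cIoo (p := p - (s : UnitAddCircle)) (s := s - s') (u := s)
      (by linarith) (by linarith) h2.2
    have e : p - (s : UnitAddCircle) + ((s - s' : ℝ) : UnitAddCircle) = p - s' := by
      rw [AddCircle.coe_sub]; abel
    rwa [sub_add_cancel, e] at this
  have hx := hmem (s / 2) (by linarith) (by linarith)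
  obtain ⟨k, hk, -⟩ := c.existsUnique_mem (h1 _ hx)
  refine ⟨k, ?_⟩
  filter_upwards [eventually_nhdsGT_pos_lt s h2.1] with s' hs'
  exact c.mem_region_of_no_vertex h1 hx (hmem s' hs'.1 hs'.2) hk

/-- The label of the interval starting at `p`. -/
def after (p : UnitAddCircle) : Fin n := (c.exists_labelAfter p).choose

/-- The label of the interval ending at `p`. -/
def before (p : UnitAddCircle) : Fin n := (c.exists_labelBefore p).choose

lemma labelAfter_after (p : UnitAddCircle) : c.LabelAfter p (c.after p) :=
  (c.exists_labelAfter p).choose_spec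

lemma labelBefore_before (p : UnitAddCircle) : c.LabelBefore p (c.before p) :=
  (c.exists_labelBefore p).choose_spec

lemma LabelAfter.eq_after {c : ChordDiagram n} {p : UnitAddCircle} {k : Fin n}
    (h : c.LabelAfter p k) : c.after p = k := by
  obtain ⟨s, h1, h2⟩ := (h.and (c.labelAfter_after p)).exists
  exact c.region_disjoint h2 h1

lemma LabelBefore.eq_before {c : ChordDiagram n} {p : UnitAddCircle} {k : Fin n}
    (h : c.LabelBefore p k) : c.before p = k := by
  obtain ⟨s, h1, h2⟩ := (h.and (c.labelBefore_before p)).exists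
  exact c.region_disjoint h2 h1

lemma after_eq_of_mem {p : UnitAddCircle} {k : Fin n} (hp : p ∈ c.region k) : c.after p = k :=
  LabelAfter.eq_after (tendsto_add_coe p ((c.isOpen_region k).mem_nhds hp))

lemma before_eq_of_mem {p : UnitAddCircle} {k : Fin n} (hp : p ∈ c.region k) : c.before p = k :=
  LabelBefore.eq_before (tendsto_sub_coe p ((c.isOpen_region k).mem_nhds hp))

lemma after_ne_before {p : UnitAddCircle} (hp : p ∈ c.vertices) : c.after p ≠ c.before p := by
  obtain ⟨j, b, rfl⟩ := hp
  intro h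
  refine c.labels_ne j b (c.labelAfter_after _) ?_
  rw [h]
  exact c.labelBefore_before _

lemma mem_region_iff {p : UnitAddCircle} {k : Fin n} :
    p ∈ c.region k ↔ c.after p = k ∧ c.before p = k := by
  refine ⟨fun h => ⟨c.after_eq_of_mem h, c.before_eq_of_mem h⟩, fun h => ?_⟩
  have hp : p ∉ c.vertices := fun hp => c.after_ne_before hp (h.1.trans h.2.symm)
  obtain ⟨k', hk', -⟩ := c.existsUnique_mem hp
  have := c.after_eq_of_mem hk'
  rw [← h.1, this]
  exact hk'

lemma not_mem_vertices_iff {p : UnitAddCircle} : p ∉ c.vertices ↔ c.after p = c.before p := by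
  refine ⟨fun hp => ?_, fun h hp => c.after_ne_before hp h⟩
  obtain ⟨k', hk', -⟩ := c.existsUnique_mem hp
  rw [c.after_eq_of_mem hk', c.before_eq_of_mem hk']

/-- The labeling of the circle given by a chord diagram. -/
def labeling : CircleLabeling n where
  A := c.after
  B := c.before
  right t := by
    filter_upwards [c.labelAfter_after t] with s hs
    exact ⟨c.after_eq_of_mem hs, c.before_eq_of_mem hs⟩
  left t := by
    filter_upwards [c.labelBefore_before t] with s hs
    exact ⟨c.after_eq_of_mem hs, c.before_eq_of_mem hs⟩
  visit k := by
    obtain ⟨p, hp, -⟩ := c.exists_mem_region k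
    exact ⟨p, c.after_eq_of_mem hp⟩
  noncrossing p q p' q' h h' hq hq' := by
    by_contra hne
    -- A common small rotation moves all four points into the interior of the intervals that they
    -- start and preserves their cyclic order.
    obtain ⟨s, a1, a2, a3, a4⟩ := ((c.labelAfter_after p).and ((c.labelAfter_after q).and
      ((c.labelAfter_after p').and (c.labelAfter_after q')))).exists
    rw [← h] at a3
    rw [← h'] at a4
    rw [← add_mem_cIoo_add (y := (s : UnitAddCircle))] at hq hq'
    -- A chord separating the two regions would have `p, p'` on one side and `q, q'` on the other,
    -- which is impossible for alternating pairs.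
    obtain ⟨j, b, h1, h2⟩ := c.exists_separating (c.not_vertex_of_mem_region a2)
      (fun h => hne (c.region_disjoint h a2))
    have h3 := c.same_side a2 a4 h2
    have h4 := c.region_subset h1 a1
    have h5 := c.region_subset h1 a3
    simp only [chordArc, Bool.not_not] at h2 h3 h4 h5
    generalize p + (s : UnitAddCircle) = P at *
    generalize q + (s : UnitAddCircle) = Q at *
    generalize p' + (s : UnitAddCircle) = P' at *
    generalize q' + (s : UnitAddCircle) = Q' at *
    rw [mem_cIoo_iff_ccw P] at hq hq' h2 h3 h4 h5
    simp only [sub_self, ccw_zero] at *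
    clear * - hq hq' h2 h3 h4 h5
    have := ccw_nonneg (Q - P)
    have := ccw_nonneg (P' - P)
    have := ccw_nonneg (Q' - P)
    have := ccw_nonneg (c.pt j b - P)
    have := ccw_nonneg (c.pt j (!b) - P)
    generalize ccw (Q - P) = x1 at *
    generalize ccw (P' - P) = x2 at *
    generalize ccw (Q' - P) = x3 at *
    generalize ccw (c.pt j b - P) = x4 at *
    generalize ccw (c.pt j (!b) - P) = x5 at *
    grind

lemma labeling_region (k : Fin n) : c.labeling.region k = c.region k := by
  ext p; exact (c.mem_region_iff).symm

lemma volume_region_ne (k : Fin n) : volume.real (c.region k) ≠ 0 := by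
  rw [← labeling_region]; exact c.labeling.volume_region_ne k

end ChordDiagram

/-! ### From a marked diagram to its cactus -/

namespace MarkedDiagram

variable {n : ℕ} (c : MarkedDiagram n)

lemma lobeMap_eq_pinch (i : Fin n) (p : UnitAddCircle) :
    c.lobeMap i p = pinch (c.toChordDiagram.region i) (c.z i) p := rfl

/-- The boundary trace of the cactus obtained by contracting the chords. -/
def trace : BoundaryTrace n := c.toChordDiagram.labeling.toTrace c.z

lemma trace_f (i : Fin n) (p : UnitAddCircle) : c.trace.f i p = c.lobeMap i p := by
  rw [trace, CircleLabeling.toTrace_f, ChordDiagram.labeling_region]; rfl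

lemma trace_region (i : Fin n) : c.trace.region i = c.toChordDiagram.region i :=
  c.toChordDiagram.labeling_region i

lemma trace_φ (t : UnitAddCircle) : c.trace.φ t = (c.after t, c.lobeMap (c.after t) t) := by
  rw [BoundaryTrace.φ_eq, trace_f]; rfl

lemma trace_ψ (t : UnitAddCircle) : c.trace.ψ t = (c.before t, c.lobeMap (c.before t) t) := by
  rw [BoundaryTrace.ψ_eq, trace_f]; rfl

/-- The cactus obtained by contracting the chords. -/
def toCactus : Cactus n := c.trace.toCactus

lemma toCactus_size (i : Fin n) :
    c.toCactus.size i = volume.real (c.toChordDiagram.region i) := by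
  rw [← labeling_size]; rfl
where labeling_size : volume.real (c.toChordDiagram.labeling.region i) =
    volume.real (c.toChordDiagram.region i) := by rw [ChordDiagram.labeling_region]

lemma toCactus_pinchingMap (i : Fin n) (t : UnitAddCircle) :
    c.toCactus.pinchingMap i t = c.lobeMap i t := by
  rw [toCactus, BoundaryTrace.pinchingMap_apply, trace_f]

lemma isContraction : IsContraction c c.toCactus := by
  refine ⟨c.toCactus_size, fun p i j hi hj => ?_, fun j hj => ?_⟩
  · rw [← hi.eq_before, ← hj.eq_after, ← trace_ψ, ← trace_φ]
    exact c.trace.next_ψ p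
  · rw [← hj.eq_after, ← trace_φ]; rfl

end MarkedDiagram

end

noncomputable section


/-! # Chord diagrams with the same contraction -/

namespace ChordDiagram

variable {n : ℕ} (c : ChordDiagram n)

/-- A region lies on one side of each chord, so one of the two arcs cut off by the chord contributes
no length to the `k`-th loop. -/
lemma pinch_chord (k : Fin n) (j : Fin (n - 1)) (b : Bool) :
    pinch (c.region k) (c.pt j b) (c.pt j (!b)) = 0 := by
  rw [pinch_eq_zero_iff_of_ne (c.volume_region_ne k) (c.pt_ne j b)]
  by_contra! h
  obtain ⟨x, hx, hxk⟩ := exists_mem_of_arcVol_ne_zero h.1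
  obtain ⟨y, hy, hyk⟩ := exists_mem_of_arcVol_ne_zero h.2
  have h1 : y ∈ chordArc c.pt j (!b) := by
    rw [chordArc, Bool.not_not]; exact hy
  exact c.not_mem_chordArc_not (c.same_side hxk hyk hx) h1

lemma exists_chord_of_adj {p q : UnitAddCircle} (h : c.graph.Adj p q) :
    ∃ j b, p = c.pt j b ∧ q = c.pt j (!b) := by
  rw [graph, SimpleGraph.fromRel_adj] at h
  rcases h.2 with ⟨j, h1, h2⟩ | ⟨j, h1, h2⟩
  · exact ⟨j, false, h1, h2⟩
  · exact ⟨j, true, h2, h1⟩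

lemma adj_pt (j : Fin (n - 1)) (b : Bool) : c.graph.Adj (c.pt j b) (c.pt j (!b)) := by
  rw [graph, SimpleGraph.fromRel_adj]
  refine ⟨c.pt_ne j b, ?_⟩
  cases b
  · exact Or.inl ⟨j, rfl, rfl⟩
  · exact Or.inr ⟨j, rfl, rfl⟩

lemma pinch_eq_zero_of_reachable {p q : UnitAddCircle} (h : c.graph.Reachable p q) (k : Fin n) :
    pinch (c.region k) p q = 0 := by
  refine h.induct (Q := fun x => pinch (c.region k) p x = 0) (pinch_self _) fun x y hxy hx => ?_
  obtain ⟨j, b, rfl, rfl⟩ := c.exists_chord_of_adj hxy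
  rw [← pinch_add (c.volume_region_ne k) p (c.pt j b), hx, c.pinch_chord, add_zero]

/-- A chord that is disjoint from a connected set of vertices does not separate it. -/
lemma mem_chordArc_of_reachable {p q : UnitAddCircle} (h : c.graph.Reachable p q)
    {j : Fin (n - 1)} (hj : ∀ b, ¬ c.graph.Reachable p (c.pt j b)) {b : Bool}
    (hp : p ∈ chordArc c.pt j b) : q ∈ chordArc c.pt j b := by
  refine (h.induct (Q := fun x => c.graph.Reachable p x ∧ x ∈ chordArc c.pt j b)
    ⟨SimpleGraph.Reachable.refl _, hp⟩ fun x y hxy hx => ⟨hx.1.trans hxy.reachable, ?_⟩).2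
  by_contra hy
  have hpy := hx.1.trans hxy.reachable
  have hy' : y ∈ chordArc c.pt j (!b) := by
    have := mem_cIoo_or (x := y) (p := c.pt j b) (q := c.pt j (!b))
      (fun e => hj b (e ▸ hpy)) (fun e => hj (!b) (e ▸ hpy))
      (c.pt_ne j b)
    rcases this with h | h
    · exact absurd h hy
    · simpa only [chordArc, Bool.not_not] using h
  obtain ⟨i, b', rfl, rfl⟩ := c.exists_chord_of_adj hxy
  have hx := hx.2
  cases b
  · exact c.flat j i b' ⟨hx, hy'⟩
  · refine c.flat j i (!b') ⟨hy', ?_⟩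
    rw [Bool.not_not]; exact hx

/-- The vertices of a tree that are next to a point outside the tree. -/
lemma exists_consecutive {S : Set UnitAddCircle} (hS : S.Finite) {x y q : UnitAddCircle}
    (hx : x ∈ S) (hy : y ∈ S) (hxy : x ≠ y) (hq : q ∉ S) :
    ∃ a ∈ S, ∃ a' ∈ S, a ≠ a' ∧ q ∈ Set.cIoo a a' ∧ ∀ v ∈ Set.cIoo a a', v ∉ S := by
  -- The point `a` is the last one of `S` before `q` and `a'` the first one after it, in the
  -- counterclockwise direction.
  obtain ⟨a, ha, hamin⟩ := hS.exists_minimalFor (fun v => ccw (q - v)) S ⟨x, hx⟩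
  obtain ⟨a', ha', hamin'⟩ := hS.exists_minimalFor (fun v => ccw (v - q)) S ⟨x, hx⟩
  have h1 : ∀ v ∈ S, ccw (v - q) ≤ ccw (a - q) := fun v hv => by
    have hv0 : v - q ≠ 0 := fun h => hq (sub_eq_zero.1 h ▸ hv)
    have ha0 : a - q ≠ 0 := fun h => hq (sub_eq_zero.1 h ▸ ha)
    have := hamin hv
    simp only [← neg_sub _ q, ccw_neg hv0, ccw_neg ha0] at this
    by_contra! hlt
    have := this (by linarith)
    linarith
  have h2 : ∀ v ∈ S, ccw (a' - q) ≤ ccw (v - q) := fun v hv => by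
    by_contra! hlt
    have := hamin' hv hlt.le
    simp only at this
    linarith
  have h0 : 0 < ccw (a' - q) := ccw_pos.2 fun h => hq (sub_eq_zero.1 h ▸ ha')
  have hne : a ≠ a' := by
    rintro rfl
    have e : ∀ v ∈ S, v = a := fun v hv =>
      ccw_sub_eq_iff.1 (le_antisymm (h1 v hv) (h2 v hv))
    exact hxy ((e x hx).trans (e y hy).symm)
  have hlt : ccw (a' - q) < ccw (a - q) :=
    lt_of_le_of_ne (h2 a ha) fun h => hne (ccw_sub_eq_iff.1 h).symm
  refine ⟨a, ha, a', ha', hne, ?_, fun v hv hvS => ?_⟩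
  · rw [mem_cIoo_iff_ccw q, sub_self, ccw_zero]
    grind
  · rw [mem_cIoo_iff_ccw q] at hv
    have := h1 v hvS
    have := h2 v hvS
    grind

/-- Consecutive vertices of a tree bound an interval that begins and ends on the same region. -/
lemma after_eq_before_of_consecutive {a a' : UnitAddCircle} (h : c.graph.Reachable a a')
    (hne : a ≠ a') (hcons : ∀ v ∈ Set.cIoo a a', ¬ c.graph.Reachable a v) :
    c.after a = c.before a' := by
  -- A chord leaving the arc from `a` to `a'` would not belong to the tree, as its inner end is not
  -- a vertex of the tree, and it would separate `a` from `a'`, which the tree joins.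
  have hcross : ∀ i b, c.pt i b ∈ Set.cIoo a a' → c.pt i (!b) ∉ Set.cIoo a' a := by
    intro i b h1 h2
    have h3 : ¬ c.graph.Reachable a (c.pt i b) := hcons _ h1
    have h4 : ¬ c.graph.Reachable a (c.pt i (!b)) := fun h5 =>
      h3 (h5.trans (c.adj_pt i b).symm.reachable)
    have h5 : ∀ b', ¬ c.graph.Reachable a (c.pt i b') := fun b' => by
      rcases Bool.eq_or_eq_not b' b with rfl | rfl
      exacts [h3, h4]
    obtain ⟨h6, h7⟩ := crossing_symm h1 h2
    have h8 : a ∈ chordArc c.pt i (!b) := by rw [chordArc, Bool.not_not]; exact h6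
    exact c.not_mem_chordArc_not (c.mem_chordArc_of_reachable h h5 h8)
      (by rw [Bool.not_not]; exact h7)
  by_contra hcon
  have hev : ∀ᶠ s : ℝ in 𝓝[>] 0, s < ccw (a' - a) / 2 := by
    have h0 : 0 < ccw (a' - a) := ccw_pos.2 (sub_ne_zero.2 hne.symm)
    exact (eventually_nhdsGT_pos_lt _ (by linarith)).mono fun s hs => hs.2
  obtain ⟨s, h1, h2, h3, h4, h5, h6⟩ := ((c.labelAfter_after a).and ((c.labelBefore_before a').and
    ((eventually_forall_cIoo_add (P := fun x => x ∉ c.vertices) (c.eventually_add_not_vertex a)).and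
    ((eventually_forall_cIoo_sub (P := fun x => x ∉ c.vertices)
      (c.eventually_sub_not_vertex a')).and
    (hev.and (eventually_nhdsGT_pos_lt 1 one_pos)))))).exists
  -- A chord that separates the beginning of the arc from its end has exactly one end point inside.
  -- The other can be neither `a` nor `a'`, since the inner end is not in the tree, nor outside by
  -- `hcross`.
  obtain ⟨j, b, h7, h8⟩ := c.exists_separating (c.not_vertex_of_mem_region h2)
    (fun h => hcon (c.region_disjoint h h2))
  have h9 := c.region_subset h7 h1
  have hn1 : ∀ b, c.pt j b ∉ Set.cIoo a (a + (s : UnitAddCircle)) := fun b hb =>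
    h3 _ hb (c.pt_mem_vertices j b)
  have hn2 : ∀ b, c.pt j b ∉ Set.cIoo (a' - (s : UnitAddCircle)) a' := fun b hb =>
    h4 _ hb (c.pt_mem_vertices j b)
  have hn3 : ∀ b, c.pt j b ≠ a + (s : UnitAddCircle) := fun b hb =>
    c.not_vertex_of_mem_region h1 (hb ▸ c.pt_mem_vertices j b)
  have hn4 : ∀ b, c.pt j b ≠ a' - (s : UnitAddCircle) := fun b hb =>
    c.not_vertex_of_mem_region h2 (hb ▸ c.pt_mem_vertices j b)
  have hn5 : ∀ b, c.pt j b ∈ Set.cIoo a a' → c.pt j (!b) ≠ a ∧ c.pt j (!b) ≠ a' := fun b hb =>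
    ⟨fun e => hcons _ hb (by rw [← e]; exact (c.adj_pt j b).symm.reachable),
      fun e => hcons _ hb (h.trans (by rw [← e]; exact (c.adj_pt j b).symm.reachable))⟩
  have hx1 := hcross j b
  have hx2 := hcross j (!b)
  have hx3 := hn5 b
  have hx4 := hn5 (!b)
  have hy1 := hn1 b
  have hy2 := hn1 (!b)
  have hy3 := hn2 b
  have hy4 := hn2 (!b)
  have hy5 := hn3 b
  have hy6 := hn3 (!b)
  have hy7 := hn4 b
  have hy8 := hn4 (!b)
  simp only [chordArc, Bool.not_not] at h8 h9 hx1 hx2 hx3 hx4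
  have e1 : ccw (a + (s : UnitAddCircle) - a) = s := by
    rw [add_sub_cancel_left, ccw_coe h6.1.le h6.2]
  have e2 : ccw (a' - (s : UnitAddCircle) - a) = ccw (a' - a) - s := by
    rw [sub_right_comm, ccw_sub, ccw_coe h6.1.le h6.2, if_pos (by linarith [h6.1])]
  simp only [ne_eq, ← ccw_sub_eq_iff (p := a)] at hx3 hx4 hy5 hy6 hy7 hy8
  simp only [mem_cIoo_iff_ccw a, sub_self, ccw_zero, e1, e2] at *
  have := ccw_nonneg (c.pt j b - a)
  have := ccw_nonneg (c.pt j (!b) - a)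
  have hs := h6.1
  clear * - this h5 hs h8 h9 hx1 hx2 hx3 hx4 hy1 hy2 hy3 hy4 hy5 hy6 hy7 hy8
  generalize ccw (c.pt j b - a) = x1 at *
  generalize ccw (c.pt j (!b) - a) = x2 at *
  generalize ccw (a' - a) = x3 at *
  grind

/-- If `q` is not joined to `p`, it lies strictly between two consecutive vertices `a, a'` of the
tree of `p`. The region that starts at `a` also ends at `a'`, so it has positive length on both
sides of `q` and its pinching map distinguishes `q` from the tree. -/
lemma reachable_of_pinch {p q : UnitAddCircle} (hp : p ∈ c.vertices)
    (h : ∀ k, pinch (c.region k) p q = 0) :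
    c.graph.Reachable p q := by
  by_contra hpq
  obtain ⟨j, b, rfl⟩ := hp
  obtain ⟨a, ha, a', ha', hne, hqa, hcons⟩ :=
    exists_consecutive (S := {v | v ∈ c.vertices ∧ c.graph.Reachable (c.pt j b) v})
      (c.finite_vertices.subset fun v hv => hv.1)
      ⟨c.pt_mem_vertices j b, SimpleGraph.Reachable.refl _⟩
      ⟨c.pt_mem_vertices j (!b), (c.adj_pt j b).reachable⟩ (c.pt_ne j b) (fun h => hpq h.2)
  have hcons' : ∀ v ∈ Set.cIoo a a', ¬ c.graph.Reachable a v := fun v hv hav => by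
    refine hcons v hv ⟨?_, ha.2.trans hav⟩
    refine hav.induct (Q := fun x => x ∈ c.vertices) ha.1 fun x y hxy _ => ?_
    obtain ⟨i, b', -, rfl⟩ := c.exists_chord_of_adj hxy
    exact c.pt_mem_vertices _ _
  have hk := c.after_eq_before_of_consecutive (ha.2.symm.trans ha'.2) hne hcons'
  have h1 : pinch (c.region (c.after a)) a q = 0 := by
    rw [← pinch_add (c.volume_region_ne _) a (c.pt j b) q, h,
      c.pinch_eq_zero_of_reachable ha.2.symm, add_zero]
  have hqa' := cIoo_rotate.1 (cIoo_rotate.1 hqa)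
  have hne1 : a ≠ q := fun e => left_not_mem_cIoo a a' (by rw [e] at hqa ⊢; exact hqa)
  have hne2 : q ≠ a' := fun e => right_not_mem_cIoo a a' (by rw [← e] at hqa ⊢; exact hqa)
  rw [pinch_eq_zero_iff_of_ne (c.volume_region_ne _) hne1, arcVol_add hqa'] at h1
  have h2 := arcVol_pos_of_right hne1 (c.labelAfter_after a)
  have h3 := arcVol_pos_of_left (R := c.region (c.after a)) hne2
    (by rw [hk]; exact c.labelBefore_before a')
  have h4 := arcVol_nonneg (R := c.region (c.after a)) a' a
  rcases h1 with h1 | h1 <;> linarith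

lemma sameTree_iff {p q : UnitAddCircle} : c.SameTree p q ↔
    p ∈ c.vertices ∧ q ∈ c.vertices ∧ ∀ k, pinch (c.region k) p q = 0 :=
  ⟨fun h => ⟨h.1, h.2.1, c.pinch_eq_zero_of_reachable h.2.2⟩,
    fun h => ⟨h.1, h.2.1, c.reachable_of_pinch h.1 h.2.2⟩⟩

lemma region_subset_closedRegion (k : Fin n) : c.region k ⊆ c.closedRegion k := fun p hp j b h => by
  rw [mem_cIcc_iff_not]
  exact Set.disjoint_left.1 (disjoint_cIoo _ _) (hp j b h)

lemma isClosed_closedRegion (k : Fin n) : IsClosed (c.closedRegion k) := by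
  have : c.closedRegion k = ⋂ j, ⋂ b, ⋂ _ : c.lab j b = k, Set.cIcc (c.pt j b) (c.pt j (!b)) := by
    ext p
    simp only [closedRegion, Set.mem_iInter]
    rfl
  rw [this]
  exact isClosed_iInter fun j => isClosed_iInter fun b => isClosed_iInter fun _ => isClosed_cIcc _ _

lemma mem_closedRegion_of_after {p : UnitAddCircle} {k : Fin n} (h : c.after p = k) :
    p ∈ c.closedRegion k := by
  subst h
  exact (c.isClosed_closedRegion _).mem_of_tendsto (tendsto_add_coe p)
    ((c.labelAfter_after p).mono fun _ h => c.region_subset_closedRegion _ h)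

lemma mem_region_of_mem_closedRegion {p : UnitAddCircle} {k : Fin n} (h : p ∈ c.closedRegion k)
    (hp : p ∉ c.vertices) : p ∈ c.region k := fun j b hj => by
  have h1 := h j b hj
  rw [mem_cIcc_iff_not] at h1
  refine (c.mem_chordArc_or hp j b).resolve_right fun h2 => h1 ?_
  rwa [chordArc, Bool.not_not] at h2

lemma mem_vertices_of_arcVol {p q : UnitAddCircle} {k : Fin n} (h : p ∈ c.closedRegion k)
    (hne : p ≠ q) (h0 : pinch (c.region k) p q = 0) : p ∈ c.vertices := by
  by_contra hp
  have h1 := (c.isOpen_region k).mem_nhds (c.mem_region_of_mem_closedRegion h hp)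
  rw [pinch_eq_zero_iff_of_ne (c.volume_region_ne k) hne] at h0
  have h2 := arcVol_pos_of_right hne (tendsto_add_coe p h1)
  have h3 := arcVol_pos_of_left hne.symm (tendsto_sub_coe p h1)
  rcases h0 with h0 | h0 <;> linarith

/-- Two points of a closed region with the same image in the loop belong to the same tree. -/
lemma sameTree_of_pinch {p q : UnitAddCircle} {k : Fin n} (hp : p ∈ c.closedRegion k)
    (hq : q ∈ c.closedRegion k) (hne : p ≠ q) (h : pinch (c.region k) p q = 0) :
    c.SameTree p q := by
  have h' : pinch (c.region k) q p = 0 := by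
    rw [← pinch_swap (c.volume_region_ne k) p q, h, zero_add]
  refine c.sameTree_iff.2 ⟨c.mem_vertices_of_arcVol hp hne h,
    c.mem_vertices_of_arcVol hq hne.symm h', fun l => ?_⟩
  by_cases hl : l = k
  · rw [hl, h]
  rw [pinch_eq_zero_iff_of_ne (c.volume_region_ne l) hne]
  by_contra! hcon
  obtain ⟨x, hx, hxl⟩ := exists_mem_of_arcVol_ne_zero hcon.1
  obtain ⟨y, hy, hyl⟩ := exists_mem_of_arcVol_ne_zero hcon.2
  -- If a region `l ≠ k` had points on both arcs between `p` and `q`, a chord of the `k`-th region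
  -- would have these points strictly on its far side, while `p` and `q` are in its closed near
  -- side. Alternating pairs do not allow this.
  obtain ⟨j, b, h1, h2⟩ := c.exists_separating (c.not_vertex_of_mem_region hxl)
    (fun h => hl (c.region_disjoint hxl h))
  have h3 := c.same_side hxl hyl h2
  have h4 := hp j b h1
  have h5 := hq j b h1
  rw [mem_cIcc_iff_not] at h4 h5
  rw [chordArc, Bool.not_not] at h2 h3
  simp only [mem_cIoo_iff_ccw p, sub_self, ccw_zero] at *
  have := ccw_nonneg (x - p)
  have := ccw_nonneg (y - p)
  have := ccw_nonneg (q - p)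
  have := ccw_nonneg (c.pt j b - p)
  have := ccw_nonneg (c.pt j (!b) - p)
  generalize ccw (x - p) = x1 at *
  generalize ccw (y - p) = x2 at *
  generalize ccw (q - p) = x3 at *
  generalize ccw (c.pt j b - p) = x4 at *
  generalize ccw (c.pt j (!b) - p) = x5 at *
  grind

lemma after_congr {c c' : ChordDiagram n} (h : ∀ k, c.region k = c'.region k)
    (p : UnitAddCircle) : c.after p = c'.after p :=
  LabelAfter.eq_after (by rw [LabelAfter, h]; exact c'.labelAfter_after p)

end ChordDiagram

/-! ### Equality of contractions and the relations defining `MD` -/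

namespace MarkedDiagram

variable {n : ℕ}

lemma lobeMap_add (c : MarkedDiagram n) (i : Fin n) (p q : UnitAddCircle) :
    c.lobeMap i p + pinch (c.toChordDiagram.region i) p q = c.lobeMap i q :=
  pinch_add (c.volume_region_ne i) _ _ _

lemma lobeMap_z (c : MarkedDiagram n) (i : Fin n) : c.lobeMap i (c.z i) = 0 := pinch_self _

/-- The regions determine the labels along the circle and the lengths of the loops. The marks only
fix where each loop parameter starts, so agreement in the loops suffices. -/
lemma toCactus_eq_of_region {c c' : MarkedDiagram n}
    (h : ∀ k, c.toChordDiagram.region k = c'.toChordDiagram.region k)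
    (hz : ∀ i, c.lobeMap i (c'.z i) = 0) : c.toCactus = c'.toCactus := by
  refine BoundaryTrace.toCactus_eq (fun t => ?_) fun i => ⟨c'.z i, ?_⟩
  · rw [trace_φ, trace_φ]; exact ChordDiagram.after_congr h t
  · rw [trace_f, trace_f, hz, lobeMap_z]

lemma Sim0.toCactus_eq {c c' : MarkedDiagram n} (h : c.Sim0 c') : c.toCactus = c'.toCactus := by
  refine toCactus_eq_of_region (fun k => by rw [h.1]) fun i => ?_
  by_cases hi : c.z i = c'.z i
  · rw [← hi, lobeMap_z]
  · rw [← c.lobeMap_add i (c.z i), lobeMap_z,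
      (c.sameTree_iff.1 (h.2 i hi)).2.2 i, add_zero]

lemma SameOrbit.toCactus_eq {c c' : MarkedDiagram n} (h : c.SameOrbit c') :
    c.toCactus = c'.toCactus := by
  obtain ⟨τ, ε, h1, h2, h3⟩ := h
  refine toCactus_eq_of_region (fun k => ?_) fun i => by rw [h3, lobeMap_z]
  have harc : ∀ j b, chordArc c'.pt j b = chordArc c.pt (τ j) (xor (ε j) b) := fun j b => by
    rw [chordArc, chordArc, h1, h1, Bool.xor_not]
  ext p
  refine ⟨fun h j b hb => ?_, fun h j b hb => ?_⟩
  · rw [harc]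
    exact h _ _ ((h2 j b).symm.trans hb)
  · have h4 := h (τ.symm j) (xor (ε (τ.symm j)) b)
    rw [h2, harc, Equiv.apply_symm_apply, ← Bool.xor_assoc, Bool.xor_self, Bool.false_xor] at h4
    exact h4 hb

lemma toCactus_eq_of_relatedForests {c c' : MarkedDiagram n}
    (h : c.toChordDiagram.RelatedForests c'.toChordDiagram) (hz : c.z = c'.z) :
    c.toCactus = c'.toCactus :=
  toCactus_eq_of_region h.2.2 fun i => by rw [← hz, lobeMap_z]

lemma trace_eq_of_toCactus_eq {c c' : MarkedDiagram n} (h : c.toCactus = c'.toCactus) :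
    c.trace.φ = c'.trace.φ ∧ c.trace.ψ = c'.trace.ψ := by
  have hφ : c.trace.φ = c'.trace.φ :=
    c'.trace.eq_of_isTrace (by rw [← toCactus, ← h]; exact c.trace.isTrace)
  have hnext : c.trace.next = c'.trace.next := congrArg Cactus.next h
  refine ⟨hφ, funext fun t => c.trace.next.injective ?_⟩
  rw [c.trace.next_ψ, hnext, c'.trace.next_ψ, hφ]

/-- The trace and its left limits give the labels after and before each point. Vertices are the
points where these differ, regions those where both equal `k`, and trees are recovered from the
regions by `ChordDiagram.sameTree_iff`. -/
lemma relatedForests_of_toCactus_eq {c c' : MarkedDiagram n} (h : c.toCactus = c'.toCactus) :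
    c.toChordDiagram.RelatedForests c'.toChordDiagram := by
  obtain ⟨hφ, hψ⟩ := trace_eq_of_toCactus_eq h
  have hA : ∀ t, c.after t = c'.after t := fun t => by
    have := congrArg Prod.fst (congrFun hφ t)
    rwa [trace_φ, trace_φ] at this
  have hB : ∀ t, c.before t = c'.before t := fun t => by
    have := congrArg Prod.fst (congrFun hψ t)
    rwa [trace_ψ, trace_ψ] at this
  have hv : c.vertices = c'.vertices := by
    ext p
    rw [← not_iff_not, c.not_mem_vertices_iff, c'.not_mem_vertices_iff, hA, hB]
  have hr : ∀ k, c.region k = c'.region k := fun k => by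
    ext p
    rw [c.mem_region_iff, c'.mem_region_iff, hA, hB]
  exact ⟨hv, fun p q => by rw [c.sameTree_iff, c'.sameTree_iff, hv]; simp only [hr], hr⟩

/-- A diagram with other marked points. -/
def withMarks (c : MarkedDiagram n) (z : Fin n → UnitAddCircle)
    (hz : ∀ i, c.after (z i) = i) : MarkedDiagram n where
  toChordDiagram := c.toChordDiagram
  z := z
  z_mem i := c.mem_closedRegion_of_after (hz i)

lemma mk_withMarks (c : MarkedDiagram n) (z : Fin n → UnitAddCircle)
    (hz : ∀ i, c.after (z i) = i) (h : ∀ i, c.lobeMap i (z i) = 0) :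
    MC.mk (c.withMarks z hz) = MC.mk c := by
  have hs : c.Sim0 (c.withMarks z hz) := ⟨rfl, fun i hi =>
    c.sameTree_of_pinch (c.z_mem i) (c.mem_closedRegion_of_after (hz i)) hi (h i)⟩
  exact congrArg (Quot.mk _) (Quot.sound hs).symm

/-- Diagrams with the same contraction define the same point of `MD n`. -/
lemma mk_eq_of_toCactus_eq {c c' : MarkedDiagram n} (h : c.toCactus = c'.toCactus) :
    MD.mk c = MD.mk c' := by
  have hrel := relatedForests_of_toCactus_eq h
  -- The relation `∼_f` requires equal marks, so the marks of both diagrams are first moved within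
  -- their trees to the times at which the common trace leaves from the marked points of the lobes.
  choose z hz using fun i => c.trace.φ_surjective (i, 0)
  have h1 : ∀ (d : MarkedDiagram n), d.trace.φ = c.trace.φ → ∀ i, d.after (z i) = i ∧
      d.lobeMap i (z i) = 0 := fun d hd i => by
    have h2 := hz i
    rw [← hd, trace_φ] at h2
    have h3 := congrArg Prod.fst h2
    have h4 := congrArg Prod.snd h2
    simp only at h3 h4
    rw [h3] at h4
    exact ⟨h3, h4⟩
  have h2 := h1 c rfl
  have h3 := h1 c' (trace_eq_of_toCactus_eq h).1.symm
  rw [MD.mk, MD.mk, ← c.mk_withMarks z (fun i => (h2 i).1) fun i => (h2 i).2,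
    ← c'.mk_withMarks z (fun i => (h3 i).1) fun i => (h3 i).2]
  exact Quot.sound ⟨_, _, rfl, rfl, hrel, rfl⟩

end MarkedDiagram

end

noncomputable section


/-! # Every cactus is a contraction of a chord diagram -/

/-- The coordinate of a point of the circle in `(0, 1]`. -/
def ccwOne (x : UnitAddCircle) : ℝ := 1 - ccw (-x)

lemma ccwOne_zero : ccwOne 0 = 1 := by rw [ccwOne, neg_zero, ccw_zero, sub_zero]

lemma ccwOne_of_ne {x : UnitAddCircle} (hx : x ≠ 0) : ccwOne x = ccw x := by
  rw [ccwOne, ccw_neg hx]; ring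

lemma ccwOne_pos (x : UnitAddCircle) : 0 < ccwOne x := sub_pos.2 (ccw_lt_one _)

lemma ccwOne_le_one (x : UnitAddCircle) : ccwOne x ≤ 1 := sub_le_self _ (ccw_nonneg _)

lemma coe_ccwOne (x : UnitAddCircle) : ((ccwOne x : ℝ) : UnitAddCircle) = x := by
  rw [ccwOne, AddCircle.coe_sub, coe_ccw, coe_one_eq_zero]; abel

lemma ccwOne_coe {u : ℝ} (h0 : 0 < u) (h1 : u ≤ 1) : ccwOne (u : UnitAddCircle) = u := by
  rcases h1.eq_or_lt with rfl | h1
  · rw [coe_one_eq_zero, ccwOne_zero]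
  · rw [ccwOne_of_ne, ccw_coe h0.le h1]
    rw [← ccw_pos, ccw_coe h0.le h1]
    exact h0

lemma ccwOne_injective : Function.Injective ccwOne := fun x y h => by
  rw [← coe_ccwOne x, h, coe_ccwOne]

/-- Counting the base point as last instead of first is a cyclic change of the order and does not
affect betweenness. -/
lemma mem_cIoo_iff_ccwOne {x y z : UnitAddCircle} : x ∈ Set.cIoo y z ↔
    (ccwOne y < ccwOne x ∧ ccwOne x < ccwOne z) ∨ (ccwOne z < ccwOne y ∧ ccwOne y < ccwOne x) ∨
    (ccwOne x < ccwOne z ∧ ccwOne z < ccwOne y) := by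
  have key : ∀ x : UnitAddCircle, (ccw x = 0 ∧ ccwOne x = 1) ∨
      (0 < ccw x ∧ ccw x < 1 ∧ ccwOne x = ccw x) := fun x => by
    by_cases hx : x = 0
    · left; rw [hx]; exact ⟨ccw_zero, ccwOne_zero⟩
    · exact Or.inr ⟨ccw_pos.2 hx, ccw_lt_one x, ccwOne_of_ne hx⟩
  rw [mem_cIoo_iff_ccw 0]
  simp only [sub_zero]
  have hx := key x
  have hy := key y
  have hz := key z
  generalize ccw x = a at *
  generalize ccw y = b at *
  generalize ccw z = d at *
  grind

/-! ### The chords of a boundary trace -/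

namespace BoundaryTrace

variable {n : ℕ} (T : BoundaryTrace n)

/-- Two points of the circle with the same image in the cactus. -/
def Glued (p q : UnitAddCircle) : Prop := ∀ i, T.f i p = T.f i q

variable {T}

lemma Glued.symm {p q : UnitAddCircle} (h : T.Glued p q) : T.Glued q p := fun i => (h i).symm

lemma Glued.trans {p q r : UnitAddCircle} (h : T.Glued p q) (h' : T.Glued q r) : T.Glued p r :=
  fun i => (h i).trans (h' i)

variable (T)

/-- Glued points lie in the same position on every lobe, so they are told apart by the lobe from
which the trace leaves; there are at most `n`. -/
lemma finite_glued (p : UnitAddCircle) : {x | T.Glued x p}.Finite := by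
  refine Set.Finite.of_finite_image (f := fun x => (T.φ x).1) (Set.toFinite _) ?_
  intro x hx y hy hxy
  refine T.φ_injective ?_
  simp only at hxy
  rw [T.φ_eq x, T.φ_eq y, hxy, hx, hy]

lemma glued_of_φ_eq_ψ {p q : UnitAddCircle} (h : T.φ p = T.ψ q) : T.Glued p q := fun i => by
  rw [T.f_eq_ψ i q, f, h]

lemma eq_of_f_eq {k : Fin n} {p q : UnitAddCircle} (hp : p ∈ T.region k)
    (h : T.f k p = T.f k q) : p = q := by
  by_contra hne
  have h1 := (T.isOpen_region k).mem_nhds hp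
  have h2 := arcVol_pos_of_right hne (tendsto_add_coe p h1)
  have h3 := arcVol_pos_of_left (Ne.symm hne) (tendsto_sub_coe p h1)
  rcases (T.f_eq_iff hne).1 h with h | h <;> linarith

/-- One of the two arcs contains no length of this region. The region arrives at `q`, so it is the
arc that starts at `q`. -/
lemma arcVol_eq_zero_of_ψ {p q : UnitAddCircle} (hne : p ≠ q)
    (h : T.f (T.ψ q).1 p = T.f (T.ψ q).1 q) : arcVol (T.region (T.ψ q).1) q p = 0 :=
  ((T.f_eq_iff hne).1 h).resolve_left (arcVol_pos_of_left hne (T.eventually_left_mem q)).ne'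

lemma arcVol_eq_zero_of_φ {p q : UnitAddCircle} (hne : p ≠ q)
    (h : T.f (T.φ q).1 p = T.f (T.φ q).1 q) : arcVol (T.region (T.φ q).1) p q = 0 :=
  ((T.f_eq_iff hne).1 h).resolve_right (arcVol_pos_of_right hne.symm (T.eventually_right_mem q)).ne'

lemma arcVol_pos_of_mem_left {k : Fin n} {p q x : UnitAddCircle} (hx : x ∈ Set.cIoo p q)
    (h : (T.ψ x).1 = k) : 0 < arcVol (T.region k) p q := by
  subst h
  rw [arcVol_add hx]
  have hne : p ≠ x := by rintro rfl; exact left_not_mem_cIoo _ _ hx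
  exact add_pos_of_pos_of_nonneg (arcVol_pos_of_left hne (T.eventually_left_mem x))
    (arcVol_nonneg _ _)

lemma arcVol_pos_of_mem_right {k : Fin n} {p q x : UnitAddCircle} (hx : x ∈ Set.cIoo p q)
    (h : (T.φ x).1 = k) : 0 < arcVol (T.region k) p q := by
  subst h
  exact arcVol_pos_of_mem hx (T.eventually_right_mem x)

/-- Pairs of glued points do not cross. -/
lemma glued_of_crossing {p p' q q' : UnitAddCircle} (hp : T.Glued p p') (hq : T.Glued q q')
    (h : q ∈ Set.cIoo p p') (h' : q' ∈ Set.cIoo p' p) : T.Glued p q := fun i => by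
  have hne : p ≠ q := by rintro rfl; exact left_not_mem_cIoo _ _ h
  have h1 := (T.f_eq_iff (ne_of_mem_cIoo h)).1 (hp i)
  obtain ⟨h3, h4⟩ := crossing_symm h h'
  have h2 := (T.f_eq_iff (ne_of_mem_cIoo h4)).1 (hq i)
  rw [T.f_eq_iff hne]
  have e1 := arcVol_add (R := T.region i) h
  have e2 := arcVol_add (R := T.region i) h'
  have e3 := arcVol_add (R := T.region i) h4
  have e4 := arcVol_add (R := T.region i) h3
  have e5 := arcVol_add (R := T.region i) (cIoo_rotate.1 (cIoo_rotate.1 h))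
  have := arcVol_nonneg (R := T.region i) p q
  have := arcVol_nonneg (R := T.region i) q p'
  have := arcVol_nonneg (R := T.region i) p' q'
  have := arcVol_nonneg (R := T.region i) q' p
  rcases h1 with h1 | h1
  · left; linarith
  · rcases h2 with h2 | h2
    · right; linarith
    · left; linarith

/-- The supremum of the times at which the trace arrives along the `k`-th lobe is attained: just
before it, left limits stay on the lobe of the left limit at the supremum. -/
lemma exists_last (k : Fin n) : ∃ v, (T.ψ v).1 = k ∧
    ∀ x, (T.ψ x).1 = k → ccwOne x ≤ ccwOne v := by
  set S : Set ℝ := {u | 0 < u ∧ u ≤ 1 ∧ (T.ψ (u : UnitAddCircle)).1 = k} with hS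
  have hmem : ∀ x, (T.ψ x).1 = k → ccwOne x ∈ S := fun x hx =>
    ⟨ccwOne_pos x, ccwOne_le_one x, by rw [coe_ccwOne]; exact hx⟩
  obtain ⟨t, ht⟩ := T.visit k
  obtain ⟨s, hs⟩ := (T.eventually_right_mem t).exists
  have hne : S.Nonempty := ⟨_, hmem _ (hs.2.trans ht)⟩
  have hbdd : BddAbove S := ⟨1, fun u hu => hu.2.1⟩
  have hle : sSup S ≤ 1 := csSup_le hne fun u hu => hu.2.1
  have hpos : 0 < sSup S := by
    obtain ⟨u, hu⟩ := hne
    exact hu.1.trans_le (le_csSup hbdd hu)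
  refine ⟨((sSup S : ℝ) : UnitAddCircle), ?_, fun x hx => ?_⟩
  · by_contra hcon
    obtain ⟨ε, hε, h⟩ := (mem_nhdsGT_iff_exists_Ioo_subset).1 (T.eventually_left_mem
      ((sSup S : ℝ) : UnitAddCircle))
    obtain ⟨u, hu, hlt⟩ := exists_lt_of_lt_csSup hne (show sSup S - ε < sSup S by
      linarith [Set.mem_Ioi.1 hε])
    rcases (le_csSup hbdd hu).eq_or_lt with he | hlt'
    · exact hcon (by rw [← he]; exact hu.2.2)
    · have h1 := (@h (sSup S - u) ⟨by linarith, by linarith⟩).2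
      rw [AddCircle.coe_sub, sub_sub_cancel] at h1
      exact hcon (h1.symm.trans hu.2.2)
  · rw [ccwOne_coe hpos hle]
    exact le_csSup hbdd (hmem x hx)

/-- The chord that cuts off the `k`-th lobe. -/
structure IsChord (k : Fin n) (w v : UnitAddCircle) : Prop where
  lt : ccwOne w < ccwOne v
  glued : T.Glued w v
  label : (T.ψ v).1 = k
  first : ∀ x, T.Glued x v → ccwOne w ≤ ccwOne x

variable {T}

lemma IsChord.ne {k : Fin n} {w v : UnitAddCircle} (h : T.IsChord k w v) : w ≠ v := by
  rintro rfl; exact lt_irrefl _ h.lt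

lemma exists_isChord_of_ne {v x : UnitAddCircle} (h : T.Glued x v) (hlt : ccwOne x < ccwOne v) :
    ∃ w, T.IsChord (T.ψ v).1 w v := by
  obtain ⟨w, hw, hmin⟩ := (T.finite_glued v).exists_minimalFor ccwOne _ ⟨x, h⟩
  have hmin' : ∀ x, T.Glued x v → ccwOne w ≤ ccwOne x := fun y hy => by
    by_contra! hcon
    exact absurd (hmin hy hcon.le) (not_le.2 hcon)
  exact ⟨w, (hmin' x h).trans_lt hlt, hw, rfl, hmin'⟩

variable (T) in
-- Let `v` be the last arrival on the `k`-th lobe and `x` the time at which the trace leaves from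
-- this same point along the lobe. Since `k` is not the base lobe, `x` is not the base time, so the
-- interval following it precedes the end of the turn and contains arrivals; hence `x < v`. Thus `v`
-- is not the first of its class.
lemma exists_isChord {k : Fin n} (hk : k ≠ (T.φ 0).1) : ∃ w v, T.IsChord k w v := by
  obtain ⟨v, hv, hmax⟩ := T.exists_last k
  obtain ⟨x, hx⟩ := T.φ_surjective (T.ψ v)
  have hxk : (T.φ x).1 = k := by rw [hx, hv]
  have hx0 : ccwOne x < 1 := lt_of_le_of_ne (ccwOne_le_one x) fun h => hk (by
    rw [← hxk, ← ccwOne_injective (h.trans ccwOne_zero.symm)])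
  have hlt : ccwOne x < ccwOne v := by
    obtain ⟨s, h1, h2⟩ := ((T.eventually_right_mem x).and
      (eventually_nhdsGT_pos_lt (1 - ccwOne x) (by linarith))).exists
    have h3 := hmax _ (h1.2.trans hxk)
    have e : x + (s : UnitAddCircle) = ((ccwOne x + s : ℝ) : UnitAddCircle) := by
      rw [AddCircle.coe_add, coe_ccwOne]
    rw [e, ccwOne_coe (by linarith [ccwOne_pos x]) (by linarith)] at h3
    linarith
  obtain ⟨w, hw⟩ := exists_isChord_of_ne (T.glued_of_φ_eq_ψ hx) hlt
  rw [hv] at hw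
  exact ⟨w, v, hw⟩

lemma IsChord.arcVol_eq_zero {k : Fin n} {w v : UnitAddCircle} (h : T.IsChord k w v) :
    arcVol (T.region k) v w = 0 := by
  have := T.arcVol_eq_zero_of_ψ h.ne (h.glued _)
  rwa [h.label] at this

/-- Nothing of the `k`-th region lies outside the arc from `w` to `v`, where the base lobe starts.
-/
lemma IsChord.label_ne {k : Fin n} {w v : UnitAddCircle} (h : T.IsChord k w v) :
    k ≠ (T.φ 0).1 := by
  intro hk
  have h1 := h.arcVol_eq_zero
  by_cases hv : v = 0
  · subst hv hk
    exact (arcVol_pos_of_right h.ne.symm (T.eventually_right_mem 0)).ne' h1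
  · refine (T.arcVol_pos_of_mem_right (x := 0) ?_ hk.symm).ne' h1
    rw [mem_cIoo_iff_ccwOne, ccwOne_zero]
    have := (ccwOne_le_one v).lt_of_ne fun e => hv (ccwOne_injective (e.trans ccwOne_zero.symm))
    exact Or.inr (Or.inl ⟨h.lt, this⟩)

/-- The `k`-th region has no length after `v`, so `v` is its last arrival. Together with
`exists_isChord` this matches the chords with the lobes other than the base lobe. -/
lemma IsChord.unique {k : Fin n} {w v w' v' : UnitAddCircle} (h : T.IsChord k w v)
    (h' : T.IsChord k w' v') : w = w' ∧ v = v' := by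
  have key : ∀ {w v w' v' : UnitAddCircle}, T.IsChord k w v → T.IsChord k w' v' →
      ccwOne v' ≤ ccwOne v := fun {w v w' v'} h h' => by
    by_contra! hlt
    refine (T.arcVol_pos_of_mem_left (x := v') ?_ h'.label).ne' h.arcVol_eq_zero
    rw [mem_cIoo_iff_ccwOne]
    exact Or.inr (Or.inl ⟨h.lt, hlt⟩)
  have hv : v = v' := ccwOne_injective (le_antisymm (key h' h) (key h h'))
  subst hv
  exact ⟨ccwOne_injective (le_antisymm (h.first _ h'.glued) (h'.first _ h.glued)), rfl⟩

lemma IsChord.mem_cIoo {k : Fin n} {w v t : UnitAddCircle} (h : T.IsChord k w v)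
    (ht : t ∈ T.region k) : t ∈ Set.cIoo w v := by
  have h1 : t ≠ v := fun e => h.ne ((T.eq_of_f_eq ht (q := w) (by rw [e, h.glued])).symm.trans e)
  have h2 : t ≠ w := fun e => h.ne (e.symm.trans (T.eq_of_f_eq ht (q := v) (by rw [e, h.glued])))
  exact (mem_cIoo_or h2 h1 h.ne).resolve_right fun h3 =>
    (T.arcVol_pos_of_mem_right h3 ht.1).ne' h.arcVol_eq_zero

lemma IsChord.mem_cIoo' {k : Fin n} {w v t : UnitAddCircle} (h : T.IsChord k w v)
    (ht : t ∈ T.region (T.φ v).1) : t ∈ Set.cIoo v w := by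
  have h1 : t ≠ v := fun e => h.ne ((T.eq_of_f_eq ht (q := w) (by rw [e, h.glued])).symm.trans e)
  have h2 : t ≠ w := fun e => h.ne (e.symm.trans (T.eq_of_f_eq ht (q := v) (by rw [e, h.glued])))
  exact (mem_cIoo_or h2 h1 h.ne).resolve_left fun h3 =>
    (T.arcVol_pos_of_mem_right h3 ht.1).ne' (T.arcVol_eq_zero_of_φ h.ne (h.glued _))

/-- The region of the `k`-th lobe is cut out by the chords next to it. -/
lemma mem_region_of_chords {k : Fin n} {q : UnitAddCircle}
    (h1 : ∀ w v, T.IsChord k w v → q ∈ Set.cIoo w v)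
    (h2 : ∀ l w v, T.IsChord l w v → (T.φ v).1 = k → q ∈ Set.cIoo v w) : q ∈ T.region k := by
  obtain ⟨w, hw⟩ := T.φ_surjective (k, T.f k q)
  obtain ⟨v, hv⟩ := T.ψ_surjective (k, T.f k q)
  have hwk : (T.φ w).1 = k := by rw [hw]
  have hvk : (T.ψ v).1 = k := by rw [hv]
  have hwv : T.Glued w v := T.glued_of_φ_eq_ψ (hw.trans hv.symm)
  have hqv : T.f k v = T.f k q := by
    have := T.f_ψ v
    rwa [hv] at this
  by_cases hne : w = v
  · have hm : v ∈ T.region k := ⟨by rw [← hne]; exact hwk, hvk⟩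
    rwa [← T.eq_of_f_eq hm hqv]
  -- From `w` to `v` the trace makes its turn around the `k`-th lobe, so the initial value is not
  -- taken strictly in between.
  have hgap : ∀ x, T.f k x = T.f k v → x ∉ Set.cIoo w v := fun x hx hxm => by
    have hxv : x ≠ v := by rintro rfl; exact right_not_mem_cIoo _ _ hxm
    subst hvk
    have h3 := T.arcVol_eq_zero_of_ψ hxv hx
    exact (T.arcVol_pos_of_mem_right (cIoo_rotate.1 hxm) hwk).ne' h3
  -- The class is a star with centre its first point `o`. The chords from `o` to `v` and from `o` to
  -- `w`, when nondegenerate, border the `k`-th lobe. They confine `q` to the arc from `w` to `v`,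
  -- in contradiction to `hgap`.
  obtain ⟨o, ho, hmin⟩ := (T.finite_glued v).exists_minimalFor ccwOne _ ⟨w, hwv⟩
  have hmin' : ∀ x, T.Glued x v → ccwOne o ≤ ccwOne x := fun y hy => by
    by_contra! hcon
    exact absurd (hmin hy hcon.le) (not_le.2 hcon)
  have hch : ∀ x, T.Glued x v → x ≠ o → T.IsChord (T.ψ x).1 o x := fun x hx hxo =>
    ⟨(hmin' x hx).lt_of_ne fun e => hxo (ccwOne_injective e).symm, ho.trans hx.symm, rfl,
      fun y hy => hmin' y (hy.trans hx)⟩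
  exfalso
  refine hgap q hqv.symm ?_
  by_cases hvo : v = o
  · rw [hvo]
    exact h2 _ _ _ (hch w hwv fun e => hne (e.trans hvo.symm)) hwk
  have h3 := h1 o v (by
    have := hch v (fun _ => rfl) hvo
    rwa [hvk] at this)
  by_cases hwo : w = o
  · rw [hwo]; exact h3
  have h4 := h2 _ _ _ (hch w hwv hwo) hwk
  have h5 := hgap o (ho k)
  rw [mem_cIoo_iff] at h3
  simp only [mem_cIoo_iff_ccw o, sub_self, ccw_zero] at h4 h5 ⊢
  clear * - h3 h4 h5
  have := ccw_nonneg (q - o)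
  have := ccw_nonneg (w - o)
  generalize ccw (q - o) = x1 at *
  generalize ccw (w - o) = x2 at *
  generalize ccw (v - o) = x3 at *
  grind

lemma card_ne (k₀ : Fin n) : Fintype.card (Fin (n - 1)) = Fintype.card {k : Fin n // k ≠ k₀} := by
  simp [Fintype.card_subtype_compl]

variable (T)

lemma exists_chords : ∃ (e : Fin (n - 1) ≃ {k : Fin n // k ≠ (T.φ 0).1})
    (w v : Fin (n - 1) → UnitAddCircle), ∀ j, T.IsChord (e j).1 (w j) (v j) := by
  choose w v h using fun k : {k : Fin n // k ≠ (T.φ 0).1} => T.exists_isChord k.2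
  let e := Fintype.equivOfCardEq (card_ne (T.φ 0).1)
  exact ⟨e, fun j => w (e j), fun j => v (e j), fun j => h (e j)⟩

/-- The arc from `w` to `v` is the side of the `k`-th lobe, and the other side belongs to the lobe
on which the trace continues at `v`. The stars in the classes of glued points are the trees of the
diagram. -/
lemma exists_chordDiagram : ∃ c : ChordDiagram n, ∀ k, c.region k = T.region k := by
  obtain ⟨e, w, v, h⟩ := T.exists_chords
  have hall : ∀ k x y, T.IsChord k x y → ∃ j, (e j).1 = k ∧ w j = x ∧ v j = y := by
    intro k x y hk
    refine ⟨e.symm ⟨k, hk.label_ne⟩, by simp, ?_⟩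
    have := h (e.symm ⟨k, hk.label_ne⟩)
    rw [Equiv.apply_symm_apply] at this
    exact this.unique hk
  let pt : Fin (n - 1) → Bool → UnitAddCircle := fun j b => if b then v j else w j
  let lab : Fin (n - 1) → Bool → Fin n := fun j b => if b then (T.φ (v j)).1 else (e j).1
  have hregion : ∀ k, openRegion pt lab k = T.region k := by
    intro k
    ext q
    refine ⟨fun hq => T.mem_region_of_chords ?_ ?_, ?_⟩
    · intro x y hxy
      obtain ⟨j, h1, rfl, rfl⟩ := hall k x y hxy
      exact hq j false h1
    · intro l x y hxy hl
      obtain ⟨j, h1, rfl, rfl⟩ := hall l x y hxy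
      exact hq j true hl
    · rintro hq j (_ | _) hj
      · exact (h j).mem_cIoo (by rw [show (e j).1 = k from hj]; exact hq)
      · exact (h j).mem_cIoo' (by rw [show (T.φ (v j)).1 = k from hj]; exact hq)
  -- The ends of crossing chords would all be glued, so both chords would belong to the same star
  -- and share their first point.
  have hcross : ∀ i j b, ¬ (pt j b ∈ Set.cIoo (w i) (v i) ∧ pt j (!b) ∈ Set.cIoo (v i) (w i)) := by
    rintro i j b ⟨h1, h2⟩
    have hg : T.Glued (w i) (w j) := by
      cases b
      · exact T.glued_of_crossing (h i).glued (h j).glued h1 h2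
      · exact (T.glued_of_crossing (h i).glued (h j).glued.symm h1 h2).trans (h j).glued.symm
    have hw : w i = w j := ccwOne_injective (le_antisymm
      ((h i).first _ (hg.symm.trans (h i).glued)) ((h j).first _ (hg.trans (h j).glued)))
    cases b
    · rw [show pt j false = w i from hw.symm] at h1
      exact left_not_mem_cIoo _ _ h1
    · rw [show pt j (!true) = w i from hw.symm] at h2
      exact right_not_mem_cIoo _ _ h2
  refine ⟨⟨pt, lab, fun j => (h j).ne, fun i j b => hcross i j b, fun p hp => ?_, fun k => ?_⟩,
    hregion⟩
  -- If the trace did not leave from the point where it arrives at `p`, the time `x ≠ p` at which it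
  -- does would be glued to `p`. Then `p` would be an end of a chord, whether it is the first point
  -- of its class or not.
  · have hAB : (T.φ p).1 = (T.ψ p).1 := by
      obtain ⟨x, hx⟩ := T.φ_surjective (T.ψ p)
      have hg := T.glued_of_φ_eq_ψ hx
      have hxp : x = p := by
        by_contra hne
        rcases lt_or_gt_of_ne (fun e => hne (ccwOne_injective e)) with hlt | hlt
        · obtain ⟨y, hy⟩ := exists_isChord_of_ne hg hlt
          obtain ⟨j, -, -, h1⟩ := hall _ _ _ hy
          exact hp j true h1.symm
        · obtain ⟨y, hy⟩ := exists_isChord_of_ne hg.symm hlt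
          obtain ⟨j, -, h1, h2⟩ := hall _ _ _ hy
          rcases (hy.first p hg.symm).eq_or_lt with h3 | h3
          · exact hp j false ((ccwOne_injective h3).symm.trans h1.symm)
          · obtain ⟨y', hy'⟩ := exists_isChord_of_ne (hy.glued.trans hg) h3
            obtain ⟨j', -, -, h4⟩ := hall _ _ _ hy'
            exact hp j' true h4.symm
      rw [← hx, hxp]
    refine ⟨(T.φ p).1, ?_, fun k hk => ?_⟩
    · simp only [hregion]
      exact ⟨rfl, hAB.symm⟩
    · simp only [hregion] at hk
      exact hk.1.symm
  · rw [hregion]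
    exact (T.isOpen_region k).measure_pos volume (by
      obtain ⟨t, rfl⟩ := T.visit k
      obtain ⟨s, hs⟩ := (T.eventually_right_mem t).exists
      exact ⟨_, hs⟩)

lemma exists_markedDiagram : ∃ c : MarkedDiagram n, c.toCactus = T.toCactus := by
  obtain ⟨c, hc⟩ := T.exists_chordDiagram
  have hA : ∀ t, c.after t = (T.φ t).1 := fun t => ChordDiagram.LabelAfter.eq_after (by
    rw [ChordDiagram.LabelAfter, hc]; exact T.eventually_right_mem t)
  choose z hz using fun i => T.φ_surjective (i, 0)
  let m : MarkedDiagram n := ⟨c, z, fun i => c.mem_closedRegion_of_after (by rw [hA, hz])⟩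
  refine ⟨m, BoundaryTrace.toCactus_eq (fun t => ?_) fun i => ⟨z i, ?_⟩⟩
  · rw [MarkedDiagram.trace_φ]
    exact hA t
  · rw [MarkedDiagram.trace_f]
    have h1 := T.f_φ (z i)
    rw [hz] at h1
    rw [h1]
    exact m.lobeMap_z i

end BoundaryTrace

lemma MarkedDiagram.toCactus_surjective {n : ℕ} :
    Function.Surjective (MarkedDiagram.toCactus (n := n)) := fun a => by
  obtain ⟨c, hc⟩ := a.boundary.exists_markedDiagram
  exact ⟨c, hc.trans a.toCactus_boundary⟩

end

noncomputable section


/-! # The contraction is a quotient map -/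

lemma eventually_mem_cIoo {ι : Type*} {l : Filter ι} {u v x : ι → UnitAddCircle}
    {a b y : UnitAddCircle} (hu : Tendsto u l (𝓝 a)) (hx : Tendsto x l (𝓝 y))
    (hv : Tendsto v l (𝓝 b)) (h : y ∈ Set.cIoo a b) : ∀ᶠ i in l, x i ∈ Set.cIoo (u i) (v i) :=
  (hu.prodMk_nhds (hx.prodMk_nhds hv)).eventually (isOpen_sbtw.mem_nhds h)

lemma eventually_mem_cIoo_iff {ι : Type*} {l : Filter ι} {u v : ι → UnitAddCircle}
    {a b x : UnitAddCircle} (hu : Tendsto u l (𝓝 a)) (hv : Tendsto v l (𝓝 b)) (hab : a ≠ b)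
    (ha : x ≠ a) (hb : x ≠ b) :
    ∀ᶠ i in l, x ∈ Set.cIoo (u i) (v i) ↔ x ∈ Set.cIoo a b := by
  rcases mem_cIoo_or ha hb hab with h | h
  · filter_upwards [eventually_mem_cIoo hu tendsto_const_nhds hv h] with i hi
    exact iff_of_true hi h
  · filter_upwards [eventually_mem_cIoo hv tendsto_const_nhds hu h] with i hi
    exact iff_of_false (Set.disjoint_left.1 (disjoint_cIoo _ _) hi)
      (Set.disjoint_left.1 (disjoint_cIoo _ _) h)

/-! ### Lengths of regions as the chords move -/

section openRegion

variable {n : ℕ} {ι : Type*} {l : Filter ι} {pt : ι → Fin (n - 1) → Bool → UnitAddCircle}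
  {pt₀ : Fin (n - 1) → Bool → UnitAddCircle} (lab : Fin (n - 1) → Bool → Fin n) (k : Fin n)

lemma pt_ne_not (hne : ∀ j, pt₀ j false ≠ pt₀ j true) (j : Fin (n - 1)) (b : Bool) :
    pt₀ j b ≠ pt₀ j (!b) := by
  cases b
  · exact hne j
  · exact (hne j).symm

lemma eventually_mem_openRegion_iff (h : Tendsto pt l (𝓝 pt₀))
    (hne : ∀ j, pt₀ j false ≠ pt₀ j true) {x : UnitAddCircle} (hx : ∀ j b, x ≠ pt₀ j b) :
    ∀ᶠ i in l, x ∈ openRegion (pt i) lab k ↔ x ∈ openRegion pt₀ lab k := by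
  have h1 : ∀ j b, Tendsto (fun i => pt i j b) l (𝓝 (pt₀ j b)) := fun j b =>
    (tendsto_pi_nhds.1 (tendsto_pi_nhds.1 h j)) b
  have h2 : ∀ᶠ i in l, ∀ j b, x ∈ chordArc (pt i) j b ↔ x ∈ chordArc pt₀ j b :=
    eventually_all.2 fun j => eventually_all.2 fun b =>
      eventually_mem_cIoo_iff (h1 j b) (h1 j (!b)) (pt_ne_not hne j b) (hx j b) (hx j (!b))
  filter_upwards [h2] with i hi
  simp only [openRegion, Set.mem_ofPred_eq, hi]

lemma isOpen_openRegion (pt : Fin (n - 1) → Bool → UnitAddCircle) :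
    IsOpen (openRegion pt lab k) := by
  have : openRegion pt lab k = ⋂ x : {x : Fin (n - 1) × Bool // lab x.1 x.2 = k},
      chordArc pt x.1.1 x.1.2 := by
    ext p
    simp [openRegion]
  rw [this]
  exact isOpen_iInter_of_finite fun x => isOpen_cIoo _ _

/-- Away from the finitely many limiting end points, membership in the region and in the arc is
eventually constant, so the indicators converge almost everywhere and dominated convergence applies.
The condition `q ≠ p₀` excludes arcs that jump between empty and full. -/
lemma tendsto_arcVol_openRegion [l.IsCountablyGenerated] (h : Tendsto pt l (𝓝 pt₀))
    (hne : ∀ j, pt₀ j false ≠ pt₀ j true) {q p₀ : UnitAddCircle} {p : ι → UnitAddCircle}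
    (hp : Tendsto p l (𝓝 p₀)) (hq : q ≠ p₀) :
    Tendsto (fun i => arcVol (openRegion (pt i) lab k) q (p i)) l
      (𝓝 (arcVol (openRegion pt₀ lab k) q p₀)) := by
  refine (ENNReal.tendsto_toReal (measure_ne_top volume _)).comp
    (tendsto_measure_of_ae_tendsto_indicator_of_isFiniteMeasure l
      ((isOpen_openRegion lab k pt₀).inter (isOpen_cIoo _ _)).measurableSet
      (fun i => ((isOpen_openRegion lab k (pt i)).inter (isOpen_cIoo _ _)).measurableSet) ?_)
  have hfin : (Set.range (fun x : Fin (n - 1) × Bool => pt₀ x.1 x.2) ∪ {q, p₀}).Finite :=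
    (Set.finite_range _).union (Set.toFinite _)
  have h0 : ∀ᵐ x : UnitAddCircle,
      x ∉ Set.range (fun x : Fin (n - 1) × Bool => pt₀ x.1 x.2) ∪ {q, p₀} :=
    measure_eq_zero_iff_ae_notMem.1 (volume_real_finite hfin)
  filter_upwards [h0] with x hx
  simp only [Set.mem_union, Set.mem_range, Set.mem_insert_iff, Set.mem_singleton_iff,
    not_or, not_exists] at hx
  filter_upwards [eventually_mem_openRegion_iff lab k h hne (x := x)
    (fun j b e => hx.1 (j, b) e.symm),
    eventually_mem_cIoo_iff tendsto_const_nhds hp hq hx.2.1 hx.2.2] with i h1 h2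
  rw [Set.mem_inter_iff, Set.mem_inter_iff, h1, h2]

/-- Cut the circle at `0` and `1/2` into two arcs with fixed distinct end points. -/
lemma tendsto_volume_openRegion [l.IsCountablyGenerated] (h : Tendsto pt l (𝓝 pt₀))
    (hne : ∀ j, pt₀ j false ≠ pt₀ j true) :
    Tendsto (fun i => volume.real (openRegion (pt i) lab k)) l
      (𝓝 (volume.real (openRegion pt₀ lab k))) := by
  have hq : (0 : UnitAddCircle) ≠ ((1 / 2 : ℝ) : UnitAddCircle) := by
    have := add_coe_ne (p := 0) (s := 1 / 2) (by norm_num) (by norm_num)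
    rw [zero_add] at this
    exact this.symm
  have h1 := (tendsto_arcVol_openRegion lab k h hne tendsto_const_nhds hq).add
    (tendsto_arcVol_openRegion lab k h hne tendsto_const_nhds hq.symm)
  simpa only [arcVol_compl hq] using h1

end openRegion

/-! ### Continuity and compactness -/

namespace MarkedDiagram

variable {n : ℕ}

lemma isInducing : IsInducing fun c : MarkedDiagram n => ((c.pt, c.lab), c.z) := by
  have h1 : IsInducing fun c : ChordDiagram n => (c.pt, c.lab) := ⟨rfl⟩
  have h2 : IsInducing fun c : MarkedDiagram n => (c.toChordDiagram, c.z) := ⟨rfl⟩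
  exact (h1.prodMap IsInducing.id).comp h2

instance : FirstCountableTopology (MarkedDiagram n) := isInducing.firstCountableTopology

lemma continuous_pt : Continuous fun c : MarkedDiagram n => c.pt :=
  continuous_fst.comp (continuous_fst.comp isInducing.continuous)

lemma continuous_z (i : Fin n) : Continuous fun c : MarkedDiagram n => c.z i :=
  (continuous_apply i).comp (continuous_snd.comp isInducing.continuous)

lemma eventually_lab_eq (c : MarkedDiagram n) : ∀ᶠ c' in 𝓝 c, c'.lab = c.lab := by
  have h : Continuous fun c : MarkedDiagram n => c.lab :=
    continuous_snd.comp (continuous_fst.comp isInducing.continuous)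
  exact h.continuousAt.eventually (isOpen_discrete {c.lab} |>.mem_nhds rfl)

lemma tendsto_arcVol {X : Type*} {l : Filter X} [l.IsCountablyGenerated] {g : X → MarkedDiagram n}
    {c : MarkedDiagram n} (hg : Tendsto g l (𝓝 c)) (i : Fin n) {q p₀ : UnitAddCircle}
    {p : X → UnitAddCircle} (hp : Tendsto p l (𝓝 p₀)) (hq : q ≠ p₀) :
    Tendsto (fun x => arcVol ((g x).region i) q (p x)) l (𝓝 (arcVol (c.region i) q p₀)) := by
  refine (tendsto_arcVol_openRegion c.lab i ((continuous_pt.tendsto c).comp hg) c.ne hp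
    hq).congr' ?_
  filter_upwards [hg.eventually c.eventually_lab_eq] with x hx
  rw [ChordDiagram.region, hx]; rfl

lemma tendsto_volume {X : Type*} {l : Filter X} [l.IsCountablyGenerated] {g : X → MarkedDiagram n}
    {c : MarkedDiagram n} (hg : Tendsto g l (𝓝 c)) (i : Fin n) :
    Tendsto (fun x => volume.real ((g x).region i)) l (𝓝 (volume.real (c.region i))) := by
  refine (tendsto_volume_openRegion c.lab i ((continuous_pt.tendsto c).comp hg) c.ne).congr' ?_
  filter_upwards [hg.eventually c.eventually_lab_eq] with x hx
  rw [ChordDiagram.region, hx]; rfl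

/-- The length from `z i` to `p` jumps when the two collide, although its class in `ℝ/ℤ` does not.
Writing the lobe map as a difference of pinchings from an auxiliary point `q`, different from both
limits, avoids the jump. -/
lemma continuous_lobeMap (i : Fin n) :
    Continuous fun x : MarkedDiagram n × UnitAddCircle => x.1.lobeMap i x.2 := by
  refine continuous_iff_continuousAt.2 fun ⟨c, p⟩ => ?_
  obtain ⟨q, hq⟩ : ∃ q, q ∉ ({p, c.z i} : Set UnitAddCircle) := by
    by_contra! h
    have : volume (Set.univ : Set UnitAddCircle) = 0 :=
      measure_mono_null (fun x _ => h x)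
        (volume_real_finite (Set.toFinite ({p, c.z i} : Set UnitAddCircle)))
    have h1 := volume_real_univ_circle
    rw [Measure.real, this] at h1
    simp at h1
  simp only [Set.mem_insert_iff, Set.mem_singleton_iff, not_or] at hq
  have hfst : Tendsto (fun x : MarkedDiagram n × UnitAddCircle => x.1) (𝓝 (c, p)) (𝓝 c) :=
    continuous_fst.tendsto _
  have key : ∀ (p₀ : UnitAddCircle) (P : MarkedDiagram n × UnitAddCircle → UnitAddCircle),
      Tendsto P (𝓝 (c, p)) (𝓝 p₀) → q ≠ p₀ →
      Tendsto (fun x => pinch (x.1.region i) q (P x)) (𝓝 (c, p)) (𝓝 (pinch (c.region i) q p₀)) :=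
    fun p₀ P hP hne => (AddCircle.continuous_mk' 1).continuousAt.tendsto.comp
      ((tendsto_arcVol hfst i hP hne).div (tendsto_volume hfst i) (c.volume_region_ne i))
  have h1 := (key p _ (continuous_snd.tendsto (c, p)) hq.1).sub
    (key (c.z i) (fun x => x.1.z i) (((continuous_z i).tendsto c).comp hfst) hq.2)
  have h2 : ∀ x : MarkedDiagram n × UnitAddCircle, pinch (x.1.region i) q x.2 -
      pinch (x.1.region i) q (x.1.z i) = x.1.lobeMap i x.2 := fun x =>
    (pinch_eq_sub (x.1.volume_region_ne i) _ _ _).symm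
  simp only [h2] at h1
  rw [← pinch_eq_sub (c.volume_region_ne i)] at h1
  exact h1

/-- Joint continuity of the lobe maps in the diagram and the point gives continuity into the space
of maps with the uniform topology. -/
lemma continuous_toCactus : Continuous (toCactus (n := n)) := by
  refine Cactus.continuous_iff.2 ⟨fun i => ?_, fun i => ?_⟩
  · simp only [toCactus_size]
    exact continuous_iff_continuousAt.2 fun c => tendsto_volume tendsto_id i
  · refine ContinuousMap.continuous_of_continuous_uncurry _ ?_
    simp only [Function.uncurry_def, toCactus_pinchingMap]
    exact continuous_lobeMap i

lemma not_both_arcs_small {ι : Type*} {l : Filter ι} [l.NeBot] {u v : ι → UnitAddCircle}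
    {a b : UnitAddCircle} (hu : Tendsto u l (𝓝 a)) (hv : Tendsto v l (𝓝 b)) {ε : ℝ} (hε : 0 < ε)
    (h : ∀ᶠ i in l, ε ≤ ccw (v i - u i) ∧ ε ≤ ccw (u i - v i)) : a ≠ b := by
  rintro rfl
  have h1 : Tendsto (fun i => v i - u i) l (𝓝 0) := by
    have := hv.sub hu
    rwa [sub_self] at this
  have h2 : ∀ᶠ x : UnitAddCircle in 𝓝 0, ccw x < ε ∨ ccw (-x) < ε := by
    have h3 := (eventually_nhdsGT_pos_lt ε hε).and (eventually_nhdsGT_pos_lt 1 one_pos)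
    refine eventually_nhds_circle (Or.inl (by rwa [ccw_zero])) ?_ ?_
    · filter_upwards [h3] with s hs
      rw [zero_add]
      exact Or.inl ((ccw_coe hs.1.1.le hs.2.2).trans_lt hs.1.2)
    · filter_upwards [h3] with s hs
      rw [zero_sub, neg_neg]
      exact Or.inr ((ccw_coe hs.1.1.le hs.2.2).trans_lt hs.1.2)
  obtain ⟨i, h4, h5, h6⟩ := ((h1.eventually h2).and h).exists
  rw [neg_sub] at h4
  rcases h4 with h4 | h4 <;> linarith

lemma le_ccw_of_le_volume (c : ChordDiagram n) {ε : ℝ}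
    (h : ∀ k, ε ≤ volume.real (c.region k)) (j : Fin (n - 1)) (b : Bool) :
    ε ≤ ccw (c.pt j (!b) - c.pt j b) := by
  rw [← volume_real_cIoo]
  exact (h (c.lab j b)).trans (measureReal_mono fun p hp => c.region_subset rfl hp)

/-- An ultrafilter of such diagrams has a limit in the compact space of all end points, labels and
marks. The bound keeps the ends of each chord apart, since both of its sides contain a region. It
then passes to the limit, which is a diagram because crossing and leaving a closed region are open
conditions. -/
lemma isCompact_setOf_le_volume {ε : Fin n → ℝ} (hε : ∀ k, 0 < ε k) :
    IsCompact {c : MarkedDiagram n | ∀ k, ε k ≤ volume.real (c.region k)} := by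
  rw [isCompact_iff_ultrafilter_le_nhds]
  intro F hF
  rw [le_principal_iff] at hF
  obtain ⟨L, -, hL⟩ := isCompact_univ.ultrafilter_le_nhds
    (F.map fun c : MarkedDiagram n => ((c.pt, c.lab), c.z)) (by simp)
  have hlim : Tendsto (fun c : MarkedDiagram n => ((c.pt, c.lab), c.z)) F (𝓝 L) := hL
  obtain ⟨⟨pt, lab⟩, z⟩ := L
  have hpt : Tendsto (fun c : MarkedDiagram n => c.pt) F (𝓝 pt) :=
    (continuous_fst.comp continuous_fst).continuousAt.tendsto.comp hlim
  have hlab' : Tendsto (fun c : MarkedDiagram n => c.lab) F (𝓝 lab) :=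
    (continuous_snd.comp continuous_fst).continuousAt.tendsto.comp hlim
  have hz : Tendsto (fun c : MarkedDiagram n => c.z) F (𝓝 z) :=
    continuous_snd.continuousAt.tendsto.comp hlim
  have hlab : ∀ᶠ c : MarkedDiagram n in F, c.lab = lab :=
    hlab'.eventually (isOpen_discrete {lab} |>.mem_nhds rfl)
  have hpt' : ∀ j b, Tendsto (fun c : MarkedDiagram n => c.pt j b) F (𝓝 (pt j b)) := fun j b =>
    (tendsto_pi_nhds.1 (tendsto_pi_nhds.1 hpt j)) b
  have hz' : ∀ i, Tendsto (fun c : MarkedDiagram n => c.z i) F (𝓝 (z i)) := tendsto_pi_nhds.1 hz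
  have hne : ∀ j, pt j false ≠ pt j true := fun j => by
    obtain ⟨k, hk⟩ : ∃ k, ∀ k', ε k ≤ ε k' := by
      have : Nonempty (Fin n) := ⟨lab j false⟩
      exact Finite.exists_min ε
    refine not_both_arcs_small (hpt' j false) (hpt' j true) (hε k) ?_
    filter_upwards [hF] with c hc
    have hc' : ∀ k', ε k ≤ volume.real (c.region k') := fun k' => (hk k').trans (hc k')
    exact ⟨le_ccw_of_le_volume c.toChordDiagram hc' j false,
      le_ccw_of_le_volume c.toChordDiagram hc' j true⟩
  have hvol : ∀ k, ε k ≤ volume.real (openRegion pt lab k) := fun k => by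
    have h1 : Tendsto (fun pt => volume.real (openRegion pt lab k)) (𝓝 pt)
        (𝓝 (volume.real (openRegion pt lab k))) := tendsto_volume_openRegion lab k tendsto_id hne
    refine ge_of_tendsto (h1.comp hpt) ?_
    filter_upwards [hF, hlab] with c hc hcl
    rw [Function.comp, ← hcl]
    exact hc k
  let c₀ : ChordDiagram n := ⟨pt, lab, hne, fun i j b h => by
      obtain ⟨c, h1, h2⟩ := ((eventually_mem_cIoo (hpt' i false) (hpt' j b) (hpt' i true) h.1).and
        (eventually_mem_cIoo (hpt' i true) (hpt' j (!b)) (hpt' i false) h.2)).exists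
      exact c.flat i j b ⟨h1, h2⟩,
    fun p hp => by
      have h1 : ∀ᶠ c : MarkedDiagram n in F, ∀ j b, p ≠ c.pt j b :=
        eventually_all.2 fun j => eventually_all.2 fun b =>
          (hpt' j b).eventually (isOpen_ne.mem_nhds (hp j b).symm) |>.mono fun _ h => h.symm
      have h2 : ∀ᶠ c : MarkedDiagram n in F, ∀ k,
          p ∈ openRegion c.pt lab k ↔ p ∈ openRegion pt lab k :=
        eventually_all.2 fun k => eventually_mem_openRegion_iff lab k hpt hne hp
      obtain ⟨c, h3, h4, h5⟩ := (h1.and (h2.and hlab)).exists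
      have h6 := c.existsUnique_region p h3
      rw [h5] at h6
      simpa only [h4] using h6,
    fun k => by
      by_contra h
      have h1 := hvol k
      rw [Measure.real, nonpos_iff_eq_zero.1 (not_lt.1 h)] at h1
      exact absurd ((hε k).trans_le h1) (lt_irrefl _)⟩
  let m : MarkedDiagram n := ⟨c₀, z, fun i j b h => by
    rw [mem_cIcc_iff_not]
    intro h1
    obtain ⟨c, h2, h3⟩ := ((eventually_mem_cIoo (hpt' j (!b)) (hz' i) (hpt' j b) h1).and
      hlab).exists
    have h4 := c.z_mem i j b (by rw [h3]; exact h)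
    rw [mem_cIcc_iff_not] at h4
    exact h4 h2⟩
  refine ⟨m, hvol, ?_⟩
  rw [isInducing.nhds_eq_comap]
  exact tendsto_iff_comap.1 hlim

/-- A surjection that is proper over a neighbourhood of each cactus: there all sizes exceed half of
the original ones, so diagrams may be taken from a compact set, whose closed subsets have closed
images. -/
lemma isQuotientMap_toCactus : IsQuotientMap (toCactus (n := n)) := by
  refine isQuotientMap_iff_isClosed.2 ⟨toCactus_surjective, fun s =>
    ⟨fun h => h.preimage continuous_toCactus, fun h => ?_⟩⟩
  refine isClosed_of_closure_subset fun a ha => ?_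
  set K := {c : MarkedDiagram n | ∀ k, a.size k / 2 ≤ volume.real (c.region k)}
  have hK : IsCompact K := isCompact_setOf_le_volume fun k => half_pos (a.size_pos k)
  have hcl := ((hK.inter_right h).image continuous_toCactus).isClosed
  have hnhds : ∀ᶠ b in 𝓝 a, ∀ k, a.size k / 2 < b.size k := eventually_all.2 fun k =>
    (Cactus.continuous_size k).continuousAt.eventually
      (lt_mem_nhds (half_lt_self (a.size_pos k)))
  have hmem : a ∈ closure (toCactus '' (K ∩ toCactus ⁻¹' s)) := by
    rw [mem_closure_iff_frequently] at ha ⊢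
    refine (ha.and_eventually hnhds).mono fun b hb => ?_
    obtain ⟨c, rfl⟩ := toCactus_surjective b
    exact ⟨c, ⟨fun k => by rw [← c.toCactus_size]; exact (hb.2 k).le, hb.1⟩, rfl⟩
  rw [hcl.closure_eq] at hmem
  obtain ⟨c, hc, rfl⟩ := hmem
  exact hc.2

end MarkedDiagram

/-! ### Descent to `MC` and `MD` -/

/-- The cactus obtained by contracting the chords of a diagram. -/
def MC.toCactus {n : ℕ} : MC n → Cactus n :=
  Quot.lift (Quot.lift MarkedDiagram.toCactus fun _ _ h => h.toCactus_eq) (by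
    rintro _ _ ⟨c, c', rfl, rfl, h⟩
    exact h.toCactus_eq)

lemma MC.continuous_mk {n : ℕ} : Continuous (MC.mk (n := n)) :=
  continuous_quot_mk.comp continuous_quot_mk

lemma MC.isQuotientMap_toCactus {n : ℕ} : IsQuotientMap (MC.toCactus (n := n)) :=
  IsQuotientMap.of_comp MC.continuous_mk
    (continuous_quot_lift _ (continuous_quot_lift _ MarkedDiagram.continuous_toCactus))
    MarkedDiagram.isQuotientMap_toCactus

lemma MC.exists_mk {n : ℕ} (x : MC n) : ∃ c, MC.mk c = x := by
  obtain ⟨y, rfl⟩ := Quot.exists_rep x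
  obtain ⟨c, rfl⟩ := Quot.exists_rep y
  exact ⟨c, rfl⟩

lemma MD.exists_mk {n : ℕ} (x : MD n) : ∃ c, MD.mk c = x := by
  obtain ⟨y, rfl⟩ := Quot.exists_rep x
  obtain ⟨c, rfl⟩ := MC.exists_mk y
  exact ⟨c, rfl⟩

/-- The cactus obtained by contracting the chords of a diagram. -/
def MD.toCactus {n : ℕ} : MD n → Cactus n :=
  Quot.lift MC.toCactus (by
    rintro _ _ ⟨c, c', rfl, rfl, h, hz⟩
    exact MarkedDiagram.toCactus_eq_of_relatedForests h hz)

lemma MD.isQuotientMap_toCactus {n : ℕ} : IsQuotientMap (MD.toCactus (n := n)) :=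
  IsQuotientMap.of_comp continuous_quot_mk
    (continuous_quot_lift _ MC.isQuotientMap_toCactus.continuous) MC.isQuotientMap_toCactus

lemma MD.toCactus_injective {n : ℕ} : Function.Injective (MD.toCactus (n := n)) := by
  intro x y h
  obtain ⟨c, rfl⟩ := MD.exists_mk x
  obtain ⟨c', rfl⟩ := MD.exists_mk y
  exact MarkedDiagram.mk_eq_of_toCactus_eq h

/-- The space of marked chord diagrams is homeomorphic to the space of cacti. -/
def MD.homeomorphCactus (n : ℕ) : MD n ≃ₜ Cactus n :=
  (Equiv.ofBijective MD.toCactus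
    ⟨MD.toCactus_injective, MD.isQuotientMap_toCactus.surjective⟩).toHomeomorph
    fun _ => MD.isQuotientMap_toCactus.isOpen_preimage

end

noncomputable section


/-! # Patching of chord diagrams -/

namespace MarkedDiagram

section lift

variable {n : ℕ} (c : MarkedDiagram n)

/-- The initial point of an interval of the `i`-th region with image `x` in the `i`-th lobe. -/
def lift (i : Fin n) (x : UnitAddCircle) : UnitAddCircle := c.trace.φEquiv.symm (i, x)

lemma trace_φ_lift (i : Fin n) (x : UnitAddCircle) : c.trace.φ (c.lift i x) = (i, x) :=
  BoundaryTrace.φ_φEquiv_symm _ _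

lemma after_lift (i : Fin n) (x : UnitAddCircle) : c.after (c.lift i x) = i := by
  have := congrArg Prod.fst (c.trace_φ_lift i x)
  rwa [trace_φ] at this

lemma lobeMap_lift (i : Fin n) (x : UnitAddCircle) : c.lobeMap i (c.lift i x) = x := by
  have := congrArg Prod.snd (c.trace_φ_lift i x)
  rwa [trace_φ, after_lift] at this

lemma lift_injective (i : Fin n) : Function.Injective (c.lift i) := fun x y h => by
  rw [← c.lobeMap_lift i x, h, lobeMap_lift]

lemma eq_of_lobeMap_eq {i : Fin n} {p q : UnitAddCircle} (hp : p ∈ c.region i)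
    (h : c.lobeMap i p = c.lobeMap i q) : p = q := by
  rw [← trace_f, ← trace_f] at h
  exact c.trace.eq_of_f_eq (by rw [trace_region]; exact hp) h

lemma lift_lobeMap {i : Fin n} {p : UnitAddCircle} (hp : p ∈ c.region i) :
    c.lift i (c.lobeMap i p) = p := (c.eq_of_lobeMap_eq hp (c.lobeMap_lift _ _).symm).symm

lemma lobeMap_sub (i : Fin n) (p q : UnitAddCircle) :
    c.lobeMap i q - c.lobeMap i p = pinch (c.region i) p q := by
  rw [← c.lobeMap_add i p q, add_sub_cancel_left]

lemma arcVol_of_lobeMap_ne {i : Fin n} {p q : UnitAddCircle}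
    (h : c.lobeMap i p ≠ c.lobeMap i q) : 0 < arcVol (c.region i) p q ∧
      ccw (c.lobeMap i q - c.lobeMap i p) =
        arcVol (c.region i) p q / volume.real (c.region i) := by
  have h0 : pinch (c.region i) p q ≠ 0 := by
    rw [← lobeMap_sub]; exact sub_ne_zero.2 h.symm
  rw [Ne, pinch_eq_zero_iff (c.volume_region_ne i), not_or] at h0
  refine ⟨(arcVol_nonneg _ _).lt_of_ne (Ne.symm h0.1), ?_⟩
  rw [lobeMap_sub]
  exact ccw_pinch_of_lt ((arcVol_le _ _).lt_of_ne h0.2)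

/-- The lobe maps preserve the cyclic order. -/
lemma lobeMap_mem_cIoo {i : Fin n} {p q r : UnitAddCircle} (h : q ∈ Set.cIoo p r)
    (hpq : c.lobeMap i p ≠ c.lobeMap i q) (hqr : c.lobeMap i q ≠ c.lobeMap i r)
    (hpr : c.lobeMap i p ≠ c.lobeMap i r) :
    c.lobeMap i q ∈ Set.cIoo (c.lobeMap i p) (c.lobeMap i r) := by
  obtain ⟨h1, h2⟩ := c.arcVol_of_lobeMap_ne hpq
  obtain ⟨h3, -⟩ := c.arcVol_of_lobeMap_ne hqr
  obtain ⟨-, h4⟩ := c.arcVol_of_lobeMap_ne hpr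
  have hv : 0 < volume.real (c.region i) :=
    measureReal_nonneg.lt_of_ne (c.volume_region_ne i).symm
  rw [mem_cIoo_iff, h2, h4, arcVol_add h]
  exact ⟨div_pos h1 hv, by gcongr; linarith⟩

lemma mem_cIoo_of_lobeMap {i : Fin n} {p q r : UnitAddCircle}
    (h : c.lobeMap i q ∈ Set.cIoo (c.lobeMap i p) (c.lobeMap i r)) : q ∈ Set.cIoo p r := by
  have hpq : c.lobeMap i p ≠ c.lobeMap i q := fun e => left_not_mem_cIoo _ _ (e ▸ h)
  have hqr : c.lobeMap i q ≠ c.lobeMap i r := fun e => right_not_mem_cIoo _ _ (e ▸ h)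
  have hpr := ne_of_mem_cIoo h
  refine (mem_cIoo_or (x := q) (p := p) (q := r) (fun e => hpq (by rw [e]))
    (fun e => hqr (by rw [e])) (fun e => hpr (by rw [e]))).resolve_right fun h' => ?_
  exact Set.disjoint_left.1 (disjoint_cIoo _ _) h
    (c.lobeMap_mem_cIoo h' hqr.symm hpq.symm hpr.symm)

lemma lift_mem_cIoo_iff {i : Fin n} {x y z : UnitAddCircle} :
    c.lift i y ∈ Set.cIoo (c.lift i x) (c.lift i z) ↔ y ∈ Set.cIoo x z := by
  refine ⟨fun h => ?_, fun h => c.mem_cIoo_of_lobeMap (i := i) (by simpa only [lobeMap_lift])⟩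
  have h1 : x ≠ y := fun e => left_not_mem_cIoo _ _ (e ▸ h)
  have h2 : y ≠ z := fun e => right_not_mem_cIoo _ _ (e ▸ h)
  have h3 : x ≠ z := fun e => ne_of_mem_cIoo h (e ▸ rfl)
  have := c.lobeMap_mem_cIoo (i := i) h
  simp only [lobeMap_lift] at this
  exact this h1 h2 h3

/-- A point that is projected to the point `x` of the `i`-th lobe lies before the interval of the
`i`-th region starting over `x`. -/
lemma mem_cIoo_lift {i : Fin n} {p : UnitAddCircle} {y : UnitAddCircle}
    (hp : p ≠ c.lift i (c.lobeMap i p)) (hy : y ≠ c.lobeMap i p) :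
    p ∈ Set.cIoo (c.lift i y) (c.lift i (c.lobeMap i p)) := by
  set w := c.lift i (c.lobeMap i p) with hw
  have h1 : p ≠ c.lift i y := fun e => hy (by rw [e, lobeMap_lift])
  have h2 : c.lift i y ≠ w := fun e => hy (c.lift_injective i e)
  refine (mem_cIoo_or h1 hp h2).resolve_right fun h => hy ?_
  have h3 : pinch (c.region i) w p = 0 := by
    rw [← lobeMap_sub, hw, lobeMap_lift, sub_self]
  have h4 : arcVol (c.region i) p w = 0 := by
    refine ((pinch_eq_zero_iff_of_ne (c.volume_region_ne i) hp.symm).1 h3).resolve_left ?_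
    refine (arcVol_pos_of_right hp.symm ?_).ne'
    have := c.labelAfter_after w
    rwa [hw, after_lift] at this
  have h6 := arcVol_add (R := c.region i) (cIoo_rotate.1 (cIoo_rotate.1 h))
  have h7 := arcVol_nonneg (R := c.region i) (c.lift i y) w
  have h8 := arcVol_nonneg (R := c.region i) p (c.lift i y)
  have h9 : pinch (c.region i) p (c.lift i y) = 0 :=
    (pinch_eq_zero_iff (c.volume_region_ne i)).2 (Or.inl (by linarith))
  rw [← lobeMap_sub, lobeMap_lift] at h9
  exact sub_eq_zero.1 h9

lemma lobeMap_add_coe {i : Fin n} {p : UnitAddCircle} (h : c.after p = i) :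
    ∀ᶠ s : ℝ in 𝓝[>] 0, c.lobeMap i (p + (s : UnitAddCircle)) =
      c.lobeMap i p + ((s / volume.real (c.region i) : ℝ) : UnitAddCircle) := by
  subst h
  filter_upwards [eventually_pinch_add_eq (c.labelAfter_after p)] with s hs
  rw [← lobeMap_add, hs]

end lift

variable {m : ℕ} {k : Fin m → ℕ} (c : MarkedDiagram m) (d : ∀ i, MarkedDiagram (k i))

/-- The chords of the patching. -/
abbrev PatchIndex (k : Fin m → ℕ) : Type := Fin (m - 1) ⊕ (Σ i, Fin (k i - 1))

/-- The end points of the chords of the patching. -/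
def patchPt : PatchIndex k → Bool → UnitAddCircle
  | Sum.inl j, b => c.pt j b
  | Sum.inr x, b => c.lift x.1 ((d x.1).pt x.2 b)

/-- The labels of the patching. -/
def patchLab : PatchIndex k → Bool → Fin (∑ i, k i)
  -- Inner end points over a contracted chord are attached by `lift` at the start of the next
  -- interval of the region. The inner region that then still touches the outer chord is the one
  -- ending at this point, whence `before`.
  | Sum.inl j, b => finSigmaFinEquiv
      ⟨c.lab j b, (d (c.lab j b)).before (c.lobeMap (c.lab j b) (c.pt j b))⟩
  | Sum.inr x, b => finSigmaFinEquiv ⟨x.1, (d x.1).lab x.2 b⟩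

lemma pos {n : ℕ} (c : MarkedDiagram n) : 0 < n := (c.after 0).pos

lemma card_patchIndex (hm : 0 < m) (hk : ∀ i, 0 < k i) :
    Fintype.card (PatchIndex k) = Fintype.card (Fin ((∑ i, k i) - 1)) := by
  have h1 : ∑ i, (k i - 1) + m = ∑ i, k i := by
    have : ∑ i, (k i - 1) + ∑ _ : Fin m, 1 = ∑ i, k i := by
      rw [← Finset.sum_add_distrib]
      exact Finset.sum_congr rfl fun i _ => Nat.sub_add_cancel (hk i)
    simpa using this
  simp only [Fintype.card_sum, Fintype.card_sigma, Fintype.card_fin]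
  omega

lemma patchPt_ne (j : PatchIndex k) : patchPt c d j false ≠ patchPt c d j true := by
  rcases j with j | ⟨i, j⟩
  · exact c.ne j
  · exact fun h => (d i).ne j (c.lift_injective i h)

/-- Both ends of an inner chord are followed by points of the same region of `c`, which lies on one
side of the outer chord. -/
lemma patchPt_flat_outer (j : Fin (m - 1)) (x : Σ i, Fin (k i - 1)) (b b' : Bool) :
    ¬ (patchPt c d (Sum.inr x) b ∈ chordArc c.pt j b' ∧
      patchPt c d (Sum.inr x) (!b) ∈ chordArc c.pt j (!b')) := by
  rintro ⟨h1, h2⟩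
  have hmem : ∀ b, ∀ᶠ s : ℝ in 𝓝[>] 0,
      patchPt c d (Sum.inr x) b + (s : UnitAddCircle) ∈ c.region x.1 := fun b => by
    have := c.labelAfter_after (patchPt c d (Sum.inr x) b)
    rwa [show c.after (patchPt c d (Sum.inr x) b) = x.1 from c.after_lift _ _] at this
  obtain ⟨s, h3, h4, h5, h6⟩ := ((hmem b).and ((hmem (!b)).and
    (((tendsto_add_coe _).eventually ((isOpen_cIoo _ _).mem_nhds h1)).and
    ((tendsto_add_coe _).eventually ((isOpen_cIoo _ _).mem_nhds h2))))).exists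
  exact c.not_mem_chordArc_not (c.same_side h3 h4 h5) h6

lemma patchPt_flat (x y : PatchIndex k) (b : Bool) :
    ¬ (patchPt c d y b ∈ Set.cIoo (patchPt c d x false) (patchPt c d x true) ∧
      patchPt c d y (!b) ∈ Set.cIoo (patchPt c d x true) (patchPt c d x false)) := by
  rintro ⟨h1, h2⟩
  rcases x with j | ⟨i, j⟩
  · rcases y with j' | y
    · exact c.flat j j' b ⟨h1, h2⟩
    · exact patchPt_flat_outer c d j y b false ⟨h1, h2⟩
  · rcases y with j' | ⟨i', j'⟩
    · obtain ⟨h3, h4⟩ := crossing_symm h1 h2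
      refine patchPt_flat_outer c d j' ⟨i, j⟩ false (!b) ⟨?_, ?_⟩
      · rw [chordArc, Bool.not_not]; exact h3
      · rw [Bool.not_not]; exact h4
    · by_cases hi : i = i'
      · subst hi
        exact (d i).flat j j' b ⟨c.lift_mem_cIoo_iff.1 h1, c.lift_mem_cIoo_iff.1 h2⟩
      · refine hi ?_
        have h := c.labeling.noncrossing _ _ _ _
          (show c.after _ = c.after _ from (c.after_lift i ((d i).pt j false)).trans
            (c.after_lift i ((d i).pt j true)).symm)
          (show c.after _ = c.after _ from (c.after_lift i' ((d i').pt j' b)).trans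
            (c.after_lift i' ((d i').pt j' (!b))).symm) h1 h2
        exact (c.after_lift i _).symm.trans (h.trans (c.after_lift i' _))

lemma mem_arc_of_mem_region {i : Fin m} {l : Fin (k i)} {p : UnitAddCircle} (hp : p ∈ c.region i)
    (hl : c.lobeMap i p ∈ (d i).region l) (x : PatchIndex k) (b : Bool)
    (hx : patchLab c d x b = finSigmaFinEquiv ⟨i, l⟩) :
    p ∈ Set.cIoo (patchPt c d x b) (patchPt c d x (!b)) := by
  rcases x with j | ⟨i', j⟩
  · have h := congrArg Sigma.fst (finSigmaFinEquiv.injective hx)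
    exact c.region_subset h hp
  · have h := finSigmaFinEquiv.injective hx
    obtain rfl : i' = i := congrArg Sigma.fst h
    have h' : (d i').lab j b = l := eq_of_heq (Sigma.mk.inj h).2
    refine c.mem_cIoo_of_lobeMap (i := i') ?_
    simp only [patchPt, lobeMap_lift]
    exact (d i').region_subset h' hl

lemma lobeMap_not_mem_vertices {i : Fin m} {p : UnitAddCircle} (hp : p ∈ c.region i)
    (h : ∀ x b, p ≠ patchPt c d x b) : c.lobeMap i p ∉ (d i).vertices := by
  rintro ⟨j, b, e⟩
  refine h (Sum.inr ⟨i, j⟩) b ?_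
  change p = c.lift i ((d i).pt j b)
  rw [← e, c.lift_lobeMap hp]

/-- Points in the patched region with other labels are separated by a chord of the patching. -/
lemma exists_patch_separating {i i' : Fin m} {l : Fin (k i)} {l' : Fin (k i')} {p : UnitAddCircle}
    (hp : p ∈ c.region i') (hl : c.lobeMap i' p ∈ (d i').region l')
    (hne : (⟨i, l⟩ : Σ i, Fin (k i)) ≠ ⟨i', l'⟩) :
    ∃ x b, patchLab c d x b = finSigmaFinEquiv ⟨i, l⟩ ∧
      p ∈ Set.cIoo (patchPt c d x (!b)) (patchPt c d x b) := by
  by_cases hi : i = i'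
  · subst hi
    have hll : c.lobeMap i p ∉ (d i).region l := fun h =>
      hne (by rw [(d i).region_disjoint h hl])
    obtain ⟨j, b, h1, h2⟩ := (d i).exists_separating ((d i).not_vertex_of_mem_region hl) hll
    refine ⟨Sum.inr ⟨i, j⟩, b, congrArg (fun l => finSigmaFinEquiv ⟨i, l⟩) h1, ?_⟩
    refine c.mem_cIoo_of_lobeMap (i := i) ?_
    simp only [patchPt, lobeMap_lift]
    rwa [chordArc, Bool.not_not] at h2
  have hpi : p ∉ c.region i := fun h => hi (c.region_disjoint h hp)
  -- Here `p` is outside the `i`-th region and is projected to a point of its loop. If the inner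
  -- region `l` ends there, it borders the outer chords leading to `p`; if not, an inner chord
  -- bounding `l` separates it from the inner region ending there.
  by_cases hb : (d i).before (c.lobeMap i p) = l
  · obtain ⟨j, b, h1, h2⟩ := c.exists_separating (c.not_vertex_of_mem_region hp) hpi
    rw [chordArc, Bool.not_not] at h2
    refine ⟨Sum.inl j, b, ?_, h2⟩
    subst h1
    have h3 : c.lobeMap (c.lab j b) (c.pt j b) = c.lobeMap (c.lab j b) p := by
      rw [← sub_eq_zero, lobeMap_sub, pinch_eq_zero_iff (c.volume_region_ne _)]
      left
      have h4 := arcVol_add (R := c.region (c.lab j b)) h2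
      have h5 : arcVol (c.region (c.lab j b)) (c.pt j (!b)) (c.pt j b) = 0 :=
        arcVol_eq_zero_of_disjoint fun x hx hx' =>
          Set.disjoint_left.1 (disjoint_cIoo _ _) hx (c.region_subset rfl hx')
      have := arcVol_nonneg (R := c.region (c.lab j b)) (c.pt j (!b)) p
      have := arcVol_nonneg (R := c.region (c.lab j b)) p (c.pt j b)
      linarith
    simp only [patchLab, h3, hb]
  · set y := c.lobeMap i p with hy
    obtain ⟨s₀, hs₀⟩ := ((d i).labelBefore_before y).exists
    obtain ⟨j, b, h1, h2⟩ := (d i).exists_separating ((d i).not_vertex_of_mem_region hs₀)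
      (fun h => hb ((d i).region_disjoint hs₀ h))
    have h3 : ∀ᶠ s : ℝ in 𝓝[>] 0, y - (s : UnitAddCircle) ∈ chordArc (d i).pt j (!b) :=
      ((d i).labelBefore_before y).mono fun s hs => (d i).same_side hs₀ hs h2
    refine ⟨Sum.inr ⟨i, j⟩, b, congrArg (fun l => finSigmaFinEquiv ⟨i, l⟩) h1, ?_⟩
    -- When the separating inner chord has an end exactly over the projection of `p`, that end was
    -- lifted past `p`, so `p` is still on the side of the region that ends there.
    by_cases hyb : y = (d i).pt j b
    · have h4 : p ≠ c.lift i (c.lobeMap i p) := fun e => by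
        have h5 := c.after_eq_of_mem hp
        rw [e, after_lift] at h5
        exact hi h5
      have h6 := c.mem_cIoo_lift h4 (y := (d i).pt j (!b)) (by
        rw [← hy, hyb]; exact ((d i).pt_ne j b).symm)
      rw [← hy, hyb] at h6
      exact h6
    · have hyb' : y ≠ (d i).pt j (!b) := fun e => by
        obtain ⟨s, h4, h5⟩ := (h3.and ((d i).eventually_sub_mem_chordArc j (!b))).exists
        rw [e] at h4
        exact (d i).not_mem_chordArc_not h4 h5
      refine c.mem_cIoo_of_lobeMap (i := i) ?_
      simp only [patchPt, lobeMap_lift]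
      refine (mem_cIoo_or hyb hyb' ((d i).pt_ne j b)).resolve_left fun h4 => ?_
      obtain ⟨s, h5, h6⟩ := (h3.and (tendsto_sub_coe _ ((isOpen_cIoo _ _).mem_nhds h4))).exists
      exact (d i).not_mem_chordArc_not h5 (by rw [Bool.not_not]; exact h6)

/-- The diagram obtained by patching the diagrams `d i` into the regions of `c`. -/
lemma exists_isPatching : ∃ e, c.IsPatching d e := by
  let f : PatchIndex k ≃ Fin ((∑ i, k i) - 1) :=
    Fintype.equivOfCardEq (card_patchIndex c.pos fun i => (d i).pos)
  let pt : Fin ((∑ i, k i) - 1) → Bool → UnitAddCircle := fun j b => patchPt c d (f.symm j) b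
  let lab : Fin ((∑ i, k i) - 1) → Bool → Fin (∑ i, k i) := fun j b => patchLab c d (f.symm j) b
  have hsub : ∀ (i : Fin m) (l : Fin (k i)) (p : UnitAddCircle), p ∈ c.region i →
      c.lobeMap i p ∈ (d i).region l → p ∈ openRegion pt lab (finSigmaFinEquiv ⟨i, l⟩) :=
    fun i l p hp hl j b hj => mem_arc_of_mem_region c d hp hl (f.symm j) b hj
  have hexists : ∀ p, (∀ j b, p ≠ pt j b) → ∃ (i : Fin m) (l : Fin (k i)), p ∈ c.region i ∧
      c.lobeMap i p ∈ (d i).region l := fun p hp => by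
    have hp' : ∀ x b, p ≠ patchPt c d x b := fun x b => by
      have := hp (f x) b
      simpa only [pt, Equiv.symm_apply_apply] using this
    obtain ⟨i, hi, -⟩ := c.existsUnique_region p fun j b => hp' (Sum.inl j) b
    obtain ⟨l, hl, -⟩ := (d i).existsUnique_mem (lobeMap_not_mem_vertices c d hi hp')
    exact ⟨i, l, hi, hl⟩
  have huniq : ∀ (i : Fin m) (l : Fin (k i)) (p : UnitAddCircle), p ∈ c.region i →
      c.lobeMap i p ∈ (d i).region l → ∀ y, p ∈ openRegion pt lab y →
      y = finSigmaFinEquiv ⟨i, l⟩ := fun i l p hp hl y hy => by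
    obtain ⟨⟨i', l'⟩, rfl⟩ := finSigmaFinEquiv.surjective y
    by_contra hne
    obtain ⟨x, b, h1, h2⟩ := exists_patch_separating c d hp hl
      (fun e => hne (congrArg finSigmaFinEquiv e))
    have h3 := hy (f x) b (by simp only [lab, Equiv.symm_apply_apply]; exact h1)
    simp only [chordArc, pt, Equiv.symm_apply_apply] at h3
    exact Set.disjoint_left.1 (disjoint_cIoo _ _) h2 h3
  have hpos : ∀ y, 0 < volume (openRegion pt lab y) := fun y => by
    obtain ⟨⟨i, l⟩, rfl⟩ := finSigmaFinEquiv.surjective y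
    obtain ⟨x, hx, -⟩ := (d i).exists_mem_region l
    refine (isOpen_openRegion lab _ pt).measure_pos volume ?_
    have h1 := c.labelAfter_after (c.lift i x)
    rw [after_lift] at h1
    have h2 := c.lobeMap_add_coe (c.after_lift i x)
    have hv : 0 < volume.real (c.region i) :=
      measureReal_nonneg.lt_of_ne (c.volume_region_ne i).symm
    have h3 := BoundaryTrace.eventually_div hv
      (tendsto_add_coe x (((d i).isOpen_region l).mem_nhds hx))
    obtain ⟨s, h4, h5, h6⟩ := (h1.and (h2.and h3)).exists
    refine ⟨_, hsub i l _ h4 ?_⟩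
    rw [h5, lobeMap_lift]
    exact h6
  let e : ChordDiagram (∑ i, k i) := ⟨pt, lab, fun j => patchPt_ne c d _,
    fun i j b => patchPt_flat c d _ _ b, fun p hp => by
      obtain ⟨i, l, hi, hl⟩ := hexists p hp
      exact ⟨_, hsub i l p hi hl, huniq i l p hi hl⟩, hpos⟩
  have hz : ∀ i l, c.lift i ((d i).z l) ∈ e.closedRegion (finSigmaFinEquiv ⟨i, l⟩) := by
    intro i l j b hj
    suffices key : ∀ x, patchLab c d x b = finSigmaFinEquiv ⟨i, l⟩ →
        c.lift i ((d i).z l) ∈ Set.cIcc (patchPt c d x b) (patchPt c d x (!b)) from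
      key _ hj
    rintro (j | ⟨i', j⟩) hj'
    · have h := congrArg Sigma.fst (finSigmaFinEquiv.injective hj')
      exact c.mem_closedRegion_of_after (c.after_lift i _) j b h
    · have h := finSigmaFinEquiv.injective hj'
      obtain rfl : i' = i := congrArg Sigma.fst h
      have h' : (d i').lab j b = l := eq_of_heq (Sigma.mk.inj h).2
      have h'' := (d i').z_mem l j b h'
      rw [mem_cIcc_iff_not] at h'' ⊢
      exact fun h => h'' (c.lift_mem_cIoo_iff.1 h)
  refine ⟨⟨e, fun y => c.lift (finSigmaFinEquiv.symm y).1
    ((d _).z (finSigmaFinEquiv.symm y).2), fun y => ?_⟩, ⟨f, fun j b => ?_, fun i j b => ?_⟩,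
    fun i l p hp => ?_, fun i l => ?_⟩
  · have := hz (finSigmaFinEquiv.symm y).1 (finSigmaFinEquiv.symm y).2
    rwa [Sigma.eta, Equiv.apply_symm_apply] at this
  · simp only [e, pt, Equiv.symm_apply_apply]; rfl
  · simp only [e, pt, Equiv.symm_apply_apply]
    exact ⟨c.mem_closedRegion_of_after (c.after_lift i _), c.lobeMap_lift _ _⟩
  · obtain ⟨i', l', h1, h2⟩ := hexists p (e.ne_pt (e.not_vertex_of_mem_region hp))
    have h3 := finSigmaFinEquiv.injective (huniq i' l' p h1 h2 _ hp)
    obtain rfl : i = i' := congrArg Sigma.fst h3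
    obtain rfl : l = l' := eq_of_heq (Sigma.mk.inj h3).2
    exact ⟨h1, h2⟩
  · have key : ∀ y : Σ i, Fin (k i), y = ⟨i, l⟩ → c.lift y.1 ((d y.1).z y.2) ∈ c.closedRegion i ∧
        c.lobeMap i (c.lift y.1 ((d y.1).z y.2)) = (d i).z l := by
      rintro _ rfl
      exact ⟨c.mem_closedRegion_of_after (c.after_lift i _), c.lobeMap_lift _ _⟩
    exact key _ (Equiv.symm_apply_apply _ _)

variable {c d}

/-- The label after a point in a patching. -/
lemma IsPatching.after {e : MarkedDiagram (∑ i, k i)} (h : c.IsPatching d e) (t : UnitAddCircle) :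
    e.after t = finSigmaFinEquiv
      ⟨c.after t, (d (c.after t)).after (c.lobeMap (c.after t) t)⟩ := by
  obtain ⟨⟨i, l⟩, hil⟩ := finSigmaFinEquiv.surjective (e.after t)
  have h1 : ∀ᶠ s : ℝ in 𝓝[>] 0, t + (s : UnitAddCircle) ∈ c.region i ∧
      c.lobeMap i (t + (s : UnitAddCircle)) ∈ (d i).region l :=
    (e.labelAfter_after t).mono fun s hs => h.2.1 i l _ (by rw [hil]; exact hs)
  have hi : c.after t = i := ChordDiagram.LabelAfter.eq_after (h1.mono fun _ h => h.1)
  subst hi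
  have hv : 0 < volume.real (c.region (c.after t)) :=
    measureReal_nonneg.lt_of_ne (c.volume_region_ne _).symm
  obtain ⟨s, h2, h3, h4⟩ := (h1.and ((c.lobeMap_add_coe rfl).and (BoundaryTrace.eventually_div hv
    ((d (c.after t)).labelAfter_after (c.lobeMap (c.after t) t))))).exists
  rw [h3] at h2
  rw [← hil, (d _).region_disjoint h2.2 h4]

lemma comp_trace_toCactus : (BoundaryTrace.comp c.trace fun i => (d i).trace).toCactus =
    c.toCactus.comp fun i => (d i).toCactus := by
  refine Cactus.ext_pinchingMap (funext fun l => ContinuousMap.ext fun t => ?_)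
  rw [BoundaryTrace.pinchingMap_apply, BoundaryTrace.comp_f, Cactus.comp_pinchingMap]
  simp only [ContinuousMap.comp_apply, toCactus_pinchingMap, trace_f, Function.comp_apply]

/-- The contraction of a patching is the composite of the contractions. -/
lemma IsPatching.toCactus_eq {e : MarkedDiagram (∑ i, k i)} (h : c.IsPatching d e) :
    e.toCactus = c.toCactus.comp fun i => (d i).toCactus := by
  rw [← comp_trace_toCactus]
  -- The labels along the circle agree by `IsPatching.after`, and at its own mark each pinching map
  -- vanishes on both sides.
  refine BoundaryTrace.toCactus_eq (fun t => ?_) fun l => ⟨e.z l, ?_⟩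
  · rw [trace_φ, h.after]
    have key : ∀ x : LobePoint m, x = (c.after t, c.lobeMap (c.after t) t) →
        finSigmaFinEquiv ⟨c.after t, (d (c.after t)).after (c.lobeMap (c.after t) t)⟩ =
          (BoundaryTrace.incl x.1 ((d x.1).trace.φ x.2)).1 := by
      rintro _ rfl
      rw [trace_φ]; rfl
    exact key _ (c.trace_φ t)
  · rw [trace_f, lobeMap_z]
    obtain ⟨⟨i, l⟩, rfl⟩ := finSigmaFinEquiv.surjective l
    have h1 := Cactus.comp_pinchingMap_mk c.toCactus (fun i => (d i).toCactus) i l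
    rw [← comp_trace_toCactus] at h1
    have h2 := congrArg (fun g => g (e.z (finSigmaFinEquiv ⟨i, l⟩))) h1
    simp only [BoundaryTrace.pinchingMap_apply, ContinuousMap.comp_apply,
      toCactus_pinchingMap] at h2
    rw [h2, (h.2.2 i l).2, lobeMap_z]

end MarkedDiagram

end

noncomputable section


/-! # The operad of marked chord diagrams -/

namespace MarkedDiagram

/-- Renumbering the regions. -/
def relabel {n : ℕ} (c : MarkedDiagram n) (σ : Equiv.Perm (Fin n)) : MarkedDiagram n :=
  have h : ∀ k, openRegion c.pt (fun j b => σ.symm (c.lab j b)) k = c.region (σ k) := fun k => by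
    simp only [openRegion, ChordDiagram.region, Equiv.symm_apply_eq]
  { pt := c.pt
    lab := fun j b => σ.symm (c.lab j b)
    ne := c.ne
    flat := c.flat
    existsUnique_region := fun p hp => by
      obtain ⟨k, hk, huniq⟩ := c.existsUnique_region p hp
      refine ⟨σ.symm k, ?_, fun k' hk' => ?_⟩
      · simp only [h, Equiv.apply_symm_apply]
        exact hk
      · simp only [h] at hk'
        exact (Equiv.eq_symm_apply σ).2 (huniq _ hk')
    region_pos := fun k => by
      rw [h]
      exact c.region_pos _
    z := fun i => c.z (σ i)
    z_mem := fun i j b hj => c.z_mem (σ i) j b (σ.symm_apply_eq.1 hj) }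

lemma isRelabeling_relabel {n : ℕ} (c : MarkedDiagram n) (σ : Equiv.Perm (Fin n)) :
    c.IsRelabeling σ (c.relabel σ) := ⟨rfl, fun _ _ => rfl, fun _ => rfl⟩

lemma relabel_toCactus {n : ℕ} (c : MarkedDiagram n) (σ : Equiv.Perm (Fin n)) :
    (c.relabel σ).toCactus = c.toCactus.act σ := by
  have h : ∀ k, (c.relabel σ).region k = c.region (σ k) := fun k => by
    simp only [relabel, openRegion, ChordDiagram.region, Equiv.symm_apply_eq]
  refine Cactus.ext_pinchingMap (funext fun i => ContinuousMap.ext fun t => ?_)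
  rw [Cactus.act_pinchingMap, toCactus_pinchingMap, toCactus_pinchingMap, lobeMap_eq_pinch, h]
  rfl

/-- The diagram without chords with marked point `u`. -/
def unit : MarkedDiagram 1 where
  pt j := j.elim0
  lab j := j.elim0
  ne j := j.elim0
  flat i := i.elim0
  existsUnique_region _ _ := ⟨0, fun j => j.elim0, fun _ _ => Subsingleton.elim _ _⟩
  region_pos k := by
    have h : openRegion (n := 1) (fun j => j.elim0) (fun j => j.elim0) k = Set.univ :=
      Set.eq_univ_of_forall fun _ j => j.elim0
    rw [h, AddCircle.measure_univ]
    simp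
  z _ := 0
  z_mem _ j := j.elim0

lemma unit_toCactus : unit.toCactus = Cactus.unit := by
  refine Cactus.ext_pinchingMap (funext fun i => ContinuousMap.ext fun t => ?_)
  have h : unit.region i = Set.univ := Set.eq_univ_of_forall fun _ j => j.elim0
  rw [Cactus.unit_pinchingMap, toCactus_pinchingMap, lobeMap, h, volume_real_univ_circle,
    Set.univ_inter, volume_real_cIoo, div_one, coe_ccw]
  exact sub_zero t

end MarkedDiagram

/-! ### Transport of operad structures along homeomorphisms -/

section transport

variable {O O' : ℕ → Type} [∀ n, TopologicalSpace (O n)] [∀ n, TopologicalSpace (O' n)]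

lemma heq_symm_of_heq (h : ∀ n, O n ≃ₜ O' n) {a b : ℕ} (hab : a = b) {x : O' a} {y : O b}
    (hxy : HEq x (h b y)) : HEq ((h a).symm x) y := by
  subst hab
  rw [eq_of_heq hxy, Homeomorph.symm_apply_apply]

lemma reindexAlong_symm (h : ∀ n, O n ≃ₜ O' n)
    (act : ∀ {n : ℕ}, O' n → Equiv.Perm (Fin n) → O' n) {a b : ℕ} (e : Fin a ≃ Fin b) (x : O b) :
    reindexAlong (fun {n} x σ => (h n).symm (act (h n x) σ)) e x =
      (h a).symm (reindexAlong act e (h b x)) := by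
  obtain rfl : b = a := by simpa using (Fintype.card_congr e).symm
  rfl

/-- Transport of an operad structure along homeomorphisms. -/
def TopOperad.transport (Q : TopOperad O') (h : ∀ n, O n ≃ₜ O' n) : TopOperad O where
  act {n} x σ := (h n).symm (Q.act (h n x) σ)
  comp {_ _} x y := (h _).symm (Q.comp (h _ x) fun i => h _ (y i))
  unit := (h 1).symm Q.unit
  continuous_act σ := (h _).symm.continuous.comp ((Q.continuous_act σ).comp (h _).continuous)
  continuous_comp := (h _).symm.continuous.comp (Q.continuous_comp.comp
    (((h _).continuous.comp continuous_fst).prodMk (continuous_pi fun i =>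
      (h _).continuous.comp ((continuous_apply i).comp continuous_snd))))
  act_one x := by rw [Q.act_one, Homeomorph.symm_apply_apply]
  act_mul x σ τ := by rw [Q.act_mul, Homeomorph.apply_symm_apply]
  unit_comp {n} y := heq_symm_of_heq h (by simp) (by
    rw [Homeomorph.apply_symm_apply]; exact Q.unit_comp _)
  comp_unit {n} x := heq_symm_of_heq h (by simp) (by
    simp only [Homeomorph.apply_symm_apply]; exact Q.comp_unit _)
  comp_assoc {m k q} x y z := by
    refine heq_symm_of_heq h ?_ ?_
    · rw [← Fintype.sum_sigma (f := fun y : (Σ i, Fin (k i)) => q y.1 y.2)]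
      exact Equiv.sum_comp finSigmaFinEquiv.symm (fun y : (Σ i, Fin (k i)) => q y.1 y.2)
    · simp only [Homeomorph.apply_symm_apply]
      exact Q.comp_assoc (h m x) (fun i => h (k i) (y i)) fun i j => h (q i j) (z i j)
  act_comp x y σ := by
    rw [reindexAlong_symm h Q.act, Homeomorph.apply_symm_apply, Homeomorph.apply_symm_apply,
      ← Q.act_comp]
  comp_act x y τ := by
    simp only [Homeomorph.apply_symm_apply]
    rw [← Q.comp_act]

end transport

/-- The operad of marked chord diagrams. -/
def MD.operad : TopOperad MD := Cactus.operad.transport MD.homeomorphCactus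

/-- The structure is defined through cacti, so the content is that contraction carries renumbering,
patching and the empty diagram to the operations of cacti. Any two patchings have the same
contraction, hence define the same point of `MD`. -/
lemma MD.operad_isMarkedChordDiagramOperad : IsMarkedChordDiagramOperad MD.operad := by
  refine ⟨fun n c σ => ⟨c.relabel σ, c.isRelabeling_relabel σ, ?_⟩, fun m k c d =>
    ⟨c.exists_isPatching d, fun e he => ?_⟩, MarkedDiagram.unit, rfl, ?_⟩
  · exact (Homeomorph.symm_apply_eq _).2 (c.relabel_toCactus σ).symm
  · exact (Homeomorph.symm_apply_eq _).2 he.toCactus_eq.symm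
  · exact (Homeomorph.symm_apply_eq _).2 MarkedDiagram.unit_toCactus.symm

theorem mainTheorem4 :
    ∃ (P : TopOperad MD) (Q : TopOperad Cactus)
      (δ : ∀ n : ℕ, MC n → Cactus n) (δbar : ∀ n : ℕ, MD n ≃ₜ Cactus n),
      IsMarkedChordDiagramOperad P ∧ IsCactusOperad Q ∧
      (∀ (n : ℕ) (c : MarkedDiagram n), IsContraction c (δ n (MC.mk c))) ∧
      (∀ n : ℕ, IsQuotientMap (δ n)) ∧
      (∀ (n : ℕ) (x : MC n), δ n x = δbar n x.toMD) ∧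
      (∀ (n : ℕ) (x : MD n) (σ : Equiv.Perm (Fin n)),
        δbar n (P.act x σ) = Q.act (δbar n x) σ) ∧
      (∀ (m : ℕ) (k : Fin m → ℕ) (x : MD m) (y : ∀ i, MD (k i)),
        δbar (∑ i, k i) (P.comp x y) = Q.comp (δbar m x) (fun i => δbar (k i) (y i))) ∧
      δbar 1 P.unit = Q.unit :=
  ⟨MD.operad, Cactus.operad, fun _ => MC.toCactus, MD.homeomorphCactus,
    MD.operad_isMarkedChordDiagramOperad, Cactus.operad_isCactusOperad,
    fun _ c => c.isContraction, fun _ => MC.isQuotientMap_toCactus, fun _ _ => rfl,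
    fun n _ _ => (MD.homeomorphCactus n).apply_symm_apply _,
    fun _ _ _ _ => (MD.homeomorphCactus _).apply_symm_apply _,
    (MD.homeomorphCactus 1).apply_symm_apply _⟩

end
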